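/- **Setup.** Let $n\ge 0$, let $q_1,\dots,q_{n-1}$, $x_1,\dots,x_n$, $y_1,y_2,\dots$ and $t_w$ ($w\in S_n$) be independent variables, and let $w_0$ be the longest element of $S_n$. For $k\ge 0$ let $\Delta_k(t\,|\,x_1,\dots,x_k)=\sum_{i=0}^k e_i(x_1,\dots,x_k|q)\,t^{k-i}$ be the determinant of the tridiagonal $k\times k$ matrix with diagonal entries $x_i+t$, entries $q_i$ at the places $(i,i+1)$ and entries $-1$ at the places $(i+1,i)$. Put $\tilde e_i=e_i(x_1,\dots,x_n|q)$ and let $\tilde I_n=(\tilde e_1,\dots,\tilde e_n)$. The quantum Schubert polynomials are $$\tilde{\mathfrak S}_w(x)=\Bigl(\partial^{(y)}_{ww_0}\prod_{i=1}^{n-1}\Delta_i(y_{n-i}\,|\,x_1,\dots,x_i)\Bigr)\Big|_{y=0},\qquad w\in S_n ,$$ where $\partial_k^{(y)}f=(f-s_kf)/(y_k-y_{k+1})$ and $\partial_u^{(y)}=\partial_{a_1}^{(y)}\cdots\partial_{a_p}^{(y)}$ for a reduced word $s_{a_1}\cdots s_{a_p}$ of $u$. Let $\delta_n=(n-1,\dots,1,0)$.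 Modulo $\tilde I_n$, every $f\in\mathbb Q[q][x]$ is congruent to a unique $\mathbb Q[q]$-linear combination $[f]$ of the monomials $x^I$, $I\subseteq\delta_n$. Let $$K(x,t)=\Bigl[\exp\Bigl(\sum_{w\in S_n}t_w\tilde{\mathfrak S}_w(x)\Bigr)\Bigr],$$ the projection being applied to each coefficient of the power series in $t$. Let $E$ be the field of fractions of $\mathbb Q[q][[t_w: w\in S_n]]$, let $\langle\cdot\rangle_{\tilde I_n}: E[x_1,\dots,x_n]\to E$ be the Grothendieck residue with respect to $\tilde e_1,\dots,\tilde e_n$, and put $\langle f,g\rangle_t=\langle fg\,K(x,t)\rangle_{\tilde I_n}$ for $f,g\in E[x_1,\dots,x_n]$. For $v\in S_n$ let $c(v)\subseteq\delta_n$ be the code of $v$, $c(v)_i=\#\{j>i: v(j)<v(i)\}$. Let $X_v^t\in E[x_1,\dots,x_n]$, $v\in S_n$, be the (not normalized) Gram–Schmidt orthogonalization of the monomials $x^{c(v)}$, taken in increasing lexicographic order of the exponents, with respect to $\langle\ ,\ \rangle_t$. Put $\mathcal F_v(t)=\langle X_v^t,X_v^t\rangle_t$ and $\mathfrak F=\mathrm{diag}(\mathcal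 F_v,\ v\in S_n)$. **Statement.** All $\mathcal F_v$ are nonzero and $\langle X_u^t,X_v^t\rangle_t=0$ for $u\ne v$. For each $w\in S_n$ there are unique matrices $L_w=((L_w)_{vu})$ and $M_w=((M_w)_{vu})$, $u,v\in S_n$, with entries in $E$, such that for all $v\in S_n$ $$\tilde{\mathfrak S}_w X_v^t\equiv\sum_{u}(L_w)_{vu}X_u^t \pmod{\tilde I_n},\qquad \frac{\partial}{\partial t_w}X_v^t=\sum_u (M_w)_{vu}X_u^t .$$ Put $\tilde L_w=L_w\mathfrak F$ and $\tilde M_w=M_w\mathfrak F$. Then $\tilde L_w$ is symmetric, that is, $(L_w)_{uv}\mathcal F_v=(L_w)_{vu}\mathcal F_u$ for all $u,v$; consequently $L_w$ is symmetrizable (its product with some invertible diagonal matrix is symmetric). Moreover, with $\tilde M_w'$ the transpose of $\tilde M_w$, $$\tilde M_w+\tilde M_w'+\tilde L_w=\frac{\partial}{\partial t_w}\mathfrak F .$$ -/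

import Mathlib

noncomputable section

namespace FlagLax

/-! ### Divided differences -/

/-- The division underlying the divided difference operator is always exact. -/
theorem exists_divDiff {S : Type*} [CommRing S] (k : ℕ) (f : MvPolynomial ℕ S) :
    ∃ g : MvPolynomial ℕ S,
      (MvPolynomial.X k - MvPolynomial.X (k + 1)) * g
        = f - MvPolynomial.rename (Equiv.swap k (k + 1)) f := by
  induction f using MvPolynomial.induction_on with
  | C a => exact ⟨0, by simp⟩
  | add p q hp hq =>
    obtain ⟨g, hg⟩ := hp
    obtain ⟨h, hh⟩ := hq
    exact ⟨g + h, by rw [mul_add, hg, hh, map_add]; ring⟩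
  | mul_X p i hp =>
    obtain ⟨g, hg⟩ := hp
    have hX : ∃ h : MvPolynomial ℕ S,
        (MvPolynomial.X k - MvPolynomial.X (k + 1)) * h
          = MvPolynomial.X i - MvPolynomial.X (Equiv.swap k (k + 1) i) := by
      by_cases h1 : i = k
      · subst h1; exact ⟨1, by simp⟩
      · by_cases h2 : i = k + 1
        · subst h2; exact ⟨-1, by simp⟩
        · exact ⟨0, by rw [Equiv.swap_apply_of_ne_of_ne h1 h2]; simp⟩
    obtain ⟨h, hh⟩ := hX
    refine ⟨g * MvPolynomial.X i
      + MvPolynomial.rename (Equiv.swap k (k + 1)) p * h, ?_⟩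
    rw [map_mul, MvPolynomial.rename_X]
    linear_combination (MvPolynomial.X i) * hg
      + MvPolynomial.rename (Equiv.swap k (k + 1)) p * hh

/-- The divided difference `∂ₖ f = (f - sₖ f) / (yₖ - yₖ₊₁)`, where `sₖ` exchanges
the variables `yₖ` and `yₖ₊₁`. -/
def divDiff {S : Type*} [CommRing S] (k : ℕ) (f : MvPolynomial ℕ S) : MvPolynomial ℕ S :=
  (exists_divDiff k f).choose

theorem divDiff_spec {S : Type*} [CommRing S] (k : ℕ) (f : MvPolynomial ℕ S) :
    (MvPolynomial.X k - MvPolynomial.X (k + 1)) * divDiff k f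
      = f - MvPolynomial.rename (Equiv.swap k (k + 1)) f :=
  (exists_divDiff k f).choose_spec

/-- The Lehmer code `c(w)`: `c(w)ᵢ` is the number of `j > i` with `w j < w i`. -/
def code {n : ℕ} (w : Equiv.Perm (Fin n)) (i : Fin n) : ℕ :=
  (Finset.univ.filter fun j : Fin n => i < j ∧ w j < w i).card

/-- The list `[k + c - 1, …, k + 1, k]`. -/
def block (k c : ℕ) : List ℕ := (List.range' k c).reverse

/-- The reduced word of `w` attached to its code: the concatenation, for `i = 0, 1, …, n - 1`, of
the blocks `i + c(w)ᵢ - 1, …, i + 1, i`. A letter `k` stands for the transposition of `k` and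
`k + 1`. The length of this word is the sum of the code, the number of inversions of `w`;
`prod_reducedWord` below says that it is a word for `w`. -/
def reducedWord {n : ℕ} (w : Equiv.Perm (Fin n)) : List ℕ :=
  (List.finRange n).flatMap fun i : Fin n => block (i : ℕ) (code w i)

/-- The permutation of `ℕ` spelled by a word in the adjacent transpositions. -/
def wordProd (l : List ℕ) : Equiv.Perm ℕ := (l.map fun k => Equiv.swap k (k + 1)).prod

/-- The operator `∂_w = ∂_{a₁} ∂_{a₂} ⋯ ∂_{aₚ}`, for a reduced word `a₁ a₂ … aₚ` of `w`
(by the braid relations the operator does not depend on the reduced word). -/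
def permDivDiff {S : Type*} [CommRing S] {n : ℕ} (w : Equiv.Perm (Fin n))
    (f : MvPolynomial ℕ S) : MvPolynomial ℕ S :=
  (reducedWord w).foldr divDiff f

theorem wordProd_append (l l' : List ℕ) : wordProd (l ++ l') = wordProd l * wordProd l' := by
  simp [wordProd]

theorem wordProd_block (k c m : ℕ) : wordProd (block k c) m =
    if m = k then k + c else if k < m ∧ m ≤ k + c then m - 1 else m := by
  induction c with
  | zero =>
    simp only [block, wordProd, List.range'_zero, List.reverse_nil, List.map_nil, List.prod_nil,
      Equiv.Perm.one_apply]
    split_ifs <;> omega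
  | succ c ih =>
    have h : block k (c + 1) = [k + c] ++ block k c := by
      simp [block, List.range'_concat]
    rw [h, wordProd_append, Equiv.Perm.mul_apply, ih]
    simp only [wordProd, List.map_cons, List.map_nil, List.prod_cons, List.prod_nil, mul_one,
      Equiv.swap_apply_def]
    split_ifs <;> omega

theorem wordProd_suffix {n : ℕ} (w : Equiv.Perm (Fin n)) (l : List (Fin n)) (k : ℕ)
    (hl : List.finRange n = (List.finRange n).take k ++ l) (hk : k + l.length = n) (j : Fin n) :
    wordProd (l.flatMap fun i : Fin n => block (i : ℕ) (code w i)) j =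
      if (j : ℕ) < k then (j : ℕ) else
        k + (Finset.univ.filter fun i : Fin n => k ≤ (i : ℕ) ∧ w i < w j).card := by
  induction l generalizing k j with
  | nil =>
    have : (j : ℕ) < k := by have := j.2; simp at hk; omega
    simp [this, wordProd]
  | cons i l ih =>
    have hkn : k < n := by simp at hk; omega
    have hi : (i : ℕ) = k := by
      have := congrArg (fun L => L[k]?) hl
      simp [hkn, Nat.min_eq_left hkn.le] at this
      rw [← this]
    have hl' : List.finRange n = (List.finRange n).take (k+1) ++ l := by
      have h2 : (List.finRange n).drop k = i :: l := by
        have := List.take_append_drop k (List.finRange n)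
        exact List.append_cancel_left (this.trans hl)
      have h3 : (List.finRange n).drop (k+1) = l := by
        rw [← List.drop_drop, h2]; simp
      rw [← h3, List.take_append_drop]
    have ih := ih (k+1) hl' (by simp at hk; omega) j
    rw [List.flatMap_cons, wordProd_append, Equiv.Perm.mul_apply, ih, wordProd_block, hi]
    have hcode : code w i = (Finset.univ.filter fun m : Fin n => k + 1 ≤ (m : ℕ) ∧ w m < w i).card := by
      unfold code
      congr 1
      ext m
      simp only [Finset.mem_filter, Finset.mem_univ, true_and, Fin.lt_def, hi, Nat.succ_le_iff]
    have hcount : ∀ m : Fin n,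
        (Finset.univ.filter fun a : Fin n => k ≤ (a : ℕ) ∧ w a < w m).card =
        (Finset.univ.filter fun a : Fin n => k + 1 ≤ (a : ℕ) ∧ w a < w m).card
          + if w i < w m then 1 else 0 := by
      intro m
      split_ifs with h
      · rw [← Finset.card_insert_of_notMem (a := i)]
        · congr 1
          ext a
          simp only [Finset.mem_filter, Finset.mem_univ, true_and, Finset.mem_insert]
          constructor
          · rintro ⟨h1, h2⟩
            by_cases h3 : a = i
            · exact Or.inl h3
            · have : (a : ℕ) ≠ i := fun h => h3 (Fin.ext h)
              exact Or.inr ⟨by omega, h2⟩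
          · rintro (rfl | ⟨h1, h2⟩)
            · exact ⟨by omega, h⟩
            · exact ⟨by omega, h2⟩
        · simp [hi]
      · rw [add_zero]
        congr 1
        ext a
        simp only [Finset.mem_filter, Finset.mem_univ, true_and]
        constructor
        · rintro ⟨h1, h2⟩
          have : (a : ℕ) ≠ i := fun h3 => h (by rwa [← Fin.ext h3])
          exact ⟨by omega, h2⟩
        · rintro ⟨h1, h2⟩
          exact ⟨by omega, h2⟩
    rw [hcount j]
    by_cases hj : j = i
    · subst hj
      simp [hi, hcode]
    · have hj' : (j : ℕ) ≠ k := fun h => hj (Fin.ext (h.trans hi.symm))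
      by_cases hjk : (j : ℕ) < k
      · have h1 : (j : ℕ) < k + 1 := by omega
        simp only [h1, hjk, if_true]
        split_ifs <;> omega
      · have h1 : ¬ (j : ℕ) < k + 1 := by omega
        simp only [h1, hjk, if_false]
        rw [hcode]
        rcases lt_or_gt_of_ne (fun h => hj (w.injective h) : w j ≠ w i) with h | h
        · have hlt : (Finset.univ.filter fun a : Fin n => k + 1 ≤ (a : ℕ) ∧ w a < w j).card <
              (Finset.univ.filter fun a : Fin n => k + 1 ≤ (a : ℕ) ∧ w a < w i).card := by
            apply Finset.card_lt_card
            rw [Finset.ssubset_iff_of_subset]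
            · exact ⟨j, by simp; exact ⟨by omega, h⟩, by simp⟩
            · intro a
              simp only [Finset.mem_filter, Finset.mem_univ, true_and]
              exact fun ⟨x, y⟩ => ⟨x, y.trans h⟩
          simp only [not_lt_of_gt h, if_false]
          split_ifs <;> omega
        · have hle : (Finset.univ.filter fun a : Fin n => k + 1 ≤ (a : ℕ) ∧ w a < w i).card ≤
              (Finset.univ.filter fun a : Fin n => k + 1 ≤ (a : ℕ) ∧ w a < w j).card := by
            apply Finset.card_le_card
            intro a
            simp only [Finset.mem_filter, Finset.mem_univ, true_and]
            exact fun ⟨x, y⟩ => ⟨x, y.trans h⟩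
          simp only [h, if_true]
          split_ifs <;> omega

/-- `reducedWord w` is a word for `w`. -/
theorem prod_reducedWord {n : ℕ} (w : Equiv.Perm (Fin n)) (j : Fin n) :
    wordProd (reducedWord w) j = w j := by
  have h := wordProd_suffix w (List.finRange n) 0 (by simp) (by simp) j
  rw [reducedWord, h]
  simp only [Nat.not_lt_zero, if_false, Nat.zero_le, true_and, Nat.zero_add]
  have : (Finset.univ.filter fun i : Fin n => w i < w j) = (Finset.Iio (w j)).map w.symm.toEmbedding := by
    ext a; simp
  rw [this, Finset.card_map, Fin.card_Iio]

/-- The length of `reducedWord w` is the number of inversions of `w`. -/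
theorem length_reducedWord {n : ℕ} (w : Equiv.Perm (Fin n)) :
    (reducedWord w).length = ∑ i, code w i := by
  simp [reducedWord, block, List.length_flatMap, Fin.sum_univ_def]

/-! ### Quantum elementary polynomials and quantum Schubert polynomials -/

/-- The determinant `Δ_k(t | x₁, …, x_k)` (indices shifted to start from `0`): the tridiagonal
matrix with `xᵢ + t` on the diagonal, `qᵢ` above it and `-1` below it. -/
def qDelta {S : Type*} [CommRing S] (x q : ℕ → S) (k : ℕ) (t : S) : S :=
  Matrix.det (Matrix.of fun i j : Fin k =>
    if (j : ℕ) = i then x i + t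
    else if (j : ℕ) = i + 1 then q i
    else if (i : ℕ) = j + 1 then -1
    else 0)

/-- The quantum elementary polynomial `e_i(x₁, …, x_k | q₁, …, q_{k-1})`, the coefficient of
`t ^ (k - i)` in `Δ_k(t | x₁, …, x_k)`. -/
def qElem {S : Type*} [CommRing S] (x q : ℕ → S) (k i : ℕ) : S :=
  (qDelta (fun j => Polynomial.C (x j)) (fun j => Polynomial.C (q j)) k Polynomial.X).coeff (k - i)

/-- The ring `ℚ[q₁, …, q_{n-1}]`. -/
abbrev QRing (n : ℕ) : Type := MvPolynomial (Fin (n - 1)) ℚ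

/-- The ring `ℚ[q₁, …, q_{n-1}][x₁, …, x_n]`. -/
abbrev XRing (n : ℕ) : Type := MvPolynomial (Fin n) (QRing n)

/-- `qVar n i` is the variable `q_{i+1}`. -/
def qVar (n i : ℕ) : QRing n :=
  if h : i < n - 1 then MvPolynomial.X ⟨i, h⟩ else 0

/-- `xVar n i` is the variable `x_{i+1}`. -/
def xVar (n i : ℕ) : XRing n :=
  if h : i < n then MvPolynomial.X ⟨i, h⟩ else 0

/-- The generators `ẽ₁, …, ẽ_n` of the ideal `Ĩ_n`. -/
def eTilde (n : ℕ) (i : Fin n) : XRing n :=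
  qElem (xVar n) (fun j => MvPolynomial.C (qVar n j)) n (i + 1)

/-- The ideal `Ĩ_n` of the quantum cohomology ring. -/
def qIdeal (n : ℕ) : Ideal (XRing n) := Ideal.span (Set.range (eTilde n))

/-- `S̃_{w₀}(x, y) = ∏_{i=1}^{n-1} Δ_i(y_{n-i} | x₁, …, x_i)`, a polynomial in `y` over the ring of
polynomials in `x` and `q`; the variable `y_{j+1}` is `MvPolynomial.X j`, and the factor of
index `k` is the one with `i = k + 1`. -/
def doubleTop (n : ℕ) : MvPolynomial ℕ (XRing n) :=
  ∏ k ∈ Finset.range (n - 1),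
    qDelta (fun j => MvPolynomial.C (xVar n j))
      (fun j => MvPolynomial.C (MvPolynomial.C (qVar n j))) (k + 1) (MvPolynomial.X (n - (k + 1) - 1))

/-- The quantum double Schubert polynomial `S̃_w(x, y) = ∂_{w w₀}^{(y)} S̃_{w₀}(x, y)`. -/
def doubleSchubert {n : ℕ} (w : Equiv.Perm (Fin n)) : MvPolynomial ℕ (XRing n) :=
  permDivDiff (w * Fin.revPerm) (doubleTop n)

/-- The quantum Schubert polynomial `S̃_w(x)`: the specialization of `S̃_w(x, y)` at `y = 0`. -/
def quantumSchubert {n : ℕ} (w : Equiv.Perm (Fin n)) : XRing n :=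
  MvPolynomial.constantCoeff (doubleSchubert w)

/-! ### The kernel -/

/-- `δ_n = (n - 1, n - 2, …, 1, 0)`. -/
def staircase (n : ℕ) : Fin n →₀ ℕ := Finsupp.equivFunOnFinite.symm fun i => n - 1 - i

/-- `H_n[q]`: the `ℚ[q]`-span of the monomials `x^I`, `I ⊆ δ_n`. -/
def staircaseSpan (n : ℕ) : Submodule (QRing n) (XRing n) :=
  Submodule.span (QRing n) ((fun I => MvPolynomial.monomial I 1) '' Set.Iic (staircase n))

open Classical in
/-- The projection `[f]` of `f` to `H_n[q]` modulo `Ĩ_n`: the (unique) element of `H_n[q]`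
congruent to `f`. -/
def proj (n : ℕ) (f : XRing n) : XRing n :=
  if h : ∃ r ∈ staircaseSpan n, f - r ∈ qIdeal n then h.choose else 0

/-- Formal power series over `ℚ[q]` in the variables `t_w`, `w ∈ S_n`. -/
abbrev TRing (n : ℕ) : Type := MvPowerSeries (Equiv.Perm (Fin n)) (QRing n)

/-- The field of fractions of `ℚ[q][[t_w : w ∈ S_n]]`. -/
abbrev TField (n : ℕ) : Type := FractionRing (TRing n)

/-- `exp (∑ t_w S̃_w(x))`, a power series in `t` with coefficients in `ℚ[q][x]`. -/
def expSeries (n : ℕ) : MvPowerSeries (Equiv.Perm (Fin n)) (XRing n) :=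
  (PowerSeries.exp ℚ).subst
    (∑ w : Equiv.Perm (Fin n), MvPowerSeries.C (quantumSchubert w) * MvPowerSeries.X w)

/-- The coefficient of `x^I` in the kernel `K(x, t) = [exp (∑ t_w S̃_w(x))]`, where the projection
`[ ]` is applied to each coefficient of the power series in `t`. -/
def kernelCoeff (n : ℕ) (I : Fin n →₀ ℕ) : TRing n :=
  fun a => MvPolynomial.coeff I (proj n (MvPowerSeries.coeff a (expSeries n)))

/-- The kernel `K(x, t)`, as a polynomial in `x` over the field of fractions of `ℚ[q][[t]]`. -/
def kernel (n : ℕ) : MvPolynomial (Fin n) (TField n) :=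
  ∑ I ∈ Finset.Iic (staircase n),
    MvPolynomial.monomial I (algebraMap (TRing n) (TField n) (kernelCoeff n I))

/-! ### Grothendieck residues -/

/-- A linear functional `τ` on `R[x]`, extended `R[y]`-linearly to `R[y][x]`. -/
def residueExt {R : Type*} [CommRing R] {n : ℕ} (τ : MvPolynomial (Fin n) R →ₗ[R] R)
    (F : MvPolynomial (Fin n) (MvPolynomial (Fin n) R)) : MvPolynomial (Fin n) R :=
  ∑ m ∈ F.support, MvPolynomial.C (τ (MvPolynomial.monomial m 1)) * MvPolynomial.coeff m F

/-- `τ` is the (global) Grothendieck residue of the complete intersection `g₁ = … = g_n = 0`,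
`f ↦ Res [f dx₁ ∧ … ∧ dx_n / g₁, …, g_n]`, in the algebraic form of Scheja and Storch. The
functional `τ` vanishes on the ideal `(g₁, …, g_n)`, and if the `a i j` are polynomials in two
groups of variables `x`, `y` such that `g_i(x) - g_i(y) = ∑ j, a i j * (x_j - y_j)`, then `τ`,
applied in the variables `x` to the Bezoutian `det a`, gives `1` modulo `(g₁(y), …, g_n(y))`.
The class of `det a` does not depend on `a`. Here `R[x, y]` is `R[y][x]`. -/
def IsGrothendieckResidue {R : Type*} [CommRing R] {n : ℕ} (g : Fin n → MvPolynomial (Fin n) R)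
    (τ : MvPolynomial (Fin n) R →ₗ[R] R) : Prop :=
  (∀ f ∈ Ideal.span (Set.range g), τ f = 0) ∧
  ∃ a : Matrix (Fin n) (Fin n) (MvPolynomial (Fin n) (MvPolynomial (Fin n) R)),
    (∀ i, MvPolynomial.map MvPolynomial.C (g i) - MvPolynomial.C (g i)
      = ∑ j, a i j * (MvPolynomial.X j - MvPolynomial.C (MvPolynomial.X j))) ∧
    residueExt τ a.det - 1 ∈ Ideal.span (Set.range g)

open Classical in
/-- The Grothendieck residue with respect to `g₁, …, g_n`. -/
def grothendieckResidue {R : Type*} [CommRing R] {n : ℕ} (g : Fin n → MvPolynomial (Fin n) R) :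
    MvPolynomial (Fin n) R →ₗ[R] R :=
  if h : ∃ τ, IsGrothendieckResidue g τ then h.choose else 0

/-! ### Extension of scalars and derivatives in `t` -/

/-- The inclusion of `ℚ[q]` into the field of fractions of `ℚ[q][[t]]`. -/
def toField (n : ℕ) : QRing n →+* TField n :=
  (algebraMap (TRing n) (TField n)).comp MvPowerSeries.C

/-- The generators of `Ĩ_n`, over the field of fractions of `ℚ[q][[t]]`. -/
def eTildeF (n : ℕ) (i : Fin n) : MvPolynomial (Fin n) (TField n) :=
  MvPolynomial.map (toField n) (eTilde n i)

/-- The ideal `Ĩ_n`, over the field of fractions of `ℚ[q][[t]]`. -/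
def qIdealF (n : ℕ) : Ideal (MvPolynomial (Fin n) (TField n)) :=
  Ideal.span (Set.range (eTildeF n))

/-- The quantum Schubert polynomial `S̃_w(x)`, over the field of fractions of `ℚ[q][[t]]`. -/
def quantumSchubertF {n : ℕ} (w : Equiv.Perm (Fin n)) : MvPolynomial (Fin n) (TField n) :=
  MvPolynomial.map (toField n) (quantumSchubert w)

/-- The pairing `⟨f, g⟩_t = ⟨f g K(x, t)⟩_{Ĩ_n}`. -/
def pairing {n : ℕ} (f g : MvPolynomial (Fin n) (TField n)) : TField n :=
  grothendieckResidue (eTildeF n) (f * g * kernel n)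

/-- The derivative `∂/∂t_w` on the field of fractions of `ℚ[q][[t]]`, given by the quotient rule
(`tDeriv_div` says that it may be computed from any representation as a fraction). -/
def tDeriv {n : ℕ} (w : Equiv.Perm (Fin n)) (z : TField n) : TField n :=
  let s := IsLocalization.sec (nonZeroDivisors (TRing n)) z
  let ι := algebraMap (TRing n) (TField n)
  let D := MvPowerSeries.pderiv (QRing n) w
  (ι (D s.1) * ι s.2 - ι s.1 * ι (D s.2)) / ι s.2 ^ 2

theorem tDeriv_div {n : ℕ} (w : Equiv.Perm (Fin n)) (a b : TRing n) (hb : b ≠ 0) :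
    tDeriv w (algebraMap (TRing n) (TField n) a / algebraMap (TRing n) (TField n) b)
      = (algebraMap (TRing n) (TField n) (MvPowerSeries.pderiv (QRing n) w a)
            * algebraMap (TRing n) (TField n) b
          - algebraMap (TRing n) (TField n) a
            * algebraMap (TRing n) (TField n) (MvPowerSeries.pderiv (QRing n) w b))
        / algebraMap (TRing n) (TField n) b ^ 2 := by
  unfold tDeriv
  set z := algebraMap (TRing n) (TField n) a / algebraMap (TRing n) (TField n) b with hz
  have hs := IsLocalization.sec_spec (nonZeroDivisors (TRing n)) z
  have hinj := IsFractionRing.injective (TRing n) (TField n)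
  set s := IsLocalization.sec (nonZeroDivisors (TRing n)) z with hsdef
  have hs2 : (s.2 : TRing n) ≠ 0 := nonZeroDivisors.ne_zero s.2.2
  have hb' : algebraMap (TRing n) (TField n) b ≠ 0 := fun h => hb (hinj (h.trans (map_zero _).symm))
  have hs2' : algebraMap (TRing n) (TField n) s.2 ≠ 0 := fun h => hs2 (hinj (h.trans (map_zero _).symm))
  have key : a * s.2 = s.1 * b := by
    apply hinj
    rw [map_mul, map_mul, ← hs, hz]
    field_simp
  have key2 := congrArg (MvPowerSeries.pderiv (QRing n) w) key
  simp only [Derivation.leibniz, smul_eq_mul] at key2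
  have k1 := congrArg (algebraMap (TRing n) (TField n)) key
  have k2 := congrArg (algebraMap (TRing n) (TField n)) key2
  simp only [map_mul, map_add] at k1 k2
  dsimp only
  rw [div_eq_div_iff (pow_ne_zero 2 hs2') (pow_ne_zero 2 hb')]
  generalize algebraMap (TRing n) (TField n) (MvPowerSeries.pderiv (QRing n) w s.1) = dp at *
  generalize algebraMap (TRing n) (TField n) (MvPowerSeries.pderiv (QRing n) w s.2) = dr at *
  generalize algebraMap (TRing n) (TField n) (MvPowerSeries.pderiv (QRing n) w a) = da at *
  generalize algebraMap (TRing n) (TField n) (MvPowerSeries.pderiv (QRing n) w b) = db at *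
  clear_value s
  generalize algebraMap (TRing n) (TField n) s.1 = p at *
  generalize algebraMap (TRing n) (TField n) (s.2 : TRing n) = r at *
  generalize algebraMap (TRing n) (TField n) a = a' at *
  generalize algebraMap (TRing n) (TField n) b = b' at *
  linear_combination (-(b' * r)) * k2 + (b' * dr + r * db) * k1

/-- `∂f/∂t_w` for a polynomial `f` in `x`: differentiate the coefficients. -/
def tDerivPoly {n : ℕ} (w : Equiv.Perm (Fin n)) (f : MvPolynomial (Fin n) (TField n)) :
    MvPolynomial (Fin n) (TField n) :=
  ∑ m ∈ f.support, MvPolynomial.monomial m (tDeriv w (MvPolynomial.coeff m f))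

/-! ### The deformation `X_w^t` and the matrices `L_w`, `M_w` -/

/-- Gram-Schmidt orthogonalization (without normalization) of the vectors `b v`, taken in
increasing order of `key v`, with respect to the bilinear form `B`. -/
def formGramSchmidt {ι κ K V : Type*} [Fintype ι] [LinearOrder κ] [WellFoundedLT κ] [Field K]
    [AddCommGroup V] [Module K V] (key : ι → κ) (B : V → V → K) (b : ι → V) (v : ι) : V :=
  b v - ∑ u : {u : ι // key u < key v},
    (B (b v) (formGramSchmidt key B b u) /
      B (formGramSchmidt key B b u) (formGramSchmidt key B b u)) •
        formGramSchmidt key B b u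
termination_by WellFounded.wrap (wellFounded_lt (α := κ)) (key v)
decreasing_by all_goals exact u.2

/-- The polynomials `X_v^t(x)`: the Gram-Schmidt orthogonalization, with respect to `⟨ , ⟩_t`, of
the monomials `x^I`, `I ⊆ δ_n`, taken in lexicographic order. The exponents `I ⊆ δ_n` are exactly
the codes `c(v)`, `v ∈ S_n`, and `X_v^t` is the polynomial that comes from `x^{c(v)}`. -/
def Xt {n : ℕ} (v : Equiv.Perm (Fin n)) : MvPolynomial (Fin n) (TField n) :=
  formGramSchmidt (fun v : Equiv.Perm (Fin n) => toLex (code v)) pairing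
    (fun v => MvPolynomial.monomial (Finsupp.equivFunOnFinite.symm (code v)) 1) v

/-- `F_v(t) = ⟨X_v^t, X_v^t⟩_t`. -/
def normF {n : ℕ} (v : Equiv.Perm (Fin n)) : TField n := pairing (Xt v) (Xt v)

/-- The diagonal matrix `𝔉 = diag(F_v)`. -/
def diagF (n : ℕ) : Matrix (Equiv.Perm (Fin n)) (Equiv.Perm (Fin n)) (TField n) :=
  Matrix.diagonal normF

/-- `L` is the matrix `L_w` of the multiplication by `S̃_w`: in the quantum cohomology ring,
`S̃_w X_v^t = ∑ u, L v u • X_u^t` for all `v`. -/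
def IsMulMatrix {n : ℕ} (w : Equiv.Perm (Fin n))
    (L : Matrix (Equiv.Perm (Fin n)) (Equiv.Perm (Fin n)) (TField n)) : Prop :=
  ∀ v, Ideal.Quotient.mk (qIdealF n) (quantumSchubertF w * Xt v)
    = Ideal.Quotient.mk (qIdealF n) (∑ u, L v u • Xt u)

/-- `M` is the matrix `M_w` of the derivative in `t_w`:
`∂X_v^t/∂t_w = ∑ u, M v u • X_u^t` for all `v`. -/
def IsDerivMatrix {n : ℕ} (w : Equiv.Perm (Fin n))
    (M : Matrix (Equiv.Perm (Fin n)) (Equiv.Perm (Fin n)) (TField n)) : Prop :=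
  ∀ v, tDerivPoly w (Xt v) = ∑ u, M v u • Xt u

/-- A square matrix is symmetrizable if its product with some invertible diagonal matrix is
symmetric. -/
def IsSymmetrizable {ι K : Type*} [Fintype ι] [DecidableEq ι] [Field K] (A : Matrix ι ι K) :
    Prop :=
  ∃ d : ι → K, (∀ i, d i ≠ 0) ∧ (A * Matrix.diagonal d).IsSymm

end FlagLax

end

/-! Multiplication is self-adjoint for the pairing. So once the `X_v^t` are known to be orthogonal
with nonzero norms, and to span the monomials `x^I`, `I ⊆ δ_n`, one has `(L_w)_{vu} F_u = ⟨S̃_w X_v,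
X_u⟩` and `(M_w)_{vu} F_u = ⟨∂X_v, X_u⟩` (`IsMulMatrix.mul_normF`, `IsDerivMatrix.mul_normF`). This
gives uniqueness of both matrices and the symmetry of `L_w 𝔉`. The last identity is the Leibniz rule
for `∂⟨X_u, X_v⟩` (`tDeriv_pairing`): the residue is defined over `ℚ[q]`, so it commutes with
`∂/∂t_w`, and the kernel contributes multiplication by `S̃_w` because `∂K/∂t_w ≡ S̃_w K` modulo the
ideal (`tDerivPoly_kernel_sub_mem`).

The residue is made explicit by passing to generators with leading monomials `x_i^{n+1-i}`
(`triGen_hasLead`). For such generators the residue is the coefficient of `x^δ` in the normal form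
(`isGrothendieckResidue_nfCoeff`). The change of generators has determinant `±1` and costs only a
sign (`IsGrothendieckResidue.transform`), and the Bezoutian property determines the residue
(`IsGrothendieckResidue.unique`).

The main point is that no norm vanishes. This reduces to the minors of the Gram matrix of the
monomials on initial segments of the order (`formGramSchmidt_spec`). At `t = 0` such minors can
vanish (`⟨1, 1⟩ = 0` for `n ≥ 2`), so the dependence on `t` is essential. Up to a common sign, the
entry at `(u, v)` is the coefficient of `x^δ` in the normal form of `x^{c(u)+c(v)} exp(∑ t_w S̃_w)`.
Keep only the variables `t_w` with `S̃_w = x₁ + ⋯ + x_i`, `0 < i < n`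
(`exists_quantumSchubert_eq_sum`); the leading monomial of this `S̃_w` is `x_i`. If `t_w` is graded
by `x_i`, the lowest term of the entry has coefficient `∏ 1/(δ_i - c(u)_i - c(v)_i)!`
(`kernelSeries_lowTerm`). The products in the expansion of a minor share the same lowest degree, so
the lowest coefficient of the minor is a determinant of inverse factorials. That matrix factors into
diagonal and unitriangular binomial matrices (`det_invFactorial_ne_zero`). -/

noncomputable section

namespace FlagLax

open MvPolynomial

section

/-! ### A degree order on monomials -/

/-- The degree-lexicographic monomial order on `x₁, …, x_n` with `x₁ < x₂ < … < x_n`. -/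
def revDegLex (n : ℕ) : MonomialOrder (Fin n) where
  syn := DegLex ((Fin n)ᵒᵈ →₀ ℕ)
  -- In `degLex` the first variable is the largest. The order dual makes `x_i` the largest among
  -- `x₁, …, x_i`, so that `x₁ + ⋯ + x_i` and the complete homogeneous polynomials in `x₁, …, x_i`
  -- have pure powers of `x_i` as leading monomials.
  toSyn := (Finsupp.domCongr OrderDual.toDual).trans MonomialOrder.degLex.toSyn
  toSyn_monotone a b h := by
    apply MonomialOrder.degLex.toSyn_monotone
    intro i
    exact h _

theorem revDegLex_lt_of_degree_lt {n : ℕ} {a b : Fin n →₀ ℕ} (h : a.degree < b.degree) :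
    (revDegLex n).toSyn a < (revDegLex n).toSyn b := by
  have hd : ∀ c : Fin n →₀ ℕ, (Finsupp.domCongr (M := ℕ) (OrderDual.toDual (α := Fin n)) c).degree
      = c.degree := by
    intro c
    rw [Finsupp.degree_eq_sum, Finsupp.degree_eq_sum]
    exact Fintype.sum_equiv OrderDual.ofDual _ _ fun i => rfl
  refine Finsupp.DegLex.lt_iff.2 (Or.inl ?_)
  change (Finsupp.domCongr (M := ℕ) (OrderDual.toDual (α := Fin n)) a).degree <
    (Finsupp.domCongr (M := ℕ) (OrderDual.toDual (α := Fin n)) b).degree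
  rwa [hd, hd]

theorem revDegLex_single_lt {n : ℕ} {i j : Fin n} (h : i < j) :
    (revDegLex n).toSyn (Finsupp.single i 1) < (revDegLex n).toSyn (Finsupp.single j 1) := by
  have := MonomialOrder.degLex_single_lt_iff (a := OrderDual.toDual i) (b := OrderDual.toDual j)
  have h2 := this.2 (by simpa using h)
  change MonomialOrder.degLex.toSyn (Finsupp.domCongr _ _) <
    MonomialOrder.degLex.toSyn (Finsupp.domCongr _ _)
  simpa using h2

variable {R : Type*} [CommRing R] {n : ℕ}

/-- `x^e` is the leading monomial of `f`, with leading coefficient `1`. -/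
def HasLead (m : MonomialOrder (Fin n)) (f : MvPolynomial (Fin n) R) (e : Fin n →₀ ℕ) : Prop :=
  m.toSyn (m.degree f) ≤ m.toSyn e ∧ coeff e f = 1

variable {m : MonomialOrder (Fin n)}

theorem HasLead.mul {f g : MvPolynomial (Fin n) R} {a b : Fin n →₀ ℕ} (hf : HasLead m f a)
    (hg : HasLead m g b) : HasLead m (f * g) (a + b) := by
  refine ⟨m.degree_mul_le.trans ?_, ?_⟩
  · rw [map_add, map_add]; exact add_le_add hf.1 hg.1
  · rw [m.coeff_mul_of_add_of_degree_le hf.1 hg.1, hf.2, hg.2, one_mul]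

theorem HasLead.one : HasLead m (1 : MvPolynomial (Fin n) R) 0 := by
  refine ⟨by simp, by simp⟩

theorem HasLead.pow {f : MvPolynomial (Fin n) R} {a : Fin n →₀ ℕ} (hf : HasLead m f a) (k : ℕ) :
    HasLead m (f ^ k) (k • a) := by
  induction k with
  | zero => simpa using HasLead.one
  | succ k ih => rw [pow_succ, succ_nsmul]; exact ih.mul hf

theorem HasLead.prod {ι : Type*} (s : Finset ι) {f : ι → MvPolynomial (Fin n) R}
    {a : ι → Fin n →₀ ℕ} (h : ∀ i ∈ s, HasLead m (f i) (a i)) :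
    HasLead m (∏ i ∈ s, f i) (∑ i ∈ s, a i) := by
  classical
  induction s using Finset.induction_on with
  | empty => simpa using HasLead.one
  | insert i s hi ih =>
    rw [Finset.prod_insert hi, Finset.sum_insert hi]
    exact (h i (Finset.mem_insert_self _ _)).mul
      (ih fun j hj => h j (Finset.mem_insert_of_mem hj))

theorem HasLead.monomial (e : Fin n →₀ ℕ) : HasLead m (monomial e (1 : R)) e :=
  ⟨m.degree_monomial_le 1, by simp⟩

theorem HasLead.add_of_lt {f g : MvPolynomial (Fin n) R} {a : Fin n →₀ ℕ} (hf : HasLead m f a)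
    (hg : m.toSyn (m.degree g) < m.toSyn a) : HasLead m (f + g) a := by
  refine ⟨m.degree_add_le.trans (sup_le hf.1 hg.le), ?_⟩
  rw [coeff_add, hf.2, m.coeff_eq_zero_of_lt hg, add_zero]

theorem HasLead.map {S : Type*} [CommRing S] {f : MvPolynomial (Fin n) R} {a : Fin n →₀ ℕ}
    (hf : HasLead m f a) (φ : R →+* S) : HasLead m (MvPolynomial.map φ f) a := by
  refine ⟨m.degree_le_iff.2 fun k hk => ?_, by rw [coeff_map, hf.2, map_one]⟩
  exact (m.le_degree (support_map_subset _ _ hk)).trans hf.1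

/-! ### Families of polynomials with all possible leading monomials -/

/-- Leading-term reduction: `x^k` differs from `G k` by strictly smaller monomials, and the order is
well-founded. The bound on the indices is kept for `leadBasis_coord_eq_zero`. -/
theorem mem_span_of_hasLead {G : (Fin n →₀ ℕ) → MvPolynomial (Fin n) R}
    (hG : ∀ k, HasLead m (G k) k) (f : MvPolynomial (Fin n) R) (k : Fin n →₀ ℕ)
    (hf : m.toSyn (m.degree f) ≤ m.toSyn k) :
    f ∈ Submodule.span R (G '' {j | m.toSyn j ≤ m.toSyn k}) := by
  have key : ∀ (s : m.syn) (k : Fin n →₀ ℕ), m.toSyn k = s →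
      MvPolynomial.monomial k (1 : R) ∈ Submodule.span R (G '' {j | m.toSyn j ≤ m.toSyn k}) := by
    intro s
    induction s using WellFoundedLT.induction with
    | ind s ih =>
      intro k hk
      have h1 : MvPolynomial.monomial k (1 : R) = G k - (G k - MvPolynomial.monomial k 1) := by ring
      rw [h1]
      refine Submodule.sub_mem _ (Submodule.subset_span ⟨k, le_refl _, rfl⟩) ?_
      rw [MvPolynomial.as_sum (G k - MvPolynomial.monomial k (1 : R))]
      refine Submodule.sum_mem _ fun j hj => ?_
      have hjk : j ≠ k := by
        rintro rfl
        simp [(hG j).2] at hj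
      have hj2 : coeff j (G k) ≠ 0 := by
        rw [mem_support_iff, coeff_sub, coeff_monomial, if_neg (Ne.symm hjk), sub_zero] at hj
        exact hj
      have hlt : m.toSyn j < m.toSyn k :=
        lt_of_le_of_ne ((m.le_degree (mem_support_iff.2 hj2)).trans (hG k).1)
          fun h => hjk (m.toSyn.injective h)
      have := ih _ (hk ▸ hlt) j rfl
      rw [← mul_one (coeff j _), ← smul_eq_mul, ← smul_monomial]
      refine Submodule.smul_mem _ _ (Submodule.span_mono (Set.image_mono ?_) this)
      exact fun i hi => le_trans hi hlt.le
  rw [f.as_sum]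
  refine Submodule.sum_mem _ fun j hj => ?_
  rw [← mul_one (coeff j _), ← smul_eq_mul, ← smul_monomial]
  refine Submodule.smul_mem _ _ (Submodule.span_mono (Set.image_mono ?_) (key _ j rfl))
  exact fun i hi => le_trans hi ((m.le_degree hj).trans hf)

/-- In a relation, nothing can cancel the leading monomial of the member with the largest index. -/
theorem linearIndependent_of_hasLead {G : (Fin n →₀ ℕ) → MvPolynomial (Fin n) R}
    (hG : ∀ k, HasLead m (G k) k) : LinearIndependent R G := by
  rw [linearIndependent_iff]
  intro c hc
  by_contra hne
  obtain ⟨k, hk, hmax⟩ := c.support.exists_max_image m.toSyn (Finsupp.support_nonempty_iff.2 hne)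
  have h0 : coeff k (Finsupp.linearCombination R G c) = 0 := by rw [hc, coeff_zero]
  rw [Finsupp.linearCombination_apply, Finsupp.sum, coeff_sum, Finset.sum_eq_single k] at h0
  · rw [coeff_smul, (hG k).2, smul_eq_mul, mul_one] at h0
    exact Finsupp.mem_support_iff.1 hk h0
  · intro j hj hjk
    rw [coeff_smul, m.coeff_eq_zero_of_lt, smul_zero]
    exact (hG j).1.trans_lt (lt_of_le_of_ne (hmax j hj) fun h => hjk (m.toSyn.injective h))
  · exact fun h => absurd hk h

/-- The basis of the polynomial ring given by a family with all possible leading monomials. -/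
def leadBasis {G : (Fin n →₀ ℕ) → MvPolynomial (Fin n) R} (hG : ∀ k, HasLead m (G k) k) :
    Module.Basis (Fin n →₀ ℕ) R (MvPolynomial (Fin n) R) :=
  Module.Basis.mk (linearIndependent_of_hasLead hG) fun f _ =>
    Submodule.span_mono (Set.image_subset_range _ _) (mem_span_of_hasLead hG f _ le_rfl)

@[simp]
theorem leadBasis_apply {G : (Fin n →₀ ℕ) → MvPolynomial (Fin n) R}
    (hG : ∀ k, HasLead m (G k) k) (k : Fin n →₀ ℕ) : leadBasis hG k = G k := by
  simp [leadBasis]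

theorem leadBasis_coord_eq_zero {G : (Fin n →₀ ℕ) → MvPolynomial (Fin n) R}
    (hG : ∀ k, HasLead m (G k) k) (f : MvPolynomial (Fin n) R) (k : Fin n →₀ ℕ)
    (hf : m.toSyn (m.degree f) < m.toSyn k) : (leadBasis hG).coord k f = 0 := by
  have h := mem_span_of_hasLead hG f (m.degree f) le_rfl
  refine (LinearMap.mem_ker (f := (leadBasis hG).coord k)).1 ((Submodule.span_le.2 ?_) h)
  rintro _ ⟨j, hj, rfl⟩
  simp only [SetLike.mem_coe, LinearMap.mem_ker]
  rw [← leadBasis_apply hG j, Module.Basis.coord_apply, Module.Basis.repr_self,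
    Finsupp.single_eq_of_ne]
  rintro rfl
  exact absurd hf (not_lt.2 hj)

/-! ### The normal form modulo a sequence with pure leading powers -/

/-- The products of powers of the `r i` with monomials of small exponents. -/
def powerFamily (r : Fin n → MvPolynomial (Fin n) R) (δ : Fin n →₀ ℕ) (k : Fin n →₀ ℕ) :
    MvPolynomial (Fin n) R :=
  ∏ i, (r i ^ (k i / (δ i + 1)) * X i ^ (k i % (δ i + 1)))

theorem powerFamily_hasLead {r : Fin n → MvPolynomial (Fin n) R} {δ : Fin n →₀ ℕ}
    (hr : ∀ i, HasLead m (r i) (Finsupp.single i (δ i + 1))) (k : Fin n →₀ ℕ) :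
    HasLead m (powerFamily r δ k) k := by
  -- Division with remainder of each exponent `k i` by `δ i + 1`.
  have : k = ∑ i, ((k i / (δ i + 1)) • Finsupp.single i (δ i + 1)
      + Finsupp.single i (k i % (δ i + 1))) := by
    ext j
    simp only [Finsupp.coe_finsetSum, Finset.sum_apply, Finsupp.add_apply, Finsupp.smul_apply,
      Finsupp.single_apply, smul_eq_mul, Finset.sum_add_distrib, mul_ite, mul_zero,
      Finset.sum_ite_eq', Finset.mem_univ, if_true]
    exact (Nat.div_add_mod' _ _).symm
  conv_rhs => rw [this]
  refine HasLead.prod _ fun i _ => ((hr i).pow _).mul ?_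
  rw [X_pow_eq_monomial]
  exact HasLead.monomial _

theorem powerFamily_of_le (r : Fin n → MvPolynomial (Fin n) R) {δ k : Fin n →₀ ℕ} (h : k ≤ δ) :
    powerFamily r δ k = MvPolynomial.monomial k 1 := by
  rw [powerFamily, monomial_eq, Finsupp.prod_fintype _ _ (by simp), C_1, one_mul]
  refine Finset.prod_congr rfl fun i _ => ?_
  have := h i
  rw [Nat.div_eq_of_lt (by omega), Nat.mod_eq_of_lt (by omega), pow_zero, one_mul]

/-- Multiplication by `r i` only shifts the index. So the ideal generated by the `r i` is spanned by
the members whose index is not `≤ δ`, and the other members, plain monomials, form a basis of the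
quotient. -/
theorem mul_powerFamily (r : Fin n → MvPolynomial (Fin n) R) (δ k : Fin n →₀ ℕ) (i : Fin n) :
    powerFamily r δ k * r i = powerFamily r δ (k + Finsupp.single i (δ i + 1)) := by
  rw [powerFamily, powerFamily, ← Finset.prod_erase_mul _ _ (Finset.mem_univ i),
    ← Finset.prod_erase_mul (a := i) (Finset.univ) _ (Finset.mem_univ i), mul_assoc]
  congr 1
  · refine Finset.prod_congr rfl fun j hj => ?_
    rw [Finsupp.add_apply, Finsupp.single_eq_of_ne (Finset.ne_of_mem_erase hj), add_zero]
  · rw [Finsupp.add_apply, Finsupp.single_eq_same, Nat.add_div_right _ (Nat.succ_pos _),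
      Nat.add_mod_right, pow_succ]
    ring

theorem powerFamily_mem_ideal (r : Fin n → MvPolynomial (Fin n) R) {δ k : Fin n →₀ ℕ}
    (h : ¬ k ≤ δ) : powerFamily r δ k ∈ Ideal.span (Set.range r) := by
  obtain ⟨i, hi⟩ : ∃ i, δ i < k i := by
    by_contra hc
    push Not at hc
    exact h hc
  have hk : k = (k - Finsupp.single i (δ i + 1)) + Finsupp.single i (δ i + 1) := by
    ext j
    by_cases hj : j = i
    · subst hj; simp; omega
    · simp [Finsupp.single_eq_of_ne hj]
  rw [hk, ← mul_powerFamily]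
  exact Ideal.mul_mem_left _ _ (Ideal.subset_span ⟨i, rfl⟩)

/-- The coefficient of `x^k` in the normal form of a polynomial modulo `r`. -/
def nfCoeff {r : Fin n → MvPolynomial (Fin n) R} {δ : Fin n →₀ ℕ}
    (hr : ∀ i, HasLead m (r i) (Finsupp.single i (δ i + 1))) (k : Fin n →₀ ℕ) :
    MvPolynomial (Fin n) R →ₗ[R] R :=
  (leadBasis (powerFamily_hasLead hr)).coord k

section nf
variable {r : Fin n → MvPolynomial (Fin n) R} {δ : Fin n →₀ ℕ}
    (hr : ∀ i, HasLead m (r i) (Finsupp.single i (δ i + 1)))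
include hr

theorem nfCoeff_powerFamily (k j : Fin n →₀ ℕ) :
    nfCoeff hr k (powerFamily r δ j) = if j = k then 1 else 0 := by
  rw [nfCoeff, ← leadBasis_apply (powerFamily_hasLead hr) j, Module.Basis.coord_apply,
    Module.Basis.repr_self, Finsupp.single_apply]

theorem nfCoeff_monomial_of_le (k : Fin n →₀ ℕ) {j : Fin n →₀ ℕ} (hj : j ≤ δ) :
    nfCoeff hr k (MvPolynomial.monomial j 1) = if j = k then 1 else 0 := by
  rw [← powerFamily_of_le r hj, nfCoeff_powerFamily]

theorem nfCoeff_eq_zero_of_lt {f : MvPolynomial (Fin n) R} {k : Fin n →₀ ℕ}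
    (hf : m.toSyn (m.degree f) < m.toSyn k) : nfCoeff hr k f = 0 :=
  leadBasis_coord_eq_zero _ f k hf

/-- Monomials strictly below `x^δ` do not contribute to the coordinate at `δ`, and `x^δ` is itself a
basis element. -/
theorem nfCoeff_of_degree_le {f : MvPolynomial (Fin n) R}
    (hf : m.toSyn (m.degree f) ≤ m.toSyn δ) : nfCoeff hr δ f = coeff δ f := by
  conv_lhs => rw [f.as_sum, map_sum]
  rw [Finset.sum_eq_single δ]
  · rw [← mul_one (coeff δ f), ← smul_eq_mul, ← smul_monomial, map_smul,
      nfCoeff_monomial_of_le hr _ le_rfl, if_pos rfl]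
  · intro k hk hne
    refine nfCoeff_eq_zero_of_lt hr ((m.degree_monomial_le _).trans_lt ?_)
    exact lt_of_le_of_ne ((m.le_degree hk).trans hf) fun h => hne (m.toSyn.injective h)
  · intro h
    rw [notMem_support_iff.1 h, monomial_zero, map_zero]

/-- A multiple of `r i` involves only basis elements whose `i`-th exponent exceeds `δ i`. -/
theorem nfCoeff_of_mem_ideal {k : Fin n →₀ ℕ} (hk : k ≤ δ) {f : MvPolynomial (Fin n) R}
    (hf : f ∈ Ideal.span (Set.range r)) : nfCoeff hr k f = 0 := by
  obtain ⟨c, rfl⟩ := (Ideal.mem_span_range_iff_exists_fun).1 hf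
  rw [map_sum]
  refine Finset.sum_eq_zero fun i _ => ?_
  have : (nfCoeff hr k).comp (LinearMap.mulRight R (r i)) = 0 := by
    refine (leadBasis (powerFamily_hasLead hr)).ext fun j => ?_
    rw [leadBasis_apply, LinearMap.comp_apply, LinearMap.mulRight_apply, mul_powerFamily,
      nfCoeff_powerFamily, if_neg, LinearMap.zero_apply]
    rintro rfl
    have := hk i
    simp at this
    omega
  exact LinearMap.congr_fun this (c i)

theorem sub_nf_mem_ideal (f : MvPolynomial (Fin n) R) :
    f - ∑ k ∈ Finset.Iic δ, nfCoeff hr k f • MvPolynomial.monomial k 1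
      ∈ Ideal.span (Set.range r) := by
  let b := leadBasis (powerFamily_hasLead hr)
  have key : ∀ f ∈ Submodule.span R (Set.range b),
      f - ∑ k ∈ Finset.Iic δ, nfCoeff hr k f • MvPolynomial.monomial k 1
        ∈ Ideal.span (Set.range r) := by
    intro f hf
    induction hf using Submodule.span_induction with
    | mem x hx =>
      obtain ⟨j, rfl⟩ := hx
      simp only [b, leadBasis_apply, nfCoeff_powerFamily, ite_smul, one_smul, zero_smul,
        Finset.sum_ite_eq, Finset.mem_Iic]
      split_ifs with h
      · rw [powerFamily_of_le r h, sub_self]; exact Ideal.zero_mem _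
      · rw [sub_zero]; exact powerFamily_mem_ideal r h
    | zero => simp
    | add x y _ _ hx hy =>
      have := Ideal.add_mem _ hx hy
      simp only [map_add, add_smul, Finset.sum_add_distrib]
      convert this using 1
      ring
    | smul a x _ hx =>
      have := Ideal.mul_mem_left _ (C a) hx
      rw [← smul_eq_C_mul, smul_sub, Finset.smul_sum] at this
      simpa only [map_smul, smul_assoc] using this
  exact key f (by rw [b.span_eq]; trivial)

/-- The adapted basis is compatible with base change. Hence normal forms of polynomials over `ℚ[q]`
do not acquire any dependence on `t` over the field of fractions. -/
theorem map_nfCoeff {S : Type*} [CommRing S] (φ : R →+* S) {r' : Fin n → MvPolynomial (Fin n) S}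
    (hr' : ∀ i, HasLead m (r' i) (Finsupp.single i (δ i + 1)))
    (h : ∀ i, r' i = MvPolynomial.map φ (r i)) (k : Fin n →₀ ℕ) (f : MvPolynomial (Fin n) R) :
    nfCoeff hr' k (MvPolynomial.map φ f) = φ (nfCoeff hr k f) := by
  let b := leadBasis (powerFamily_hasLead hr)
  have key : ∀ f ∈ Submodule.span R (Set.range b),
      nfCoeff hr' k (MvPolynomial.map φ f) = φ (nfCoeff hr k f) := by
    intro f hf
    induction hf using Submodule.span_induction with
    | mem x hx =>
      obtain ⟨j, rfl⟩ := hx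
      have : MvPolynomial.map φ (powerFamily r δ j) = powerFamily r' δ j := by
        simp [powerFamily, h]
      simp only [b, leadBasis_apply, this, nfCoeff_powerFamily]
      split_ifs <;> simp
    | zero => simp
    | add x y _ _ hx hy => simp only [map_add, hx, hy]
    | smul a x _ hx =>
      simp only [smul_eq_C_mul, map_mul, map_C]
      rw [← smul_eq_C_mul, ← smul_eq_C_mul, map_smul, map_smul, hx, smul_eq_mul, smul_eq_mul,
        map_mul]
  exact key f (by rw [b.span_eq]; trivial)

end nf

end

/-! ### Determinants of matrices annihilating a vector -/

theorem det_updateRow_eq_sum {S : Type*} [CommRing S] {n : ℕ} (A : Matrix (Fin n) (Fin n) S)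
    (i : Fin n) (κ : Fin n → S) :
    (A.updateRow i κ).det = ∑ j, κ j * (A.updateRow i (Pi.single j 1)).det := by
  rw [Matrix.det_eq_sum_mul_adjugate_row _ i]
  simp [Matrix.adjugate_apply]

/-- Cramer's rule: if the rows other than `i` annihilate `d`, the cofactors along row `i` are
proportional to `d`. Apply the adjugate to `Q d`, whose only nonzero entry can be `d j` in place
`i`. -/
theorem det_updateRow_single_mul {S : Type*} [CommRing S] {n : ℕ} (A : Matrix (Fin n) (Fin n) S)
    (d : Fin n → S) (i : Fin n) (h : ∀ l, l ≠ i → ∑ j, A l j * d j = 0) (j k : Fin n) :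
    (A.updateRow i (Pi.single j 1)).det * d k = (A.updateRow i (Pi.single k 1)).det * d j := by
  set Q := A.updateRow i (Pi.single j 1) with hQ
  have h1 : Q.mulVec d = Pi.single i (d j) := by
    ext l
    by_cases hl : l = i
    · subst hl
      simp [hQ, Matrix.mulVec]
    · rw [Pi.single_eq_of_ne hl, ← h l hl]
      simp [hQ, Matrix.mulVec, dotProduct, Matrix.updateRow_ne hl]
  have h2 := congrArg (fun v => Q.adjugate.mulVec v k) h1
  simp only [Matrix.mulVec_mulVec, Matrix.adjugate_mul] at h2
  rw [Matrix.smul_mulVec, Matrix.one_mulVec, Pi.smul_apply, smul_eq_mul] at h2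
  rw [h2, Matrix.mulVec_single]
  simp [Matrix.adjugate_apply, hQ, mul_comm]

/-- A sequence in which `d a * f ∈ (d j, j ∈ T)` implies `f ∈ (d j, j ∈ T)`, `a ∉ T`. -/
def IsPrimeSequence {S : Type*} [CommRing S] {n : ℕ} (d : Fin n → S) : Prop :=
  ∀ (T : Finset (Fin n)) (a : Fin n), a ∉ T → ∀ f, d a * f ∈ Ideal.span (d '' T) →
    f ∈ Ideal.span (d '' T)

theorem isPrimeSequence_X {S : Type*} [CommRing S] {n : ℕ} :
    IsPrimeSequence (X : Fin n → MvPolynomial (Fin n) S) := by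
  intro T a ha f hf
  rw [mem_ideal_span_X_image] at hf ⊢
  intro k hk
  obtain ⟨i, hi, hki⟩ := hf (Finsupp.single a 1 + k) (by
    rw [mem_support_iff, coeff_X_mul]
    exact mem_support_iff.1 hk)
  refine ⟨i, hi, ?_⟩
  rwa [Finsupp.add_apply, Finsupp.single_eq_of_ne, zero_add] at hki
  rintro rfl
  exact ha hi

theorem IsPrimeSequence.of_equiv {S T : Type*} [CommRing S] [CommRing T] {n : ℕ} {d : Fin n → S}
    (e : T ≃+* S) (hd : IsPrimeSequence d) : IsPrimeSequence (fun j => e.symm (d j)) := by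
  intro U a ha f hf
  have key : ∀ g : T, g ∈ Ideal.span ((fun j => e.symm (d j)) '' U) ↔ e g ∈ Ideal.span (d '' U) := by
    intro g
    have h1 : Ideal.span ((fun j => e.symm (d j)) '' U)
        = (Ideal.span (d '' U)).map (e.symm : S →+* T) := by
      rw [Ideal.map_span, Set.image_image]; rfl
    rw [h1]
    constructor
    · intro h
      obtain ⟨x, hx, rfl⟩ := (Ideal.mem_map_of_equiv e.symm g).1 h
      simpa using hx
    · intro h
      exact (Ideal.mem_map_of_equiv e.symm g).2 ⟨e g, h, by simp⟩
  rw [key] at hf ⊢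
  rw [map_mul, RingEquiv.apply_symm_apply] at hf
  exact hd U a ha _ hf

theorem isPrimeSequence_X_sub_C {S : Type*} [CommRing S] {n : ℕ} (c : Fin n → S) :
    IsPrimeSequence (fun j => X j - C (c j) : Fin n → MvPolynomial (Fin n) S) := by
  let e : MvPolynomial (Fin n) S ≃ₐ[S] MvPolynomial (Fin n) S :=
    AlgEquiv.ofAlgHom (aeval fun j => X j + C (c j)) (aeval fun j => X j - C (c j))
      (by ext j; simp [algebraMap_eq]) (by ext j; simp [algebraMap_eq])
  have := isPrimeSequence_X.of_equiv (S := MvPolynomial (Fin n) S) (n := n) e.toRingEquiv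
  convert this using 2 with j
  change _ = (aeval fun j => X j - C (c j)) (X j)
  simp

/-- The relations among the `d j` are generated by the Koszul relations, and `hc` says that `c`
kills those. The induction removes one index `a` at a time: `κ a` is a combination of the remaining
`d j`, and its coefficients are absorbed into the remaining `κ j`. -/
theorem IsPrimeSequence.sum_eq_zero {S T : Type*} [CommRing S] [CommRing T] {n : ℕ} {d : Fin n → S}
    (hd : IsPrimeSequence d) (π : S →+* T) (c : Fin n → T)
    (hc : ∀ j k, c j * π (d k) = c k * π (d j)) (U : Finset (Fin n)) (κ : Fin n → S)
    (h : ∑ j ∈ U, κ j * d j = 0) : ∑ j ∈ U, π (κ j) * c j = 0 := by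
  induction U using Finset.induction_on generalizing κ with
  | empty => simp
  | insert a U ha ih =>
    rw [Finset.sum_insert ha] at h ⊢
    have h1 : κ a ∈ Ideal.span (d '' U) := by
      refine hd U a ha _ ?_
      have : d a * κ a = ∑ j ∈ U, (- κ j) * d j := by
        simp only [neg_mul, Finset.sum_neg_distrib]
        linear_combination h
      rw [this]
      exact Ideal.sum_mem _ fun j hj => Ideal.mul_mem_left _ _
        (Ideal.subset_span ⟨j, hj, rfl⟩)
    obtain ⟨b, hb⟩ : ∃ b : Fin n → S, ∑ j ∈ U, b j * d j = κ a := by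
      obtain ⟨b, hb⟩ := (Submodule.mem_span_image_finset_iff_exists_fun S).1 h1
      refine ⟨fun j => if hj : j ∈ U then b ⟨j, hj⟩ else 0, ?_⟩
      rw [← hb, ← Finset.sum_coe_sort]
      exact Finset.sum_congr rfl fun j _ => by simp
    have h2 := ih (fun j => κ j + b j * d a) (by
      rw [← h, ← hb, Finset.sum_mul, ← Finset.sum_add_distrib]
      exact Finset.sum_congr rfl fun j _ => by ring)
    rw [← hb, map_sum, Finset.sum_mul, ← Finset.sum_add_distrib, ← h2]
    refine Finset.sum_congr rfl fun j _ => ?_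
    rw [map_add, map_mul, map_mul]
    linear_combination (- π (b j)) * hc j a

/-- The rows are exchanged one by one. The difference of two rows is a relation among the `d j`, and
the cofactors are proportional to the image of `d` since all rows annihilate it under `π`. -/
theorem IsPrimeSequence.det_eq {S T : Type*} [CommRing S] [CommRing T] {n : ℕ} {d : Fin n → S}
    (hd : IsPrimeSequence d) (π : S →+* T) (a a' : Matrix (Fin n) (Fin n) S)
    (h : ∀ i, ∑ j, a i j * d j = ∑ j, a' i j * d j) (h0 : ∀ i, π (∑ j, a i j * d j) = 0) :
    π a.det = π a'.det := by
  let hyb : Finset (Fin n) → Matrix (Fin n) (Fin n) S := fun s i => if i ∈ s then a' i else a i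
  have key : ∀ s, π (hyb s).det = π a.det := by
    intro s
    induction s using Finset.induction_on with
    | empty => congr 2
    | insert i s hi ih =>
      rw [← ih]
      have e1 : hyb (insert i s) = (hyb s).updateRow i (a' i) := by
        ext l j
        by_cases hl : l = i
        · subst hl; rw [Matrix.updateRow_self]; simp [hyb]
        · rw [Matrix.updateRow_ne hl]; simp [hyb, hl]
      have e2 : hyb s = (hyb s).updateRow i (a i) := by
        ext l j
        by_cases hl : l = i
        · subst hl; rw [Matrix.updateRow_self]; simp [hyb, hi]
        · rw [Matrix.updateRow_ne hl]
      have e3 : ∀ κ : Fin n → S, π ((hyb s).updateRow i κ).det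
          = ∑ j, π (κ j) * ((((hyb s).map π).updateRow i (Pi.single j 1)).det) := by
        intro κ
        rw [RingHom.map_det, RingHom.mapMatrix_apply, Matrix.map_updateRow, det_updateRow_eq_sum]
        rfl
      rw [e1, e3]
      conv_rhs => rw [e2, e3]
      rw [← sub_eq_zero, ← Finset.sum_sub_distrib]
      have := hd.sum_eq_zero π (fun j => (((hyb s).map π).updateRow i (Pi.single j 1)).det)
        (fun j k => det_updateRow_single_mul ((hyb s).map π) (fun j => π (d j)) i
          (fun l _ => by
            have h1 : ∑ j, (hyb s).map π l j * π (d j) = π (∑ j, hyb s l j * d j) := by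
              simp [map_sum]
            rw [h1]
            by_cases hl : l ∈ s
            · simp only [hyb, hl, if_true]; rw [← h, h0]
            · simp only [hyb, hl, if_false]; rw [h0]) j k)
        Finset.univ (fun j => a' i j - a i j) (by
          simp only [sub_mul, Finset.sum_sub_distrib, h i, sub_self])
      rw [← this]
      exact Finset.sum_congr rfl fun j _ => by rw [map_sub]; ring
  rw [← key Finset.univ]
  congr 2
  ext i j
  simp [hyb]

/-! ### Uniqueness of the Grothendieck residue -/

section residue
variable {R : Type*} [CommRing R] {n : ℕ} (τ : MvPolynomial (Fin n) R →ₗ[R] R)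

theorem residueExt_eq_sum {F : MvPolynomial (Fin n) (MvPolynomial (Fin n) R)}
    {s : Finset (Fin n →₀ ℕ)} (h : F.support ⊆ s) :
    residueExt τ F = ∑ m ∈ s, C (τ (monomial m 1)) * coeff m F :=
  Finset.sum_subset h fun m _ hm => by rw [notMem_support_iff.1 hm, mul_zero]

theorem residueExt_add (F G : MvPolynomial (Fin n) (MvPolynomial (Fin n) R)) :
    residueExt τ (F + G) = residueExt τ F + residueExt τ G := by
  classical
  rw [residueExt_eq_sum τ (support_add (p := F) (q := G)),
    residueExt_eq_sum τ (Finset.subset_union_left (s₁ := F.support) (s₂ := G.support)),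
    residueExt_eq_sum τ (Finset.subset_union_right (s₁ := F.support) (s₂ := G.support)),
    ← Finset.sum_add_distrib]
  exact Finset.sum_congr rfl fun m _ => by rw [coeff_add, mul_add]

theorem residueExt_C_mul (c : MvPolynomial (Fin n) R)
    (F : MvPolynomial (Fin n) (MvPolynomial (Fin n) R)) :
    residueExt τ (C c * F) = c * residueExt τ F := by
  have : (C c * F).support ⊆ F.support := by
    rw [← smul_eq_C_mul]; exact support_smul
  rw [residueExt_eq_sum τ this, residueExt, Finset.mul_sum]
  exact Finset.sum_congr rfl fun m _ => by rw [coeff_C_mul]; ring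

/-- `residueExt τ` as a linear map. -/
def residueExtLin : MvPolynomial (Fin n) (MvPolynomial (Fin n) R)
    →ₗ[MvPolynomial (Fin n) R] MvPolynomial (Fin n) R where
  toFun := residueExt τ
  map_add' := residueExt_add τ
  map_smul' c F := by rw [smul_eq_C_mul, residueExt_C_mul]; rfl

theorem residueExtLin_apply (F : MvPolynomial (Fin n) (MvPolynomial (Fin n) R)) :
    residueExtLin τ F = residueExt τ F := rfl

theorem residueExt_map (f : MvPolynomial (Fin n) R) : residueExt τ (map C f) = C (τ f) := by
  rw [residueExt_eq_sum τ (support_map_subset _ _)]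
  conv_rhs => rw [f.as_sum, map_sum, map_sum]
  refine Finset.sum_congr rfl fun m _ => ?_
  have : monomial m (coeff m f) = coeff m f • monomial m (1 : R) := by
    rw [smul_monomial, smul_eq_mul, mul_one]
  rw [coeff_map, this, map_smul, smul_eq_mul, ← C_mul, mul_comm]

theorem residueExt_map_mul (f : MvPolynomial (Fin n) R)
    (F : MvPolynomial (Fin n) (MvPolynomial (Fin n) R)) :
    residueExt τ (map C f * F) = ∑ m ∈ F.support, C (τ (f * monomial m 1)) * coeff m F := by
  conv_lhs => rw [F.as_sum, Finset.mul_sum, ← residueExtLin_apply, map_sum]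
  refine Finset.sum_congr rfl fun m _ => ?_
  have : (map C f : MvPolynomial (Fin n) (MvPolynomial (Fin n) R)) * monomial m (coeff m F)
      = C (coeff m F) * map C (f * monomial m 1) := by
    rw [map_mul, map_monomial, C_1, mul_left_comm, C_mul_monomial, mul_one]
  rw [this, residueExtLin_apply, residueExt_C_mul, residueExt_map, mul_comm]

/-- The ideal of `R[x, y]` generated by the `g i (x)` and the `g i (y)`. -/
def doubleIdeal (g : Fin n → MvPolynomial (Fin n) R) :
    Ideal (MvPolynomial (Fin n) (MvPolynomial (Fin n) R)) :=
  (Ideal.span (Set.range g)).map (map C) ⊔ (Ideal.span (Set.range g)).map C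

variable {τ} {g : Fin n → MvPolynomial (Fin n) R}

theorem residueExt_mem (hτ : ∀ f ∈ Ideal.span (Set.range g), τ f = 0)
    {F : MvPolynomial (Fin n) (MvPolynomial (Fin n) R)} (hF : F ∈ doubleIdeal g) :
    residueExt τ F ∈ Ideal.span (Set.range g) := by
  -- The elements all of whose multiples have residue in the ideal form an ideal, so only the two
  -- kinds of generators have to be tested.
  let J : Ideal (MvPolynomial (Fin n) (MvPolynomial (Fin n) R)) :=
    { carrier := {F | ∀ H, residueExt τ (F * H) ∈ Ideal.span (Set.range g)}
      add_mem' := fun {a b} ha hb H => by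
        rw [add_mul, residueExt_add]; exact Ideal.add_mem _ (ha H) (hb H)
      zero_mem' := fun H => by
        rw [zero_mul, ← residueExtLin_apply, map_zero]; exact Ideal.zero_mem _
      smul_mem' := fun c F hF H => by
        have := hF (c * H)
        rwa [smul_eq_mul, mul_comm c F, mul_assoc] }
  have hJ : doubleIdeal g ≤ J := by
    refine sup_le (Ideal.map_le_iff_le_comap.2 fun f hf H => ?_)
      (Ideal.map_le_iff_le_comap.2 fun f hf H => ?_)
    · rw [residueExt_map_mul]
      refine Ideal.sum_mem _ fun m _ => ?_
      rw [hτ _ (Ideal.mul_mem_right _ _ hf), C_0, zero_mul]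
      exact Ideal.zero_mem _
    · rw [residueExt_C_mul]
      exact Ideal.mul_mem_right _ _ hf
  simpa using hJ hF 1

theorem map_C_mem_doubleIdeal {f : MvPolynomial (Fin n) R} (hf : f ∈ Ideal.span (Set.range g)) :
    map C f ∈ doubleIdeal g :=
  Ideal.mem_sup_left (Ideal.mem_map_of_mem _ hf)

theorem C_mem_doubleIdeal {f : MvPolynomial (Fin n) R} (hf : f ∈ Ideal.span (Set.range g)) :
    C f ∈ doubleIdeal g :=
  Ideal.mem_sup_right (Ideal.mem_map_of_mem _ hf)

/-- `a` expresses the differences `g i (x) - g i (y)` in terms of the `x j - y j`. -/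
def IsBezoutMatrix (g : Fin n → MvPolynomial (Fin n) R)
    (a : Matrix (Fin n) (Fin n) (MvPolynomial (Fin n) (MvPolynomial (Fin n) R))) : Prop :=
  ∀ i, map C (g i) - C (g i) = ∑ j, a i j * (X j - C (X j))

theorem IsBezoutMatrix.det_sub_mem
    {a a' : Matrix (Fin n) (Fin n) (MvPolynomial (Fin n) (MvPolynomial (Fin n) R))}
    (ha : IsBezoutMatrix g a) (ha' : IsBezoutMatrix g a') : a.det - a'.det ∈ doubleIdeal g := by
  rw [← Ideal.Quotient.eq]
  refine (isPrimeSequence_X_sub_C (X : Fin n → MvPolynomial (Fin n) R)).det_eq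
    (T := MvPolynomial (Fin n) (MvPolynomial (Fin n) R) ⧸ doubleIdeal g)
    (Ideal.Quotient.mk (doubleIdeal g)) a a'
    (fun i => (ha i).symm.trans (ha' i)) fun i => ?_
  rw [← ha i, Ideal.Quotient.eq_zero_iff_mem]
  exact Ideal.sub_mem _ (map_C_mem_doubleIdeal (Ideal.subset_span ⟨i, rfl⟩))
    (C_mem_doubleIdeal (Ideal.subset_span ⟨i, rfl⟩))

/-- The adjugate turns `a (x - y) = g(x) - g(y)` into `det a · (x_k - y_k) ≡ 0`, and every `f(x) -
f(y)` is a combination of the `x_k - y_k`. -/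
theorem IsBezoutMatrix.sub_mul_det_mem
    {a : Matrix (Fin n) (Fin n) (MvPolynomial (Fin n) (MvPolynomial (Fin n) R))}
    (ha : IsBezoutMatrix g a) (f : MvPolynomial (Fin n) R) :
    (map C f - C f) * a.det ∈ doubleIdeal g := by
  have hX : ∀ k, (X k - C (X k)) * a.det ∈ doubleIdeal g := by
    intro k
    have h1 : a.mulVec (fun j => X j - C (X j)) = fun i => map C (g i) - C (g i) := by
      ext1 i
      exact (ha i).symm
    have h2 := congrArg (fun v => a.adjugate.mulVec v k) h1
    simp only [Matrix.mulVec_mulVec, Matrix.adjugate_mul] at h2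
    rw [Matrix.smul_mulVec, Matrix.one_mulVec, Pi.smul_apply, smul_eq_mul] at h2
    rw [mul_comm, h2, Matrix.mulVec, dotProduct]
    exact Ideal.sum_mem _ fun i _ => Ideal.mul_mem_left _ _ (Ideal.sub_mem _
      (map_C_mem_doubleIdeal (Ideal.subset_span ⟨i, rfl⟩))
      (C_mem_doubleIdeal (Ideal.subset_span ⟨i, rfl⟩)))
  induction f using MvPolynomial.induction_on with
  | C c => simp
  | add p q hp hq =>
    rw [map_add, C_add, add_sub_add_comm, add_mul]
    exact Ideal.add_mem _ hp hq
  | mul_X p k hp =>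
    have : (map C (p * X k) - C (p * X k)) * a.det = map C p * ((X k - C (X k)) * a.det)
        + C (X k) * ((map C p - C p) * a.det) := by
      rw [map_mul, map_X, C_mul]; ring
    rw [this]
    exact Ideal.add_mem _ (Ideal.mul_mem_left _ _ (hX k)) (Ideal.mul_mem_left _ _ hp)

/-- The Bezoutian `D` is a reproducing kernel: `τ`, applied in `x` to `f(x) D`, gives `f(y)` modulo
the ideal. Applying `τ'` in `y` yields `τ' f = τ (f u)` with `u = τ'_y(D)`. The normalization of
`τ'` and the reproducing property for `f = u` force `u ≡ 1`. -/
theorem IsGrothendieckResidue.unique {τ τ' : MvPolynomial (Fin n) R →ₗ[R] R}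
    (h : IsGrothendieckResidue g τ) (h' : IsGrothendieckResidue g τ') : τ = τ' := by
  obtain ⟨hτ, a, ha, hr⟩ := h
  obtain ⟨hτ', a', ha', hr'⟩ := h'
  set D := a.det with hD
  have h1 : ∀ f, residueExt τ (map C f * D) - f ∈ Ideal.span (Set.range g) := by
    intro f
    have e1 := residueExt_mem hτ (IsBezoutMatrix.sub_mul_det_mem ha f)
    rw [sub_mul, ← residueExtLin_apply, map_sub, residueExtLin_apply, residueExtLin_apply,
      residueExt_C_mul] at e1
    have e2 := Ideal.mul_mem_left _ f hr
    have := Ideal.add_mem _ e1 e2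
    convert this using 1
    ring
  set u : MvPolynomial (Fin n) R := ∑ m ∈ D.support, C (τ' (coeff m D)) * monomial m 1 with hu
  have h2 : ∀ f, τ' f = τ (f * u) := by
    intro f
    have e1 := hτ' _ (h1 f)
    rw [map_sub, sub_eq_zero] at e1
    rw [← e1, residueExt_map_mul, hu, Finset.mul_sum, map_sum, map_sum]
    refine Finset.sum_congr rfl fun m _ => ?_
    rw [← smul_eq_C_mul, map_smul, mul_left_comm, ← smul_eq_C_mul, map_smul, smul_eq_mul,
      smul_eq_mul, mul_comm]
  have h3 : u - 1 ∈ Ideal.span (Set.range g) := by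
    -- Here `D` belongs to `τ`, whereas `τ'` is normalized with `a'`; the two Bezoutians agree
    -- modulo `doubleIdeal g`.
    have e1 : residueExt τ' D = residueExt τ (map C u * D) := by
      rw [residueExt_map_mul, residueExt]
      exact Finset.sum_congr rfl fun m _ => by rw [h2, mul_comm u]
    have e2 := residueExt_mem hτ' (IsBezoutMatrix.det_sub_mem ha ha')
    rw [← residueExtLin_apply, map_sub, residueExtLin_apply, residueExtLin_apply] at e2
    have := Ideal.sub_mem _ (Ideal.add_mem _ e2 hr') (h1 u)
    rw [← hD, e1] at this
    convert this using 1
    ring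
  refine LinearMap.ext fun f => ?_
  have e1 := hτ _ (Ideal.mul_mem_left _ f h3)
  rw [mul_sub, mul_one, map_sub, ← h2, sub_eq_zero] at e1
  exact e1.symm

theorem IsGrothendieckResidue.eq {τ : MvPolynomial (Fin n) R →ₗ[R] R}
    (h : IsGrothendieckResidue g τ) : grothendieckResidue g = τ := by
  have hex : ∃ τ, IsGrothendieckResidue g τ := ⟨τ, h⟩
  rw [grothendieckResidue, dif_pos hex]
  exact hex.choose_spec.unique h

end residue

/-! ### Existence of the residue for a sequence with pure leading powers -/

section bezout
variable {R : Type*} [CommRing R] {n : ℕ}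

/-- All monomials `x^α y^β` of `F` satisfy `α + β ∈ S`. -/
def BiSupp (F : MvPolynomial (Fin n) (MvPolynomial (Fin n) R)) (S : Set (Fin n →₀ ℕ)) : Prop :=
  ∀ α β, coeff β (coeff α F) ≠ 0 → α + β ∈ S

theorem BiSupp.mono {F : MvPolynomial (Fin n) (MvPolynomial (Fin n) R)} {S T : Set (Fin n →₀ ℕ)}
    (h : BiSupp F S) (hST : S ⊆ T) : BiSupp F T := fun α β hab => hST (h α β hab)

theorem BiSupp.zero (S : Set (Fin n →₀ ℕ)) :
    BiSupp (0 : MvPolynomial (Fin n) (MvPolynomial (Fin n) R)) S := by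
  intro α β h; simp at h

theorem BiSupp.add {F G : MvPolynomial (Fin n) (MvPolynomial (Fin n) R)} {S : Set (Fin n →₀ ℕ)}
    (hF : BiSupp F S) (hG : BiSupp G S) : BiSupp (F + G) S := by
  intro α β h
  by_cases h1 : coeff β (coeff α F) = 0
  · exact hG α β fun h2 => h (by rw [coeff_add, coeff_add, h1, h2, add_zero])
  · exact hF α β h1

theorem BiSupp.neg {F : MvPolynomial (Fin n) (MvPolynomial (Fin n) R)} {S : Set (Fin n →₀ ℕ)}
    (hF : BiSupp F S) : BiSupp (-F) S := by
  intro α β h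
  exact hF α β fun h2 => h (by rw [coeff_neg, coeff_neg, h2, neg_zero])

theorem BiSupp.sum {ι : Type*} (s : Finset ι)
    {F : ι → MvPolynomial (Fin n) (MvPolynomial (Fin n) R)} {S : Set (Fin n →₀ ℕ)}
    (h : ∀ i ∈ s, BiSupp (F i) S) : BiSupp (∑ i ∈ s, F i) S := by
  classical
  induction s using Finset.induction_on with
  | empty => simpa using BiSupp.zero S
  | insert i s hi ih =>
    rw [Finset.sum_insert hi]
    exact (h i (Finset.mem_insert_self _ _)).add
      (ih fun j hj => h j (Finset.mem_insert_of_mem hj))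

theorem BiSupp.mul {F G : MvPolynomial (Fin n) (MvPolynomial (Fin n) R)} {S T U : Set (Fin n →₀ ℕ)}
    (hF : BiSupp F S) (hG : BiSupp G T) (h : ∀ a ∈ S, ∀ b ∈ T, a + b ∈ U) : BiSupp (F * G) U := by
  intro α β hne
  rw [coeff_mul, coeff_sum] at hne
  obtain ⟨⟨a, a'⟩, ha, hne⟩ := Finset.exists_ne_zero_of_sum_ne_zero hne
  rw [coeff_mul] at hne
  obtain ⟨⟨b, b'⟩, hb, hne⟩ := Finset.exists_ne_zero_of_sum_ne_zero hne
  have h1 := h _ (hF a b (left_ne_zero_of_mul hne)) _ (hG a' b' (right_ne_zero_of_mul hne))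
  rw [← Finset.HasAntidiagonal.mem_antidiagonal.1 ha, ← Finset.HasAntidiagonal.mem_antidiagonal.1 hb]
  convert h1 using 1
  abel

theorem BiSupp.X (i : Fin n) : BiSupp (X i : MvPolynomial (Fin n) (MvPolynomial (Fin n) R))
    {Finsupp.single i 1} := by
  classical
  intro α β h
  rw [coeff_X] at h
  split_ifs at h with h1
  · rw [coeff_one] at h
    split_ifs at h with h2
    · rw [← h1, ← h2, add_zero]; rfl
    · exact absurd rfl h
  · simp at h

theorem BiSupp.C_monomial (k : Fin n →₀ ℕ) :
    BiSupp (C (monomial k (1 : R)) : MvPolynomial (Fin n) (MvPolynomial (Fin n) R)) {k} := by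
  classical
  intro α β h
  rw [coeff_C] at h
  split_ifs at h with h1
  · rw [coeff_monomial] at h
    split_ifs at h with h2
    · rw [← h1, ← h2, zero_add]; rfl
    · exact absurd rfl h
  · simp at h

theorem BiSupp.C_C (c : R) :
    BiSupp (C (C c) : MvPolynomial (Fin n) (MvPolynomial (Fin n) R)) {0} := by
  classical
  intro α β h
  rw [coeff_C] at h
  split_ifs at h with h1
  · rw [MvPolynomial.coeff_C] at h
    split_ifs at h with h2
    · rw [← h1, ← h2, zero_add]; rfl
    · exact absurd rfl h
  · simp at h

/-- Telescoping replaces the factors `x_j` by `y_j` one at a time. Each summand is then a monomial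
with one factor missing, so multiplying by `x_j` restores the total exponent `k`. This control of
the exponents is what bounds the Bezoutian later. -/
theorem exists_bezout_monomial (k : Fin n →₀ ℕ) :
    ∃ b : Fin n → MvPolynomial (Fin n) (MvPolynomial (Fin n) R),
      map C (monomial k (1 : R)) - C (monomial k 1) = ∑ j, b j * (X j - C (X j)) ∧
      ∀ j, BiSupp (b j * X j) {k} := by
  induction k using Finsupp.induction_linear with
  | zero =>
    refine ⟨0, by simp, fun j => ?_⟩
    simpa using BiSupp.zero _
  | add k l hk hl =>
    obtain ⟨b, hb, hb'⟩ := hk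
    obtain ⟨c, hc, hc'⟩ := hl
    have e : monomial (k + l) (1 : R) = monomial k 1 * monomial l 1 := by
      rw [monomial_mul, one_mul]
    refine ⟨fun j => map C (monomial l 1) * b j + C (monomial k 1) * c j, ?_, fun j => ?_⟩
    · have : ∀ j, (map C (monomial l (1 : R)) * b j + C (monomial k 1) * c j) * (X j - C (X j))
          = map C (monomial l (1 : R)) * (b j * (X j - C (X j)))
            + C (monomial k 1) * (c j * (X j - C (X j))) := fun j => by ring
      simp only [this]
      rw [Finset.sum_add_distrib, ← Finset.mul_sum, ← Finset.mul_sum, ← hb, ← hc, e, map_mul,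
        C_mul]
      ring
    · rw [add_mul, mul_assoc, mul_assoc]
      refine BiSupp.add (BiSupp.mul (S := {l}) (T := {k}) ?_ (hb' j) ?_)
        (BiSupp.mul (BiSupp.C_monomial k) (hc' j) ?_)
      · classical
        intro α β h
        rw [map_monomial, C_1, coeff_monomial] at h
        split_ifs at h with h1
        · rw [coeff_one] at h
          split_ifs at h with h2
          · rw [← h1, ← h2, add_zero]; rfl
          · exact absurd rfl h
        · simp at h
      · rintro _ rfl _ rfl
        exact add_comm _ _
      · rintro _ rfl _ rfl
        rfl
  | single i d =>
    induction d with
    | zero =>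
      refine ⟨0, by simp, fun j => ?_⟩
      simpa using BiSupp.zero _
    | succ d ih =>
      obtain ⟨b, hb, hb'⟩ := ih
      refine ⟨fun j => X i * b j + if j = i then C (monomial (Finsupp.single i d) 1) else 0,
        ?_, fun j => ?_⟩
      · have : ∀ j, (X i * b j + if j = i then C (monomial (Finsupp.single i d) (1 : R)) else 0)
            * (X j - C (X j)) = X i * (b j * (X j - C (X j)))
            + if j = i then C (monomial (Finsupp.single i d) 1) * (X j - C (X j)) else 0 := by
          intro j
          split_ifs <;> ring
        simp only [this]
        rw [Finset.sum_add_distrib, ← Finset.mul_sum, ← hb, Finset.sum_ite_eq' Finset.univ i,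
          if_pos (Finset.mem_univ _)]
        have e : monomial (Finsupp.single i (d + 1)) (1 : R)
            = monomial (Finsupp.single i d) 1 * X i := by
          rw [X, monomial_mul, one_mul, ← Finsupp.single_add]
        rw [e, map_mul, C_mul, map_X]
        ring
      · rw [add_mul, mul_assoc]
        refine BiSupp.add (BiSupp.mul (BiSupp.X i) (hb' j) ?_) ?_
        · rintro _ rfl _ rfl
          rw [add_comm, ← Finsupp.single_add]; rfl
        · split_ifs with hj
          · subst hj
            refine BiSupp.mul (BiSupp.C_monomial _) (BiSupp.X j) ?_
            rintro _ rfl _ rfl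
            rw [← Finsupp.single_add]; rfl
          · rw [zero_mul]; exact BiSupp.zero _

theorem exists_bezout (f : MvPolynomial (Fin n) R) :
    ∃ b : Fin n → MvPolynomial (Fin n) (MvPolynomial (Fin n) R),
      map C f - C f = ∑ j, b j * (X j - C (X j)) ∧ ∀ j, BiSupp (b j * X j) f.support := by
  choose b hb hb' using exists_bezout_monomial (R := R) (n := n)
  refine ⟨fun j => ∑ k ∈ f.support, C (C (coeff k f)) * b k j, ?_, fun j => ?_⟩
  · simp only [Finset.sum_mul]
    rw [Finset.sum_comm]
    conv_lhs => rw [f.as_sum, map_sum, map_sum, ← Finset.sum_sub_distrib]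
    refine Finset.sum_congr rfl fun k _ => ?_
    have e : monomial k (coeff k f) = C (coeff k f) * monomial k 1 := by
      rw [C_mul_monomial, mul_one]
    simp only [mul_assoc]
    rw [← Finset.mul_sum, ← hb, e, map_mul, C_mul, map_C]
    ring
  · rw [Finset.sum_mul]
    refine BiSupp.sum _ fun k hk => ?_
    rw [mul_assoc]
    refine BiSupp.mul (BiSupp.C_C _) (hb' k j) ?_
    rintro _ rfl _ rfl
    rw [zero_add]
    exact hk

theorem coeff_prod_sum {m : MonomialOrder (Fin n)} {ι : Type*} (s : Finset ι)
    (f : ι → MvPolynomial (Fin n) R) (a : ι → Fin n →₀ ℕ)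
    (h : ∀ i ∈ s, m.toSyn (m.degree (f i)) ≤ m.toSyn (a i)) :
    m.toSyn (m.degree (∏ i ∈ s, f i)) ≤ m.toSyn (∑ i ∈ s, a i) ∧
      coeff (∑ i ∈ s, a i) (∏ i ∈ s, f i) = ∏ i ∈ s, coeff (a i) (f i) := by
  classical
  induction s using Finset.induction_on with
  | empty => simp
  | insert i s hi ih =>
    have h1 := h i (Finset.mem_insert_self _ _)
    obtain ⟨h2, h3⟩ := ih fun j hj => h j (Finset.mem_insert_of_mem hj)
    rw [Finset.prod_insert hi, Finset.sum_insert hi, Finset.prod_insert hi]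
    refine ⟨m.degree_mul_le.trans ?_, ?_⟩
    · rw [map_add, map_add]; exact add_le_add h1 h2
    · rw [m.coeff_mul_of_add_of_degree_le h1 h2, h3]

/-- The bound on an entry depends only on its row, so all permutations give products with the same
bound `∑ a i`. -/
theorem coeff_det_sum {m : MonomialOrder (Fin n)} (N : Matrix (Fin n) (Fin n) (MvPolynomial (Fin n) R))
    (a : Fin n → Fin n →₀ ℕ) (h : ∀ i j, m.toSyn (m.degree (N i j)) ≤ m.toSyn (a i)) :
    coeff (∑ i, a i) N.det = (Matrix.of fun i j => coeff (a i) (N i j)).det := by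
  rw [Matrix.det_apply, Matrix.det_apply, coeff_sum]
  refine Finset.sum_congr rfl fun σ _ => ?_
  rw [Units.smul_def, Units.smul_def, coeff_smul]
  congr 1
  have := (coeff_prod_sum (m := m) Finset.univ (fun i => N (σ i) i) (fun i => a (σ i))
    fun i _ => h _ _).2
  rw [Equiv.sum_comp σ a] at this
  simpa using this

theorem biSupp_prod {m : MonomialOrder (Fin n)} {ι : Type*} (s : Finset ι)
    (f : ι → MvPolynomial (Fin n) (MvPolynomial (Fin n) R)) (a : ι → Fin n →₀ ℕ)
    (h : ∀ i ∈ s, BiSupp (f i) {k | m.toSyn k ≤ m.toSyn (a i)}) :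
    BiSupp (∏ i ∈ s, f i) {k | m.toSyn k ≤ m.toSyn (∑ i ∈ s, a i)} := by
  classical
  induction s using Finset.induction_on with
  | empty =>
    rw [Finset.prod_empty, Finset.sum_empty, ← C_1, ← C_1]
    refine (BiSupp.C_C 1).mono ?_
    rintro _ rfl
    exact le_rfl
  | insert i s hi ih =>
    rw [Finset.prod_insert hi, Finset.sum_insert hi]
    refine (h i (Finset.mem_insert_self _ _)).mul
      (ih fun j hj => h j (Finset.mem_insert_of_mem hj)) fun k hk l hl => ?_
    simp only [Set.mem_ofPred_eq, map_add] at hk hl ⊢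
    exact add_le_add hk hl

theorem biSupp_det {m : MonomialOrder (Fin n)}
    (N : Matrix (Fin n) (Fin n) (MvPolynomial (Fin n) (MvPolynomial (Fin n) R)))
    (a : Fin n → Fin n →₀ ℕ) (h : ∀ i j, BiSupp (N i j) {k | m.toSyn k ≤ m.toSyn (a i)}) :
    BiSupp N.det {k | m.toSyn k ≤ m.toSyn (∑ i, a i)} := by
  rw [Matrix.det_apply]
  refine BiSupp.sum _ fun σ _ => ?_
  have := biSupp_prod (m := m) Finset.univ (fun i => N (σ i) i) (fun i => a (σ i)) fun i _ => h _ _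
  rw [Equiv.sum_comp σ a] at this
  rcases Int.units_eq_one_or (Equiv.Perm.sign σ) with h1 | h1
  · rw [h1, one_smul]; exact this
  · rw [h1, Units.neg_smul, one_smul]; exact this.neg

variable {m : MonomialOrder (Fin n)} {r : Fin n → MvPolynomial (Fin n) R} {δ : Fin n →₀ ℕ}

/-- With the Bezout matrix of `exists_bezout`, the monomials `x^α y^β` of the Bezoutian satisfy `α +
β ≤ δ` in the monomial order, and `x^δ` has coefficient `1`. The coordinate at `δ` vanishes on `x^α`
for `α` below `δ`, so only `α = δ`, `β = 0` survives, and the residue of the Bezoutian is exactly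
`1`. -/
theorem isGrothendieckResidue_nfCoeff
    (hr : ∀ i, HasLead m (r i) (Finsupp.single i (δ i + 1))) :
    IsGrothendieckResidue r (nfCoeff hr δ) := by
  refine ⟨fun f hf => nfCoeff_of_mem_ideal hr le_rfl hf, ?_⟩
  choose a ha ha' using fun i => exists_bezout (r i)
  refine ⟨Matrix.of a, ha, ?_⟩
  set D := (Matrix.of a).det with hD
  -- Column `j` is multiplied by `x_j`, so that row `i` obeys the exponent bound of `r i`. The
  -- factor `x₁ ⋯ x_n = x^ε` this adds to the determinant is cancelled afterwards.
  set A : Matrix (Fin n) (Fin n) (MvPolynomial (Fin n) (MvPolynomial (Fin n) R)) :=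
    Matrix.of fun i j => X j * a i j with hA
  set μ : Fin n → Fin n →₀ ℕ := fun i => Finsupp.single i (δ i + 1) with hμ
  set ε : Fin n →₀ ℕ := ∑ i, Finsupp.single i 1 with hε
  have hsum : ∑ i, μ i = ε + δ := by
    ext j
    simp [hμ, hε, Finsupp.single_apply, add_comm, Finset.sum_add_distrib]
  have hX : (∏ j, X j : MvPolynomial (Fin n) (MvPolynomial (Fin n) R)) = monomial ε 1 := by
    exact (monomial_sum_one Finset.univ _).symm
  have hAD : A.det = monomial ε 1 * D := by
    rw [hA, hD, ← hX]
    exact Matrix.det_mul_row (fun j => X j) (Matrix.of a)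
  have hAs : ∀ i j, BiSupp (A i j) {k | m.toSyn k ≤ m.toSyn (μ i)} := by
    intro i j
    rw [hA, Matrix.of_apply, mul_comm]
    exact (ha' i j).mono fun k hk => (m.le_degree hk).trans (hr i).1
  have hco : ∀ α, coeff (ε + α) A.det = coeff α D := by
    intro α
    rw [hAD, coeff_monomial_mul, one_mul]
  have hDs : ∀ α β, coeff β (coeff α D) ≠ 0 → m.toSyn (α + β) ≤ m.toSyn δ := by
    intro α β h
    rw [← hco] at h
    have := biSupp_det A μ hAs _ _ h
    rw [Set.mem_ofPred_eq, hsum, add_assoc, map_add, map_add _ ε δ] at this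
    exact le_of_add_le_add_left this
  -- Put `y = 0` and take the coefficient of `x_i ^ (δ i + 1)` in each entry of row `i`. Off the
  -- diagonal the entry is divisible by `x_j`, `j ≠ i`, so it gives `0`. The diagonal gives the
  -- leading coefficient of `r i`, because the entries of row `i` add up to `r i` minus its constant
  -- term.
  have hlead : coeff 0 (coeff δ D) = 1 := by
    have e1 : coeff 0 (coeff δ D) = coeff (∑ i, μ i) ((A.map (map constantCoeff)).det) := by
      rw [← hco, hsum, ← RingHom.mapMatrix_apply, ← RingHom.map_det, coeff_map]
      rfl
    rw [e1, coeff_det_sum (m := m)]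
    · suffices hone : (Matrix.of fun i j => coeff (μ i) (A.map (map constantCoeff) i j)) = 1 by
        rw [hone, Matrix.det_one]
      ext i j
      rw [Matrix.of_apply, Matrix.map_apply]
      have hoff : ∀ j, j ≠ i → coeff (μ i) (map constantCoeff (A i j)) = 0 := by
        intro j hj
        rw [hA, Matrix.of_apply, map_mul, map_X, coeff_X_mul', if_neg]
        simp [hμ, Ne.symm hj]
      by_cases hj : j = i
      · subst hj
        rw [Matrix.one_apply_eq]
        have h1 := congrArg (fun f => coeff (μ j) (map constantCoeff f)) (ha j)
        simp only [map_sub, map_sum, map_mul, map_map, map_X, map_C, constantCoeff_X, C_0,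
          sub_zero, coeff_sub, coeff_sum, coeff_C] at h1
        rw [show (constantCoeff : MvPolynomial (Fin n) R →+* R).comp C = RingHom.id R from by
            ext; simp, map_id, show coeff (μ j) (r j) = 1 from (hr j).2, if_neg, Finset.sum_eq_single j] at h1
        · rw [hA, Matrix.of_apply, map_mul, map_X, mul_comm, ← h1, sub_zero]
        · intro l _ hl
          rw [← hoff l hl, hA, Matrix.of_apply, map_mul, map_X, mul_comm]
        · simp
        · intro h
          have := congrArg (fun f => f j) h
          simp [hμ] at this
      · rw [hoff j hj, Matrix.one_apply_ne (Ne.symm hj)]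
    · intro i j
      refine m.degree_le_iff.2 fun k hk => ?_
      rw [mem_support_iff, Matrix.map_apply, coeff_map] at hk
      have := hAs i j k 0 hk
      rwa [add_zero] at this
  have hres : residueExt (nfCoeff hr δ) D = 1 := by
    rw [residueExt, Finset.sum_eq_single δ]
    · rw [nfCoeff_monomial_of_le hr _ le_rfl, if_pos rfl, C_1, one_mul]
      ext β
      by_cases hβ : β = 0
      · subst hβ; rw [hlead]; simp
      · rw [coeff_one, if_neg (Ne.symm hβ)]
        by_contra h
        have := hDs _ _ h
        rw [map_add] at this
        have h2 : 0 < m.toSyn β := m.toSyn_lt_iff_ne_zero.2 fun h => hβ ((m.toSyn_eq_zero_iff β).1 h)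
        exact absurd this (not_le.2 (lt_add_of_pos_right _ h2))
    · intro α hα hne
      rw [nfCoeff_eq_zero_of_lt, C_0, zero_mul]
      obtain ⟨β, hβ⟩ := MvPolynomial.ne_zero_iff.1 (mem_support_iff.1 hα)
      have h1 := hDs _ _ hβ
      refine (m.degree_monomial_le _).trans_lt (lt_of_le_of_ne ?_ fun h => hne (m.toSyn.injective h))
      rw [map_add] at h1
      exact (m.le_add_right α β).trans h1
    · intro h
      rw [notMem_support_iff.1 h, mul_zero]
  rw [hres, sub_self]
  exact Ideal.zero_mem _

/-! ### Change of generators -/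

theorem det_sub_det_mem {S : Type*} [CommRing S] (I : Ideal S) {A B : Matrix (Fin n) (Fin n) S}
    (h : ∀ i j, A i j - B i j ∈ I) : A.det - B.det ∈ I := by
  rw [← Ideal.Quotient.eq, RingHom.map_det, RingHom.map_det]
  congr 1
  ext i j
  exact Ideal.Quotient.eq.2 (h i j)

/-- Modulo the `r k (y)`, a Bezout matrix of `g` is `V(x)` times one of `r`, so the Bezoutian is
multiplied by the constant `det V`. -/
theorem IsGrothendieckResidue.transform {g r : Fin n → MvPolynomial (Fin n) R}
    {τ : MvPolynomial (Fin n) R →ₗ[R] R} (h : IsGrothendieckResidue r τ)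
    (V : Matrix (Fin n) (Fin n) (MvPolynomial (Fin n) R)) (hV : ∀ i, g i = ∑ j, V i j * r j)
    (hspan : Ideal.span (Set.range g) = Ideal.span (Set.range r)) (c c' : R) (hc : c' * c = 1)
    (hdet : V.det = C c) : IsGrothendieckResidue g (c' • τ) := by
  obtain ⟨h1, a, ha, h2⟩ := h
  refine ⟨fun f hf => by rw [LinearMap.smul_apply, h1 f (hspan ▸ hf), smul_zero], ?_⟩
  choose b hb _ using fun i j => exists_bezout (V i j)
  let W : Matrix (Fin n) (Fin n) (MvPolynomial (Fin n) (MvPolynomial (Fin n) R)) := V.map (map C)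
  -- From `V(x) r(x) - V(y) r(y) = V(x) (r(x) - r(y)) + (V(x) - V(y)) r(y)`.
  let a' : Matrix (Fin n) (Fin n) (MvPolynomial (Fin n) (MvPolynomial (Fin n) R)) :=
    Matrix.of fun i j => (W * a) i j + ∑ k, C (r k) * b i k j
  have ha' : IsBezoutMatrix g a' := by
    intro i
    have e1 : ∀ k, map C (V i k * r k) - C (V i k * r k)
        = map C (V i k) * ∑ j, a k j * (X j - C (X j))
          + C (r k) * ∑ j, b i k j * (X j - C (X j)) := by
      intro k
      rw [← ha k, ← hb i k, map_mul, C_mul]; ring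
    have e2 : ∀ j, a' i j * (X j - C (X j)) = ∑ k, (map C (V i k) * (a k j * (X j - C (X j)))
        + C (r k) * (b i k j * (X j - C (X j)))) := by
      intro j
      simp only [a', Matrix.of_apply, Matrix.mul_apply, W, Matrix.map_apply]
      rw [add_mul, Finset.sum_mul, Finset.sum_mul, ← Finset.sum_add_distrib]
      exact Finset.sum_congr rfl fun k _ => by rw [mul_assoc, mul_assoc]
    rw [hV, map_sum, map_sum, ← Finset.sum_sub_distrib, Finset.sum_congr rfl fun k _ => e1 k,
      Finset.sum_congr rfl fun j _ => e2 j, Finset.sum_comm]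
    refine Finset.sum_congr rfl fun k _ => ?_
    rw [Finset.mul_sum, Finset.mul_sum, ← Finset.sum_add_distrib]
  refine ⟨a', ha', ?_⟩
  have hdet' : a'.det - C (C c) * a.det ∈ doubleIdeal r := by
    refine Ideal.mem_sup_right ?_
    have e : C (C c) * a.det = (W * a).det := by
      rw [Matrix.det_mul]
      have := RingHom.map_det (map C :
        MvPolynomial (Fin n) R →+* MvPolynomial (Fin n) (MvPolynomial (Fin n) R)) V
      rw [RingHom.mapMatrix_apply, hdet, map_C] at this
      rw [← this]
    rw [e]
    refine det_sub_det_mem _ fun i j => ?_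
    simp only [a', Matrix.of_apply, add_sub_cancel_left]
    exact Ideal.sum_mem _ fun k _ => Ideal.mul_mem_right _ _
      (Ideal.mem_map_of_mem _ (Ideal.subset_span ⟨k, rfl⟩))
  have e1 := residueExt_mem h1 hdet'
  rw [← residueExtLin_apply, map_sub, residueExtLin_apply, residueExtLin_apply,
    residueExt_C_mul] at e1
  have e2 := Ideal.mul_mem_left _ (C c') (Ideal.add_mem _ e1 (Ideal.mul_mem_left _ (C c) h2))
  have e3 : residueExt (c' • τ) a'.det = C c' * residueExt τ a'.det := by
    rw [residueExt, residueExt, Finset.mul_sum]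
    refine Finset.sum_congr rfl fun k _ => ?_
    rw [LinearMap.smul_apply, smul_eq_mul, C_mul, mul_assoc]
  rw [hspan, e3]
  convert e2 using 1
  have : (C c' * C c : MvPolynomial (Fin n) R) = 1 := by rw [← C_mul, hc, C_1]
  linear_combination this

end bezout

/-! ### Divided differences of powers of a variable -/

/-- The divided difference of `t ^ m` at the `i` points `z 0, …, z (i - 1)` (zero for `i = 0`). -/
def powDD {S : Type*} [CommRing S] (z : ℕ → S) : ℕ → ℕ → S
  | 0, _ => 0
  | i + 1, 0 => if i = 0 then 1 else 0
  | i + 1, m + 1 => powDD z i m + z i * powDD z (i + 1) m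
termination_by i m => i + m

section powDD
variable {S : Type*} [CommRing S] (z : ℕ → S)

@[simp] theorem powDD_zero (m : ℕ) : powDD z 0 m = 0 := by rw [powDD]

theorem powDD_succ_zero (i : ℕ) : powDD z (i + 1) 0 = if i = 0 then 1 else 0 := by rw [powDD]

theorem powDD_succ_succ (i m : ℕ) :
    powDD z (i + 1) (m + 1) = powDD z i m + z i * powDD z (i + 1) m := by rw [powDD]

theorem powDD_of_lt {i m : ℕ} (h : m < i) : powDD z (i + 1) m = 0 := by
  induction m generalizing i with
  | zero => rw [powDD_succ_zero, if_neg (by omega)]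
  | succ m ih =>
    obtain ⟨i, rfl⟩ : ∃ k, i = k + 1 := ⟨i - 1, by omega⟩
    rw [powDD_succ_succ, ih (by omega), ih (by omega), mul_zero, add_zero]

theorem powDD_self (i : ℕ) : powDD z (i + 1) i = 1 := by
  induction i with
  | zero => rw [powDD_succ_zero, if_pos rfl]
  | succ i ih => rw [powDD_succ_succ, ih, powDD_of_lt z (Nat.lt_succ_self i), mul_zero, add_zero]

theorem powDD_succ_self (i : ℕ) : powDD z (i + 1) (i + 1) = ∑ j ∈ Finset.range (i + 1), z j := by
  induction i with
  | zero => simp [powDD_succ_succ, powDD_succ_zero]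
  | succ i ih => rw [powDD_succ_succ, ih, powDD_self, mul_one, Finset.sum_range_succ _ (i + 1)]

/-- The divided difference of a polynomial at the points `z 0, …, z (i - 1)`. -/
def polyDD (i : ℕ) : Polynomial S →ₗ[S] S :=
  Polynomial.lsum fun m => LinearMap.mulRight S (powDD z i m)

theorem polyDD_eq_sum (i : ℕ) (p : Polynomial S) :
    polyDD z i p = p.sum fun m c => c * powDD z i m := by
  rw [polyDD, Polynomial.lsum_apply]; rfl

theorem polyDD_monomial (i m : ℕ) (c : S) :
    polyDD z i (Polynomial.monomial m c) = c * powDD z i m := by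
  rw [polyDD_eq_sum, Polynomial.sum_monomial_index _ _ (by simp)]

/-- On monomials this is the recursion that defines `powDD`. -/
theorem polyDD_mul_X_sub_C (i : ℕ) (p : Polynomial S) :
    polyDD z (i + 1) (p * (Polynomial.X - Polynomial.C (z i))) = polyDD z i p := by
  induction p using Polynomial.induction_on' with
  | add p q hp hq => rw [add_mul, map_add, map_add, hp, hq]
  | monomial m c =>
    rw [mul_sub, Polynomial.monomial_mul_X, map_sub, Polynomial.monomial_mul_C, polyDD_monomial,
      polyDD_monomial, polyDD_monomial, powDD_succ_succ]
    ring

theorem polyDD_mul_prod (i : ℕ) (p : Polynomial S) :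
    polyDD z i (p * ∏ k ∈ Finset.range i, (Polynomial.X - Polynomial.C (z k))) = 0 := by
  induction i with
  | zero => rw [polyDD_eq_sum, Polynomial.sum]; simp
  | succ i ih => rw [Finset.prod_range_succ, ← mul_assoc, polyDD_mul_X_sub_C, ih]

end powDD

/-! ### The weights of the quantum elementary polynomials -/

section weight
variable {A : Type*} [CommRing A] {n : ℕ}

/-- `p` has degree at most `k` in `t` and `x` together. -/
def WeightLE (p : Polynomial (MvPolynomial (Fin n) A)) (k : ℕ) : Prop :=
  ∀ m, p.coeff m ≠ 0 → (p.coeff m).totalDegree + m ≤ k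

theorem WeightLE.zero (k : ℕ) : WeightLE (0 : Polynomial (MvPolynomial (Fin n) A)) k := by
  intro m h; simp at h

theorem WeightLE.mono {p : Polynomial (MvPolynomial (Fin n) A)} {k l : ℕ} (h : WeightLE p k)
    (hkl : k ≤ l) : WeightLE p l := fun m hm => (h m hm).trans hkl

theorem WeightLE.add {p q : Polynomial (MvPolynomial (Fin n) A)} {k : ℕ} (hp : WeightLE p k)
    (hq : WeightLE q k) : WeightLE (p + q) k := by
  intro m h
  rw [Polynomial.coeff_add] at h ⊢
  by_cases h1 : p.coeff m = 0
  · rw [h1, zero_add] at h ⊢; exact hq m h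
  by_cases h2 : q.coeff m = 0
  · rw [h2, add_zero] at h ⊢; exact hp m h
  have := totalDegree_add (p.coeff m) (q.coeff m)
  have := hp m h1
  have := hq m h2
  omega

theorem WeightLE.neg {p : Polynomial (MvPolynomial (Fin n) A)} {k : ℕ} (hp : WeightLE p k) :
    WeightLE (-p) k := by
  intro m h
  rw [Polynomial.coeff_neg] at h ⊢
  rw [totalDegree_neg]
  exact hp m (neg_ne_zero.1 h)

theorem WeightLE.sum {ι : Type*} (s : Finset ι) {p : ι → Polynomial (MvPolynomial (Fin n) A)}
    {k : ℕ} (h : ∀ i ∈ s, WeightLE (p i) k) : WeightLE (∑ i ∈ s, p i) k := by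
  classical
  induction s using Finset.induction_on with
  | empty => simpa using WeightLE.zero k
  | insert i s hi ih =>
    rw [Finset.sum_insert hi]
    exact (h i (Finset.mem_insert_self _ _)).add
      (ih fun j hj => h j (Finset.mem_insert_of_mem hj))

theorem WeightLE.mul {p q : Polynomial (MvPolynomial (Fin n) A)} {k l : ℕ} (hp : WeightLE p k)
    (hq : WeightLE q l) : WeightLE (p * q) (k + l) := by
  intro m h
  rw [Polynomial.coeff_mul] at h ⊢
  obtain ⟨x, hx, hne⟩ := Finset.exists_ne_zero_of_sum_ne_zero h
  have hm : m ≤ k + l := by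
    have := hp _ (left_ne_zero_of_mul hne)
    have := hq _ (right_ne_zero_of_mul hne)
    have := Finset.HasAntidiagonal.mem_antidiagonal.1 hx
    omega
  suffices h2 : (∑ x ∈ Finset.HasAntidiagonal.antidiagonal m, p.coeff x.1 * q.coeff x.2).totalDegree
      ≤ k + l - m by omega
  refine totalDegree_finsetSum_le fun x hx => ?_
  by_cases hne : p.coeff x.1 * q.coeff x.2 = 0
  · rw [hne]; simp
  have := hp _ (left_ne_zero_of_mul hne)
  have := hq _ (right_ne_zero_of_mul hne)
  have := Finset.HasAntidiagonal.mem_antidiagonal.1 hx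
  have := totalDegree_mul (p.coeff x.1) (q.coeff x.2)
  omega

theorem WeightLE.C {c : MvPolynomial (Fin n) A} {k : ℕ} (h : c.totalDegree ≤ k) :
    WeightLE (Polynomial.C c) k := by
  intro m hm
  rw [Polynomial.coeff_C] at hm ⊢
  split_ifs at hm ⊢ with h0
  · omega
  · exact absurd rfl hm

theorem WeightLE.X : WeightLE (Polynomial.X : Polynomial (MvPolynomial (Fin n) A)) 1 := by
  intro m hm
  rw [Polynomial.coeff_X] at hm ⊢
  split_ifs at hm ⊢ with h0
  · rw [totalDegree_one]; omega
  · exact absurd rfl hm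

theorem WeightLE.prod {ι : Type*} (s : Finset ι) {p : ι → Polynomial (MvPolynomial (Fin n) A)}
    {k : ι → ℕ} (h : ∀ i ∈ s, WeightLE (p i) (k i)) : WeightLE (∏ i ∈ s, p i) (∑ i ∈ s, k i) := by
  classical
  induction s using Finset.induction_on with
  | empty => simpa using WeightLE.C (n := n) (A := A) (c := 1) (k := 0) (by simp)
  | insert i s hi ih =>
    rw [Finset.prod_insert hi, Finset.sum_insert hi]
    exact (h i (Finset.mem_insert_self _ _)).mul
      (ih fun j hj => h j (Finset.mem_insert_of_mem hj))

/-- The product is the contribution of the identity permutation. Every other permutation moves at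
least two indices, and the off-diagonal entries have degree `0` in `t` and `x`, so the rest has
degree at most `k - 2`. -/
theorem qDelta_sub_prod_weight (x q : ℕ → MvPolynomial (Fin n) A)
    (hx : ∀ i, (x i).totalDegree ≤ 1) (hq : ∀ i, (q i).totalDegree = 0) (k m : ℕ)
    (h : (qDelta (fun j => Polynomial.C (x j)) (fun j => Polynomial.C (q j)) k Polynomial.X
      - ∏ i ∈ Finset.range k, (Polynomial.C (x i) + Polynomial.X)).coeff m ≠ 0) :
    ((qDelta (fun j => Polynomial.C (x j)) (fun j => Polynomial.C (q j)) k Polynomial.X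
      - ∏ i ∈ Finset.range k, (Polynomial.C (x i) + Polynomial.X)).coeff m).totalDegree + m + 2
      ≤ k := by
  set D := qDelta (fun j => Polynomial.C (x j)) (fun j => Polynomial.C (q j)) k Polynomial.X
    - ∏ i ∈ Finset.range k, (Polynomial.C (x i) + Polynomial.X) with hD
  set M : Matrix (Fin k) (Fin k) (Polynomial (MvPolynomial (Fin n) A)) :=
    Matrix.of fun i j : Fin k =>
    if (j : ℕ) = i then Polynomial.C (x i) + Polynomial.X
    else if (j : ℕ) = i + 1 then Polynomial.C (q i)
    else if (i : ℕ) = j + 1 then -1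
    else 0 with hM
  have hsum : D = ∑ σ ∈ Finset.univ.erase (1 : Equiv.Perm (Fin k)),
      Equiv.Perm.sign σ • ∏ i, M (σ i) i := by
    have h1 : M.det = _ := Matrix.det_apply M
    rw [← Finset.add_sum_erase _ _ (Finset.mem_univ (1 : Equiv.Perm (Fin k)))] at h1
    rw [hD, qDelta, ← hM, h1, Equiv.Perm.sign_one, one_smul, ← Fin.prod_univ_eq_prod_range]
    simp [hM]
  have hent : ∀ i j, WeightLE (M i j) (if i = j then 1 else 0) := by
    intro i j
    simp only [hM, Matrix.of_apply]
    by_cases hij : i = j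
    · subst hij
      simp only [if_true]
      exact (WeightLE.C (hx _)).add WeightLE.X
    · have h1 : ¬ ((j : ℕ) = i) := fun h => hij (Fin.ext h.symm)
      rw [if_neg h1, if_neg hij]
      split_ifs
      · exact WeightLE.C (hq _).le
      · rw [← Polynomial.C_1]; exact (WeightLE.C (by simp)).neg
      · exact WeightLE.zero _
  by_cases hk : k < 2
  · exfalso
    apply h
    have : Subsingleton (Fin k) := Fin.subsingleton_iff_le_one.2 (by omega)
    have h2 : Finset.univ.erase (1 : Equiv.Perm (Fin k)) = ∅ := by
      ext σ; simp [Subsingleton.elim σ 1]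
    rw [hsum, h2, Finset.sum_empty, Polynomial.coeff_zero]
  · have : WeightLE D (k - 2) := by
      rw [hsum]
      refine WeightLE.sum _ fun σ hσ => ?_
      have hσ1 : σ ≠ 1 := Finset.ne_of_mem_erase hσ
      have h2 := WeightLE.prod Finset.univ (fun i _ => hent (σ i) i)
      have h3 : ∑ i, (if σ i = i then 1 else 0) + 2 ≤ k := by
        have h4 := Equiv.Perm.two_le_card_support_of_ne_one hσ1
        rw [← Finset.card_filter]
        have h5 := Finset.card_filter_add_card_filter_not (s := (Finset.univ : Finset (Fin k)))
          (fun i => σ i = i)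
        have h6 : σ.support = Finset.univ.filter fun i => ¬ σ i = i := by
          ext i; simp
        rw [h6] at h4
        rw [Finset.card_univ, Fintype.card_fin] at h5
        omega
      have h7 := h2.mono (show _ ≤ k - 2 by omega)
      rcases Int.units_eq_one_or (Equiv.Perm.sign σ) with h1 | h1
      · rw [h1, one_smul]; exact h7
      · rw [h1, Units.neg_smul, one_smul]; exact h7.neg
    have := this m h
    omega

theorem prod_C_add_X_natDegree_le {S : Type*} [CommRing S] (x : ℕ → S) (k : ℕ) :
    (∏ i ∈ Finset.range k, (Polynomial.C (x i) + Polynomial.X)).natDegree ≤ k ∧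
    (∏ i ∈ Finset.range k, (Polynomial.C (x i) + Polynomial.X)).coeff k = 1 ∧
    ∀ j, j + 1 = k → (∏ i ∈ Finset.range k, (Polynomial.C (x i) + Polynomial.X)).coeff j
      = ∑ i ∈ Finset.range k, x i := by
  induction k with
  | zero => simp
  | succ k ih =>
    obtain ⟨h1, h2, h3⟩ := ih
    rw [Finset.prod_range_succ]
    refine ⟨?_, ?_, ?_⟩
    · refine Polynomial.natDegree_mul_le.trans (add_le_add h1 ?_)
      refine (Polynomial.natDegree_add_le _ _).trans (max_le ?_ Polynomial.natDegree_X_le)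
      rw [Polynomial.natDegree_C]; omega
    · rw [mul_add, Polynomial.coeff_add, Polynomial.coeff_mul_X, Polynomial.coeff_mul_C, h2,
        Polynomial.coeff_eq_zero_of_natDegree_lt (Nat.lt_succ_of_le h1), zero_mul, zero_add]
    · intro j hj
      obtain rfl : j = k := by omega
      rw [mul_add, Polynomial.coeff_add, Polynomial.coeff_mul_C, h2, Finset.sum_range_succ, one_mul,
        add_comm]
      congr 1
      cases j with
      | zero => simp
      | succ j => rw [Polynomial.coeff_mul_X]; exact h3 j rfl

end weight

/-- `Δ_k(t | x₁, …, x_k)` as a polynomial in `t`. -/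
def deltaPoly (n k : ℕ) : Polynomial (XRing n) :=
  qDelta (fun j => Polynomial.C (xVar n j)) (fun j => Polynomial.C (C (qVar n j))) k Polynomial.X

theorem xVar_totalDegree_le (n i : ℕ) : (xVar n i).totalDegree ≤ 1 := by
  rw [xVar]
  split_ifs
  · rw [totalDegree_X]
  · simp

theorem deltaPoly_sub_weight (n k m : ℕ)
    (h : (deltaPoly n k - ∏ i ∈ Finset.range k,
      (Polynomial.C (xVar n i) + Polynomial.X)).coeff m ≠ 0) :
    ((deltaPoly n k - ∏ i ∈ Finset.range k,
      (Polynomial.C (xVar n i) + Polynomial.X)).coeff m).totalDegree + m + 2 ≤ k :=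
  qDelta_sub_prod_weight (xVar n) (fun j => C (qVar n j)) (xVar_totalDegree_le n)
    (fun _ => totalDegree_C _) k m h

theorem deltaPoly_coeff_of_lt (n : ℕ) {k m : ℕ} (h : k < m + 2) :
    (deltaPoly n k).coeff m
      = (∏ i ∈ Finset.range k, (Polynomial.C (xVar n i) + Polynomial.X)).coeff m := by
  rw [← sub_eq_zero, ← Polynomial.coeff_sub]
  by_contra h1
  have := deltaPoly_sub_weight n k m h1
  omega

theorem deltaPoly_natDegree_le (n k : ℕ) : (deltaPoly n k).natDegree ≤ k := by
  rw [Polynomial.natDegree_le_iff_coeff_eq_zero]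
  intro m hm
  rw [deltaPoly_coeff_of_lt n (by omega), Polynomial.coeff_eq_zero_of_natDegree_lt]
  exact (prod_C_add_X_natDegree_le (xVar n) k).1.trans_lt hm

theorem deltaPoly_coeff_self (n k : ℕ) : (deltaPoly n k).coeff k = 1 := by
  rw [deltaPoly_coeff_of_lt n (by omega)]
  exact (prod_C_add_X_natDegree_le (xVar n) k).2.1

theorem deltaPoly_coeff_pred (n k : ℕ) :
    (deltaPoly n (k + 1)).coeff k = ∑ i ∈ Finset.range (k + 1), xVar n i := by
  rw [deltaPoly_coeff_of_lt n (by omega)]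
  exact (prod_C_add_X_natDegree_le (xVar n) (k + 1)).2.2 k rfl

/-! ### Generators of the quantum ideal with pure leading powers -/

theorem powDD_totalDegree_le {n : ℕ} (i m : ℕ) :
    (powDD (fun j => - xVar n j) i m).totalDegree ≤ m + 1 - i := by
  induction m generalizing i with
  | zero =>
    cases i with
    | zero => simp
    | succ i => rw [powDD_succ_zero]; split_ifs <;> simp
  | succ m ih =>
    cases i with
    | zero => simp
    | succ i =>
      rw [powDD_succ_succ]
      refine (totalDegree_add _ _).trans (max_le ((ih i).trans (by omega)) ?_)
      by_cases hm : m < i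
      · rw [powDD_of_lt _ hm]; simp
      · have h1 := ih (i + 1)
        have h2 := xVar_totalDegree_le n i
        rw [← totalDegree_neg] at h2
        have h3 := totalDegree_mul (-xVar n i) (powDD (fun j => - xVar n j) (i + 1) m)
        omega

/-- Up to sign this is the complete homogeneous polynomial `h_l` in the first `i + 1` variables. The
recursion splits `h_l` into the last variable times `h_{l-1}` and the `h_l` of the first `i`
variables, and the second part is smaller since the last variable is the largest. -/
theorem powDD_hasLead {n : ℕ} (i : ℕ) (hi : i < n) (l : ℕ) :
    HasLead (revDegLex n) ((-1) ^ l * powDD (fun j => - xVar n j) (i + 1) (i + l))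
      (Finsupp.single ⟨i, hi⟩ l) := by
  induction i generalizing l with
  | zero =>
    induction l with
    | zero => rw [powDD_self, pow_zero, Finsupp.single_zero, mul_one]; exact HasLead.one
    | succ l ih =>
      have : (-1) ^ (l + 1) * powDD (fun j => - xVar n j) (0 + 1) (0 + (l + 1))
          = ((-1) ^ l * powDD (fun j => - xVar n j) (0 + 1) (0 + l)) * X ⟨0, hi⟩ := by
        rw [← add_assoc, powDD_succ_succ, powDD_zero, xVar, dif_pos hi]; ring
      rw [this, Finsupp.single_add]
      exact ih.mul (HasLead.monomial _)
  | succ i ih0 =>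
    induction l with
    | zero =>
      rw [add_zero, powDD_self, pow_zero, Finsupp.single_zero, mul_one]; exact HasLead.one
    | succ l ih =>
      have : (-1) ^ (l + 1) * powDD (fun j => - xVar n j) (i + 1 + 1) (i + 1 + (l + 1))
          = ((-1) ^ l * powDD (fun j => - xVar n j) (i + 1 + 1) (i + 1 + l)) * X ⟨i + 1, hi⟩
            + (-1) ^ (l + 1) * powDD (fun j => - xVar n j) (i + 1) (i + (l + 1)) := by
        rw [← add_assoc, powDD_succ_succ, xVar, dif_pos hi,
          show i + 1 + l = i + (l + 1) by omega]
        ring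
      rw [this]
      refine HasLead.add_of_lt ?_ ?_
      · rw [Finsupp.single_add]
        exact ih.mul (HasLead.monomial _)
      · refine (ih0 (by omega) (l + 1)).1.trans_lt ?_
        have e : ∀ j : Fin n, Finsupp.single j (l + 1) = (l + 1) • Finsupp.single j 1 := by
          intro j; simp
        rw [e, e, map_nsmul, map_nsmul]
        exact nsmul_lt_nsmul_right (Nat.succ_ne_zero l)
          (revDegLex_single_lt (Fin.mk_lt_mk.2 (Nat.lt_succ_self i)))

/-- The matrix expressing the generators with pure leading powers in terms of the `ẽ j`. -/
def genMatrix (n : ℕ) : Matrix (Fin n) (Fin n) (XRing n) :=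
  Matrix.of fun i j => (-1) ^ (n - (i : ℕ) + 1) * powDD (fun k => - xVar n k) (i + 1) (n - 1 - j)

/-- Generators of `Ĩ_n` whose leading monomials are the `xᵢ ^ (n + 1 - i)`. -/
def triGen (n : ℕ) (i : Fin n) : XRing n := ∑ j, genMatrix n i j * eTilde n j

theorem eTilde_eq_coeff (n : ℕ) (i : Fin n) : eTilde n i = (deltaPoly n n).coeff (n - 1 - i) := by
  rw [eTilde, qElem, Nat.sub_sub, add_comm 1]
  rfl

/-- Take the divided difference of `Δ_n(t) = t^n + ∑ ẽ_j t^{n-j}` at the `i + 1` points `-x_k`. It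
kills the classical product `∏ (t + x_k)`, and `Δ_n` differs from that product only in degree at
most `n - 2`. So a combination of the `ẽ_j` equals `±h_{n-i}` of the first `i + 1` variables up to
terms of lower degree (with `i` counted from `0`). -/
theorem triGen_hasLead (n : ℕ) (i : Fin n) :
    HasLead (revDegLex n) (triGen n i) (Finsupp.single i (staircase n i + 1)) := by
  have hi := i.2
  set z : ℕ → XRing n := fun k => - xVar n k with hz
  set N : Polynomial (XRing n) := ∏ k ∈ Finset.range n, (Polynomial.C (xVar n k) + Polynomial.X)
    with hN
  have hst : staircase n i + 1 = n - i := by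
    change n - 1 - (i : ℕ) + 1 = n - i
    omega
  have hN0 : polyDD z (i + 1) N = 0 := by
    have h1 : N = (∏ k ∈ Finset.Ico (i + 1 : ℕ) n, (Polynomial.X - Polynomial.C (z k))) *
        ∏ k ∈ Finset.range (i + 1), (Polynomial.X - Polynomial.C (z k)) := by
      rw [mul_comm, Finset.prod_range_mul_prod_Ico _ (by omega), hN]
      refine Finset.prod_congr rfl fun k _ => ?_
      simp [hz, add_comm]
    rw [h1, polyDD_mul_prod]
  have hsum : triGen n i = (-1) ^ (n - (i : ℕ)) * powDD z (i + 1) (i + (n - i))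
      + (-1) ^ (n - (i : ℕ) + 1) * polyDD z (i + 1) (deltaPoly n n - N) := by
    have h1 : polyDD z (i + 1) (deltaPoly n n)
        = ∑ m ∈ Finset.range (n + 1), (deltaPoly n n).coeff m * powDD z (i + 1) m := by
      rw [polyDD_eq_sum, Polynomial.sum_over_range' _ _ (n + 1)
        (Nat.lt_succ_of_le (deltaPoly_natDegree_le n n))]
      simp
    rw [map_sub, hN0, sub_zero, h1, Finset.sum_range_succ, deltaPoly_coeff_self, one_mul,
      ← Finset.sum_range_reflect, triGen, Finset.sum_range]
    simp only [eTilde_eq_coeff, genMatrix, Matrix.of_apply, mul_add, Finset.mul_sum]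
    rw [show (i : ℕ) + (n - i) = n by omega, add_comm ((-1 : XRing n) ^ (n - (i : ℕ)) * _), pow_succ, add_assoc]
    rw [show (-1 : XRing n) ^ (n - (i : ℕ)) * -1 * powDD z (↑i + 1) n
        = -((-1 : XRing n) ^ (n - (i : ℕ)) * powDD z (↑i + 1) n) by ring, neg_add_cancel, add_zero]
    exact Finset.sum_congr rfl fun j _ => by ring
  rw [hsum, hst]
  refine (powDD_hasLead i hi (n - i)).add_of_lt ?_
  -- The difference has degree at most `n - 2` in `t` and `x` together, and a divided difference at
  -- `i + 1` points lowers the degree by `i`.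
  have htd : ((-1) ^ (n - (i : ℕ) + 1) * polyDD z (i + 1) (deltaPoly n n - N)).totalDegree
      ≤ n - i - 1 := by
    refine (totalDegree_mul _ _).trans ?_
    have h1 : ((-1 : XRing n) ^ (n - (i : ℕ) + 1)).totalDegree = 0 := by
      rcases neg_one_pow_eq_or (XRing n) (n - (i : ℕ) + 1) with h | h <;> rw [h] <;> simp
    rw [h1, zero_add, polyDD_eq_sum]
    refine totalDegree_finsetSum_le fun m hm => ?_
    dsimp only
    have h2 := deltaPoly_sub_weight n n m (Polynomial.mem_support_iff.1 hm)
    rw [← hN] at h2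
    have h3 := powDD_totalDegree_le (n := n) (i + 1) m
    rw [← hz] at h3
    have h4 := totalDegree_mul ((deltaPoly n n - N).coeff m) (powDD z (i + 1) m)
    by_cases hmi : m < i
    · rw [powDD_of_lt _ hmi, mul_zero]; simp
    · omega
  have hdeg : ∀ f : XRing n, f.totalDegree ≤ n - i - 1 →
      (revDegLex n).toSyn ((revDegLex n).degree f)
        < (revDegLex n).toSyn (Finsupp.single i (n - (i : ℕ))) := by
    intro f hf
    apply revDegLex_lt_of_degree_lt
    rw [Finsupp.degree_single]
    by_cases h0 : f = 0
    · rw [h0, MonomialOrder.degree_zero, map_zero]; omega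
    · have := le_totalDegree ((revDegLex n).degree_mem_support h0)
      rw [Finsupp.sum_fintype _ _ (by simp), ← Finsupp.degree_eq_sum] at this
      omega
  exact hdeg _ htd

/-- With its columns reversed the matrix is triangular with signs on the diagonal, because the
divided difference of `t^j` at `i + 1` points is `0` for `j < i` and `1` for `j = i`. -/
theorem exists_genMatrix_det (n : ℕ) : ∃ c : ℤ, c * c = 1 ∧ (genMatrix n).det = C (c : QRing n) := by
  have h1 : ((genMatrix n).submatrix id Fin.revPerm).det = ∏ i : Fin n, (-1) ^ (n - (i : ℕ) + 1) := by
    rw [Matrix.det_of_isUpperTriangular]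
    · refine Finset.prod_congr rfl fun i _ => ?_
      rw [Matrix.submatrix_apply, genMatrix, Matrix.of_apply, id, Fin.revPerm_apply, Fin.val_rev,
        show n - 1 - (n - (i + 1)) = (i : ℕ) by have := i.2; omega, powDD_self, mul_one]
    · intro i j hij
      rw [Matrix.submatrix_apply, genMatrix, Matrix.of_apply, id, Fin.revPerm_apply, Fin.val_rev,
        show n - 1 - (n - (j + 1)) = (j : ℕ) by have := j.2; omega, powDD_of_lt _ (show (j : ℕ) < i from hij), mul_zero]
  rw [Matrix.det_permute'] at h1
  set s := Equiv.Perm.sign (Fin.revPerm (n := n)) with hs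
  have hs2 : (((s : ℤˣ) : ℤ) : XRing n) * ((s : ℤ) : XRing n) = 1 := by
    rw [← Int.cast_mul, ← Units.val_mul, Int.units_mul_self]; simp
  have hp : ∀ k : ℕ, ((-1 : ℤ) ^ k) * (-1) ^ k = 1 := fun k => by rw [← mul_pow]; simp
  refine ⟨s * ∏ i : Fin n, (-1) ^ (n - (i : ℕ) + 1), ?_, ?_⟩
  · rw [mul_mul_mul_comm, ← Finset.prod_mul_distrib, ← Units.val_mul, Int.units_mul_self]
    simp only [hp]; simp
  · have h2 := congrArg (fun f => ((s : ℤ) : XRing n) * f) h1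
    rw [← mul_assoc, hs2, one_mul] at h2
    rw [h2]
    simp

theorem exists_triGen_transform (n : ℕ) :
    ∃ (V : Matrix (Fin n) (Fin n) (XRing n)) (c : ℤ), c * c = 1 ∧ V.det = C (c : QRing n) ∧
      ∀ i, eTilde n i = ∑ j, V i j * triGen n j := by
  obtain ⟨c, hc, hdet⟩ := exists_genMatrix_det n
  have hcc : (C (c : QRing n) : XRing n) * C (c : QRing n) = 1 := by
    rw [← C_mul, ← Int.cast_mul, hc]; simp
  have hVU : (C (c : QRing n) : XRing n) • (genMatrix n).adjugate * genMatrix n = 1 := by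
    rw [Matrix.smul_mul, Matrix.adjugate_mul, hdet, smul_smul, hcc, one_smul]
  refine ⟨(C (c : QRing n) : XRing n) • (genMatrix n).adjugate, c, hc, ?_, fun i => ?_⟩
  · have := congrArg Matrix.det hVU
    rw [Matrix.det_mul, Matrix.det_one, hdet] at this
    linear_combination (C (c : QRing n) : XRing n) * this
      - ((C (c : QRing n) : XRing n) • (genMatrix n).adjugate).det * hcc
  · have h1 : triGen n = (genMatrix n).mulVec (eTilde n) := rfl
    have h2 := congrArg (fun v => ((C (c : QRing n) : XRing n) • (genMatrix n).adjugate).mulVec v i) h1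
    simp only [Matrix.mulVec_mulVec, hVU, Matrix.one_mulVec] at h2
    exact h2.symm

theorem span_triGen (n : ℕ) : Ideal.span (Set.range (triGen n)) = qIdeal n := by
  obtain ⟨V, c, _, _, hV⟩ := exists_triGen_transform n
  refine le_antisymm (Ideal.span_le.2 ?_) (Ideal.span_le.2 ?_)
  · rintro _ ⟨i, rfl⟩
    exact Ideal.sum_mem _ fun j _ => Ideal.mul_mem_left _ _ (Ideal.subset_span ⟨j, rfl⟩)
  · rintro _ ⟨i, rfl⟩
    rw [hV]
    exact Ideal.sum_mem _ fun j _ => Ideal.mul_mem_left _ _ (Ideal.subset_span ⟨j, rfl⟩)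

/-! ### Codes of permutations -/

theorem code_le {n : ℕ} (w : Equiv.Perm (Fin n)) (i : Fin n) : code w i ≤ n - 1 - i := by
  rw [← Fin.card_Ioi]
  refine Finset.card_le_card fun j hj => ?_
  rw [Finset.mem_Ioi]
  exact (Finset.mem_filter.1 hj).2.1

/-- `reducedWord` depends only on the code and spells the permutation. -/
theorem code_injective {n : ℕ} : Function.Injective (code : Equiv.Perm (Fin n) → Fin n → ℕ) := by
  intro w w' h
  ext j
  have h1 := prod_reducedWord w j
  have h2 := prod_reducedWord w' j
  have : reducedWord w = reducedWord w' := by rw [reducedWord, reducedWord, h]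
  rw [← h1, ← h2, this]

theorem exists_code_eq {n : ℕ} (c : Fin n → ℕ) (hc : ∀ i, c i ≤ n - 1 - i) :
    ∃ w : Equiv.Perm (Fin n), code w = c := by
  have hlt : ∀ i : Fin n, ∀ a, a ≤ n - 1 - (i : ℕ) → a < n - i := fun i a h => by
    have := i.2; omega
  let f : Equiv.Perm (Fin n) → (∀ i : Fin n, Fin (n - i)) := fun w i =>
    ⟨code w i, hlt i _ (code_le w i)⟩
  have hf : Function.Injective f := by
    intro w w' h
    apply code_injective
    ext i
    exact congrArg (fun g => ((g i : Fin _) : ℕ)) h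
  -- Surjectivity is a count: both sides have `n!` elements.
  have hcard : Fintype.card (Equiv.Perm (Fin n)) = Fintype.card (∀ i : Fin n, Fin (n - i)) := by
    rw [Fintype.card_perm, Fintype.card_pi, Fintype.card_fin]
    simp only [Fintype.card_fin]
    rw [Fin.prod_univ_eq_prod_range (fun i => n - i), ← Finset.prod_range_add_one_eq_factorial,
      ← Finset.prod_range_reflect]
    refine Finset.prod_congr rfl fun i hi => ?_
    have := Finset.mem_range.1 hi
    omega
  obtain ⟨w, hw⟩ := ((Fintype.bijective_iff_injective_and_card f).2 ⟨hf, hcard⟩).2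
    fun i => ⟨c i, hlt i _ (hc i)⟩
  exact ⟨w, funext fun i => congrArg (fun g => ((g i : Fin _) : ℕ)) hw⟩

/-! ### Divided difference operators -/

section divDiff
variable {S : Type*} [CommRing S] [IsDomain S]

theorem divDiff_unique {k : ℕ} {f g : MvPolynomial ℕ S}
    (h : (X k - X (k + 1)) * g = f - rename (Equiv.swap k (k + 1)) f) : divDiff k f = g := by
  have hne : (X k - X (k + 1) : MvPolynomial ℕ S) ≠ 0 := by
    rw [sub_ne_zero]
    exact fun h => (Nat.succ_ne_self k) (X_injective h).symm
  exact mul_left_cancel₀ hne ((divDiff_spec k f).trans h.symm)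

theorem divDiff_add (k : ℕ) (f g : MvPolynomial ℕ S) :
    divDiff k (f + g) = divDiff k f + divDiff k g :=
  divDiff_unique (by rw [mul_add, divDiff_spec, divDiff_spec, map_add]; ring)

theorem divDiff_mul (k : ℕ) (f g : MvPolynomial ℕ S) :
    divDiff k (f * g) = divDiff k f * g + rename (Equiv.swap k (k + 1)) f * divDiff k g := by
  refine divDiff_unique ?_
  rw [map_mul]
  linear_combination g * divDiff_spec k f
    + rename (Equiv.swap k (k + 1)) f * divDiff_spec k g

theorem divDiff_eq_zero {k : ℕ} {f : MvPolynomial ℕ S}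
    (h : rename (Equiv.swap k (k + 1)) f = f) : divDiff k f = 0 :=
  divDiff_unique (by rw [h, mul_zero, sub_self])

theorem divDiff_mul_of_fixed {k : ℕ} {f : MvPolynomial ℕ S}
    (h : rename (Equiv.swap k (k + 1)) f = f) (g : MvPolynomial ℕ S) :
    divDiff k (f * g) = f * divDiff k g := by
  rw [divDiff_mul, divDiff_eq_zero h, h, zero_mul, zero_add]

theorem divDiff_X_self (k : ℕ) : divDiff k (X k : MvPolynomial ℕ S) = 1 :=
  divDiff_unique (by rw [rename_X, Equiv.swap_apply_left, mul_one])

theorem divDiff_X_succ (k : ℕ) : divDiff k (X (k + 1) : MvPolynomial ℕ S) = -1 :=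
  divDiff_unique (by rw [rename_X, Equiv.swap_apply_right]; ring)

omit [IsDomain S] in
theorem rename_swap_X_of_lt {j k : ℕ} (h : j < k ∨ k + 1 < j) :
    rename (Equiv.swap k (k + 1)) (X j : MvPolynomial ℕ S) = X j := by
  rw [rename_X, Equiv.swap_apply_of_ne_of_ne (by omega) (by omega)]

theorem map_powDD_eq {R T : Type*} [CommRing R] [CommRing T] (φ : R →+* T) (z : ℕ → R) (z' : ℕ → T)
    (i m : ℕ) (h : ∀ j < i, φ (z j) = z' j) : φ (powDD z i m) = powDD z' i m := by
  induction m generalizing i with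
  | zero =>
    cases i with
    | zero => simp
    | succ i => rw [powDD_succ_zero, powDD_succ_zero]; split_ifs <;> simp
  | succ m ih =>
    cases i with
    | zero => simp
    | succ i =>
      rw [powDD_succ_succ, powDD_succ_succ, map_add, map_mul, ih i fun j hj => h j (by omega),
        ih (i + 1) h, h i (by omega)]

omit [IsDomain S] in
theorem rename_swap_powDD {k i l : ℕ} (h : k + i ≤ l) (m : ℕ) :
    rename (Equiv.swap l (l + 1)) (powDD (fun j => (X (k + j) : MvPolynomial ℕ S)) i m)
      = powDD (fun j => X (k + j)) i m :=
  map_powDD_eq (rename (Equiv.swap l (l + 1)) : MvPolynomial ℕ S →ₐ[S] _).toRingHom _ _ i m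
    fun _ _ => rename_swap_X_of_lt (Or.inl (by omega))

/-- Apply `∂_{k+c}` to the recursion of `powDD`: the part without the variable `y_{k+c}` is
invariant and dies, and the Leibniz rule reproduces the recursion with one more point. -/
theorem divDiff_powDD (k c m : ℕ) :
    divDiff (k + c) (powDD (fun j => (X (k + j) : MvPolynomial ℕ S)) (c + 1) m)
      = powDD (fun j => X (k + j)) (c + 2) m := by
  induction m with
  | zero =>
    rw [powDD_succ_zero, powDD_succ_zero, if_neg (Nat.succ_ne_zero c)]
    apply divDiff_eq_zero
    split_ifs <;> simp
  | succ m ih =>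
    rw [powDD_succ_succ, powDD_succ_succ, divDiff_add,
      divDiff_eq_zero (rename_swap_powDD le_rfl m), divDiff_mul, divDiff_X_self, ih, rename_X,
      Equiv.swap_apply_left, zero_add, one_mul, add_assoc]

/-- The operator `∂_{k + c - 1} ⋯ ∂_{k + 1} ∂_k`. -/
def blockDD (k c : ℕ) (f : MvPolynomial ℕ S) : MvPolynomial ℕ S := (block k c).foldr divDiff f

omit [IsDomain S] in
theorem blockDD_zero (k : ℕ) (f : MvPolynomial ℕ S) : blockDD k 0 f = f := rfl

omit [IsDomain S] in
theorem blockDD_succ (k c : ℕ) (f : MvPolynomial ℕ S) :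
    blockDD k (c + 1) f = divDiff (k + c) (blockDD k c f) := by
  have h : block k (c + 1) = (k + c) :: block k c := by simp [block, List.range'_concat]
  rw [blockDD, h]; rfl

theorem blockDD_add (k c : ℕ) (f g : MvPolynomial ℕ S) :
    blockDD k c (f + g) = blockDD k c f + blockDD k c g := by
  induction c with
  | zero => rfl
  | succ c ih => rw [blockDD_succ, ih, divDiff_add, blockDD_succ, blockDD_succ]

theorem blockDD_mul_of_fixed {k c : ℕ} {f : MvPolynomial ℕ S}
    (h : ∀ j, k ≤ j → j < k + c → rename (Equiv.swap j (j + 1)) f = f) (g : MvPolynomial ℕ S) :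
    blockDD k c (f * g) = f * blockDD k c g := by
  induction c with
  | zero => rfl
  | succ c ih =>
    rw [blockDD_succ, ih fun j h1 h2 => h j h1 (by omega),
      divDiff_mul_of_fixed (h (k + c) (by omega) (by omega)), blockDD_succ]

theorem blockDD_C_mul (k c : ℕ) (a : S) (g : MvPolynomial ℕ S) :
    blockDD k c (C a * g) = C a * blockDD k c g :=
  blockDD_mul_of_fixed (fun _ _ _ => rename_C _ _) g

/-- `blockDD` as a linear map. -/
def blockDDLin (k c : ℕ) : MvPolynomial ℕ S →ₗ[S] MvPolynomial ℕ S where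
  toFun := blockDD k c
  map_add' := blockDD_add k c
  map_smul' a f := by rw [smul_eq_C_mul, blockDD_C_mul, RingHom.id_apply, smul_eq_C_mul]

theorem blockDDLin_apply (k c : ℕ) (f : MvPolynomial ℕ S) : blockDDLin k c f = blockDD k c f := rfl

theorem blockDD_sum {ι : Type*} (k c : ℕ) (s : Finset ι) (f : ι → MvPolynomial ℕ S) :
    blockDD k c (∑ i ∈ s, f i) = ∑ i ∈ s, blockDD k c (f i) :=
  map_sum (blockDDLin k c) f s

/-- A block of the reduced word acts on powers of its first variable as one divided difference at `c
+ 1` points. Hence a block extracts the top coefficient of a polynomial in `y_k` of degree `c`. -/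
theorem blockDD_X_pow (k c m : ℕ) :
    blockDD k c (X k ^ m : MvPolynomial ℕ S) = powDD (fun j => X (k + j)) (c + 1) m := by
  induction c with
  | zero =>
    rw [blockDD_zero]
    induction m with
    | zero => rw [powDD_succ_zero, if_pos rfl, pow_zero]
    | succ m ih => rw [powDD_succ_succ, powDD_zero, ← ih, pow_succ, zero_add, mul_comm, add_zero]
  | succ c ih => rw [blockDD_succ, ih, divDiff_powDD]

theorem blockDD_aeval (k c : ℕ) (p : Polynomial S) :
    blockDD k c (Polynomial.aeval (X k) p : MvPolynomial ℕ S)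
      = ∑ m ∈ Finset.range (p.natDegree + 1), C (p.coeff m) * powDD (fun j => X (k + j)) (c + 1) m := by
  rw [Polynomial.aeval_eq_sum_range, ← blockDDLin_apply, map_sum]
  refine Finset.sum_congr rfl fun m _ => ?_
  rw [map_smul, blockDDLin_apply, blockDD_X_pow, smul_eq_C_mul]

theorem blockDD_aeval_of_natDegree_le {k c : ℕ} {p : Polynomial S} (h : p.natDegree ≤ c) :
    blockDD k c (Polynomial.aeval (X k) p : MvPolynomial ℕ S) = C (p.coeff c) := by
  rw [blockDD_aeval, Finset.sum_eq_single c]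
  · rw [powDD_self, mul_one]
  · intro m hm hne
    rw [powDD_of_lt _ (by have := Finset.mem_range.1 hm; omega), mul_zero]
  · intro hc
    rw [Polynomial.coeff_eq_zero_of_natDegree_lt (by simpa using hc), C_0, zero_mul]

theorem blockDD_aeval_of_natDegree_le_succ {k c : ℕ} {p : Polynomial S} (h : p.natDegree ≤ c + 1) :
    blockDD k c (Polynomial.aeval (X k) p : MvPolynomial ℕ S)
      = C (p.coeff c) + C (p.coeff (c + 1)) * ∑ j ∈ Finset.range (c + 1), X (k + j) := by
  have hsub : Finset.range (p.natDegree + 1) ⊆ Finset.range (c + 2) :=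
    Finset.range_subset_range.2 (by omega)
  rw [blockDD_aeval, Finset.sum_subset hsub, Finset.sum_range_succ, Finset.sum_range_succ,
    powDD_self, powDD_succ_self, mul_one, Finset.sum_eq_zero, zero_add]
  · intro m hm
    rw [powDD_of_lt _ (Finset.mem_range.1 hm), mul_zero]
  · intro m _ hm
    rw [Polynomial.coeff_eq_zero_of_natDegree_lt (by simpa using hm), C_0, zero_mul]

/-- The factor `y_{k+e+1}` passes through the first `e` operators. The next one, by the Leibniz
rule, turns it into `y_{k+e}` and leaves an extra term in `y_k, …, y_{k+e}`. The operator after that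
kills the extra term, and the others commute with `y_{k+e}`. -/
theorem blockDD_X_mul_X_pow (k e l m : ℕ) :
    blockDD k (e + 2 + l) (X (k + e + 1) * X k ^ m : MvPolynomial ℕ S)
      = X (k + e) * blockDD k (e + 2 + l) (X k ^ m) := by
  induction l with
  | zero =>
    rw [blockDD_X_pow, add_zero, blockDD_succ, blockDD_succ, blockDD_mul_of_fixed, blockDD_X_pow,
      divDiff_mul, divDiff_X_succ, rename_X, Equiv.swap_apply_right, divDiff_powDD, divDiff_add,
      ← add_assoc, divDiff_mul_of_fixed (by rw [map_neg, map_one]),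
      divDiff_eq_zero (rename_swap_powDD (show k + (e + 1) ≤ k + e + 1 by omega) m),
      mul_zero, zero_add, divDiff_mul_of_fixed (rename_swap_X_of_lt (Or.inl (by omega)))]
    · congr 1
      exact divDiff_powDD k (e + 1) m
    · intro j _ hj
      exact rename_swap_X_of_lt (Or.inr (by omega))
  | succ l ih =>
    rw [← add_assoc, blockDD_succ, ih,
      divDiff_mul_of_fixed (rename_swap_X_of_lt (Or.inl (by omega))), blockDD_succ]

theorem blockDD_X_mul_aeval {k i D : ℕ} (h1 : k ≤ i) (h2 : i + 1 < k + D) (p : Polynomial S) :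
    blockDD k D (X (i + 1) * Polynomial.aeval (X k) p : MvPolynomial ℕ S)
      = X i * blockDD k D (Polynomial.aeval (X k) p) := by
  obtain ⟨e, rfl⟩ := Nat.exists_eq_add_of_le h1
  obtain ⟨l, rfl⟩ : ∃ l, D = e + 2 + l := ⟨D - (e + 2), by omega⟩
  rw [Polynomial.aeval_eq_sum_range, Finset.mul_sum, ← blockDDLin_apply, ← blockDDLin_apply,
    map_sum, map_sum, Finset.mul_sum]
  refine Finset.sum_congr rfl fun m _ => ?_
  rw [mul_smul_comm, map_smul, map_smul, mul_smul_comm, blockDDLin_apply, blockDDLin_apply,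
    blockDD_X_mul_X_pow]

end divDiff

/-! ### The quantum Schubert polynomials of the simple transpositions -/

theorem map_qDelta {R T : Type*} [CommRing R] [CommRing T] (φ : R →+* T) (x q : ℕ → R) (k : ℕ)
    (t : R) : φ (qDelta x q k t) = qDelta (fun j => φ (x j)) (fun j => φ (q j)) k (φ t) := by
  rw [qDelta, qDelta, RingHom.map_det]
  congr 1
  ext a b
  rw [RingHom.mapMatrix_apply, Matrix.map_apply, Matrix.of_apply, Matrix.of_apply]
  split_ifs <;> simp

theorem aeval_deltaPoly (n k j : ℕ) :
    (Polynomial.aeval (X j) (deltaPoly n k) : MvPolynomial ℕ (XRing n))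
      = qDelta (fun j => C (xVar n j)) (fun j => C (C (qVar n j))) k (X j) := by
  have := map_qDelta (R := Polynomial (XRing n)) (T := MvPolynomial ℕ (XRing n))
    (Polynomial.eval₂RingHom C (X j)) (fun j => Polynomial.C (xVar n j))
    (fun j => Polynomial.C (C (qVar n j))) k Polynomial.X
  simp only [Polynomial.coe_eval₂RingHom, Polynomial.eval₂_C, Polynomial.eval₂_X] at this
  exact this

/-- The reindexing adds the trivial factor `Δ_0 = 1`, so that there is one factor for each of the
`n` blocks of the reduced word. -/
theorem doubleTop_eq_prod (n : ℕ) :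
    doubleTop n = ∏ j ∈ Finset.range n, Polynomial.aeval (X j) (deltaPoly n (n - 1 - j)) := by
  rw [doubleTop]
  simp only [← aeval_deltaPoly]
  cases n with
  | zero => simp
  | succ n =>
    rw [Finset.prod_range_succ _ n, ← Finset.prod_range_reflect]
    have : deltaPoly (n + 1) (n + 1 - 1 - n) = 1 := by
      rw [show n + 1 - 1 - n = 0 by omega]
      simp [deltaPoly, qDelta]
    rw [this, map_one, mul_one]
    refine Finset.prod_congr rfl fun j hj => ?_
    have := Finset.mem_range.1 hj
    rw [show n + 1 - (n + 1 - 1 - 1 - j + 1) - 1 = j by omega,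
      show n + 1 - 1 - 1 - j + 1 = n + 1 - 1 - j by omega]

theorem rename_swap_aeval {S : Type*} [CommRing S] {j k : ℕ} (h : j < k) (p : Polynomial S) :
    rename (Equiv.swap k (k + 1)) (Polynomial.aeval (X j) p : MvPolynomial ℕ S)
      = Polynomial.aeval (X j) p := by
  rw [← Polynomial.aeval_algHom_apply, rename_X, Equiv.swap_apply_of_ne_of_ne (by omega) (by omega)]

/-- The code of `u` is the staircase lowered by one at `j₀`. The blocks act from the last to the
first, and block `k` touches only the factor in `y_k` and what the previous blocks have left behind.
-/
theorem permDivDiff_suffix {n j₀ : ℕ} (hj : j₀ + 1 < n) (u : Equiv.Perm (Fin n))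
    (hu : ∀ i : Fin n, code u i = if (i : ℕ) = j₀ then n - 2 - i else n - 1 - i)
    (l : List (Fin n)) (k : ℕ) (hl : List.finRange n = (List.finRange n).take k ++ l)
    (hk : k + l.length = n) :
    (l.flatMap fun i : Fin n => block (i : ℕ) (code u i)).foldr divDiff (doubleTop n)
      = (∏ j ∈ Finset.range k, Polynomial.aeval (X j) (deltaPoly n (n - 1 - j))) *
        if k ≤ j₀ then C (∑ i ∈ Finset.range (n - 1 - j₀), xVar n i)
          + ∑ j ∈ Finset.range (n - 1 - j₀), X (k + j) else 1 := by
  induction l generalizing k with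
  | nil =>
    simp only [List.length_nil, add_zero] at hk
    subst hk
    rw [if_neg (by omega), mul_one, List.flatMap_nil, List.foldr_nil, doubleTop_eq_prod]
  | cons i l ih =>
    have hkn : k < n := by simp at hk; omega
    have hi : (i : ℕ) = k := by
      have := congrArg (fun L => L[k]?) hl
      simp [hkn, Nat.min_eq_left hkn.le] at this
      rw [← this]
    have hl' : List.finRange n = (List.finRange n).take (k + 1) ++ l := by
      have h2 : (List.finRange n).drop k = i :: l := by
        have := List.take_append_drop k (List.finRange n)
        exact List.append_cancel_left (this.trans hl)
      have h3 : (List.finRange n).drop (k + 1) = l := by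
        rw [← List.drop_drop, h2]; simp
      rw [← h3, List.take_append_drop]
    rw [List.flatMap_cons, List.foldr_append, ih (k + 1) hl' (by simp at hk; omega)]
    change blockDD _ _ _ = _
    rw [Finset.prod_range_succ, mul_assoc, hi, blockDD_mul_of_fixed]
    swap
    · intro j h1 _
      rw [map_prod]
      exact Finset.prod_congr rfl fun a ha =>
        rename_swap_aeval (by have := Finset.mem_range.1 ha; omega) _
    congr 1
    rw [hu i, hi]
    have hdeg := deltaPoly_natDegree_le n (n - 1 - k)
    -- Except at `j₀` a block is as long as the degree of its monic factor, which it turns into `1`;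
    -- below `j₀` it also moves each `y_{k+1+j}` to `y_{k+j}`. At `j₀` it is one letter short and
    -- leaves the sum of the `x`'s and `y`'s.
    rcases lt_trichotomy k j₀ with h | h | h
    · rw [if_neg (by omega), if_pos (by omega), if_pos (by omega), mul_add,
        blockDD_add, mul_comm _ (C _), blockDD_C_mul,
        blockDD_aeval_of_natDegree_le hdeg, deltaPoly_coeff_self, C_1, mul_one, Finset.mul_sum,
        blockDD_sum]
      congr 1
      refine Finset.sum_congr rfl fun j hj' => ?_
      have := Finset.mem_range.1 hj'
      rw [mul_comm, show k + 1 + j = k + j + 1 by omega,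
        blockDD_X_mul_aeval (by omega) (by omega), blockDD_aeval_of_natDegree_le hdeg,
        deltaPoly_coeff_self, C_1, mul_one]
    · rw [if_pos h, if_neg (by omega), if_pos (by omega), mul_one]
      obtain ⟨D, hD⟩ : ∃ D, n - 1 - k = D + 1 := ⟨n - 2 - k, by omega⟩
      rw [show n - 2 - k = D by omega, hD, blockDD_aeval_of_natDegree_le_succ (by
        rw [hD] at hdeg; exact hdeg), deltaPoly_coeff_self, deltaPoly_coeff_pred, C_1, one_mul,
        ← h, hD]
    · rw [if_neg (by omega), if_neg (by omega), if_neg (by omega), mul_one,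
        blockDD_aeval_of_natDegree_le hdeg, deltaPoly_coeff_self, C_1]

/-- There is a permutation whose quantum Schubert polynomial is `x₁ + ⋯ + x_k`, `0 < k < n`. -/
theorem exists_quantumSchubert_eq_sum {n k : ℕ} (hk : 0 < k) (hkn : k < n) :
    ∃ w : Equiv.Perm (Fin n), quantumSchubert w = ∑ i ∈ Finset.range k, xVar n i := by
  -- The choice `j₀ = n - 1 - k` leaves `k` variables in the sum. The permutation sought is `u w₀`,
  -- since `w₀² = 1`.
  obtain ⟨u, hu⟩ := exists_code_eq
    (fun i : Fin n => if (i : ℕ) = n - 1 - k then n - 2 - (i : ℕ) else n - 1 - i)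
    (fun i => by split_ifs <;> omega)
  refine ⟨u * Fin.revPerm, ?_⟩
  have h1 : u * Fin.revPerm * Fin.revPerm = u := by
    ext i; simp
  rw [quantumSchubert, doubleSchubert, h1, permDivDiff, reducedWord,
    permDivDiff_suffix (j₀ := n - 1 - k) (by omega) u (fun i => congrFun hu i) _ 0 (by simp)
      (by simp), if_pos (Nat.zero_le _), show n - 1 - (n - 1 - k) = k by omega]
  simp

/-! ### The exponential of a linear form -/

theorem coeff_linear_pow {σ A : Type*} [Fintype σ] [DecidableEq σ] [CommRing A] (c : σ → A)
    (d : ℕ) (e : σ →₀ ℕ) :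
    MvPowerSeries.coeff e ((∑ i, MvPowerSeries.C (c i) * MvPowerSeries.X i) ^ d) =
      if ∑ i, e i = d then (Nat.multinomial Finset.univ e : A) * ∏ i, c i ^ e i else 0 := by
  have hmon : ∀ k : σ → ℕ, ∏ i, (MvPowerSeries.C (c i) * MvPowerSeries.X i) ^ k i =
      MvPowerSeries.monomial (R := A) (Finsupp.equivFunOnFinite.symm k) (∏ i, c i ^ k i) := by
    intro k
    simp only [mul_pow, Finset.prod_mul_distrib, ← map_pow, ← map_prod]
    have : ∏ i, (MvPowerSeries.X i : MvPowerSeries σ A) ^ k i =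
        MvPowerSeries.monomial (Finsupp.equivFunOnFinite.symm k) 1 := by
      rw [MvPowerSeries.monomial_eq', Finsupp.prod_fintype _ _ (fun i => pow_zero _), map_one,
        one_mul]
      rfl
    rw [this, ← MvPowerSeries.smul_eq_C_mul, ← map_smul, smul_eq_mul, mul_one]
  rw [Finset.sum_pow_eq_sum_piAntidiag, map_sum]
  simp only [hmon]
  have hcast : ∀ (m : ℕ) (f : MvPowerSeries σ A), MvPowerSeries.coeff e ((m : MvPowerSeries σ A) * f)
      = m * MvPowerSeries.coeff e f := by
    intro m f
    rw [← nsmul_eq_mul, map_nsmul, nsmul_eq_mul]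
  simp only [hcast, MvPowerSeries.coeff_monomial]
  split_ifs with h
  · rw [Finset.sum_eq_single (e : σ → ℕ)]
    · rw [if_pos (by ext; rfl)]
    · intro k _ hk
      rw [if_neg, mul_zero]
      rintro rfl
      exact hk rfl
    · intro hk
      exact absurd (Finset.mem_piAntidiag.2 ⟨h, by simp⟩) hk
  · refine Finset.sum_eq_zero fun k hk => ?_
    rw [if_neg, mul_zero]
    rintro rfl
    exact h (Finset.mem_piAntidiag.1 hk).1

theorem coeff_exp_subst_linear {σ A : Type*} [Fintype σ] [CommRing A] [Algebra ℚ A] (c : σ → A)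
    (e : σ →₀ ℕ) :
    MvPowerSeries.coeff e ((PowerSeries.exp ℚ).subst
        (∑ i, MvPowerSeries.C (c i) * MvPowerSeries.X i)) =
      ((∏ i, (e i).factorial : ℕ) : ℚ)⁻¹ • ∏ i, c i ^ e i := by
  classical
  rw [PowerSeries.coeff_subst (PowerSeries.HasSubst.of_constantCoeff_zero (by simp))]
  rw [finsum_eq_single _ (∑ i, e i)]
  · rw [coeff_linear_pow, if_pos rfl, PowerSeries.coeff_exp, ← nsmul_eq_mul,
      ← Nat.cast_smul_eq_nsmul ℚ, smul_smul]
    congr 1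
    have h := Nat.multinomial_spec Finset.univ (e : σ → ℕ)
    have h' := congrArg (Nat.cast (R := ℚ)) h
    rw [Nat.cast_mul] at h'
    have h1 : ((∏ i, (e i).factorial : ℕ) : ℚ) ≠ 0 := by
      exact_mod_cast Finset.prod_ne_zero_iff.2 fun i _ => Nat.factorial_ne_zero _
    have h2 : (((∑ i, e i).factorial : ℕ) : ℚ) ≠ 0 := by exact_mod_cast Nat.factorial_ne_zero _
    rw [Algebra.algebraMap_self, RingHom.id_apply]
    field_simp
    linarith
  · intro d hd
    rw [coeff_linear_pow, if_neg hd.symm, smul_zero]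

theorem coeff_expSeries {n : ℕ} (a : Equiv.Perm (Fin n) →₀ ℕ) :
    MvPowerSeries.coeff a (expSeries n) =
      ((∏ w, (a w).factorial : ℕ) : ℚ)⁻¹ • ∏ w, quantumSchubert w ^ a w :=
  coeff_exp_subst_linear _ _

/-- The coefficientwise form of `∂/∂t_w exp(∑ t_v S̃_v) = S̃_w exp(∑ t_v S̃_v)`. -/
theorem coeff_expSeries_add_single {n : ℕ} (a : Equiv.Perm (Fin n) →₀ ℕ) (w : Equiv.Perm (Fin n)) :
    MvPowerSeries.coeff (a + Finsupp.single w 1) (expSeries n) * ((a w : ℕ) + 1) =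
      quantumSchubert w * MvPowerSeries.coeff a (expSeries n) := by
  have h1 : ∀ f : Equiv.Perm (Fin n) → XRing n, ∏ v, f v ^ ((a + Finsupp.single w 1 : Equiv.Perm (Fin n) →₀ ℕ) v) =
      f w * ∏ v, f v ^ a v := by
    intro f
    simp only [Finsupp.add_apply, pow_add, Finset.prod_mul_distrib, mul_comm (f w)]
    congr 1
    rw [Finset.prod_eq_single w] <;> simp +contextual [eq_comm]
  have h2 : ∏ v, ((a + Finsupp.single w 1 : Equiv.Perm (Fin n) →₀ ℕ) v).factorial = (a w + 1) * ∏ v, (a v).factorial := by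
    rw [← Finset.mul_prod_erase _ _ (Finset.mem_univ w),
      ← Finset.mul_prod_erase _ (fun v => (a v).factorial) (Finset.mem_univ w), ← mul_assoc]
    congr 1
    · simp [Nat.factorial_succ]
    · refine Finset.prod_congr rfl fun v hv => ?_
      simp [(Finset.ne_of_mem_erase hv).symm]
  have h3 : ((∏ v, (a v).factorial : ℕ) : ℚ) ≠ 0 := by
    exact_mod_cast Finset.prod_ne_zero_iff.2 fun i _ => Nat.factorial_ne_zero _
  rw [coeff_expSeries, coeff_expSeries, h1, h2, smul_mul_assoc, mul_smul_comm]
  have h4 : ∀ f : XRing n, f * ((a w : ℕ) + 1) = ((a w + 1 : ℕ) : ℚ) • f := by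
    intro f
    rw [Nat.cast_smul_eq_nsmul, nsmul_eq_mul, mul_comm]
    push_cast
    rfl
  rw [h4, smul_smul]
  congr 1
  have : ((a w + 1 : ℕ) : ℚ) ≠ 0 := by positivity
  rw [Nat.cast_mul]
  field_simp

/-! ### Normal forms modulo `Ĩ_n` and the residue over the field of fractions -/

/-- The coefficient of `x^k` in the normal form of a polynomial modulo `Ĩ_n`. -/
def normalCoeff (n : ℕ) (k : Fin n →₀ ℕ) : XRing n →ₗ[QRing n] QRing n :=
  nfCoeff (triGen_hasLead n) k

theorem normalCoeff_monomial {n : ℕ} (k : Fin n →₀ ℕ) {j : Fin n →₀ ℕ} (hj : j ≤ staircase n) :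
    normalCoeff n k (monomial j (1 : QRing n)) = if j = k then 1 else 0 :=
  nfCoeff_monomial_of_le _ k hj

theorem normalCoeff_of_mem {n : ℕ} {k : Fin n →₀ ℕ} (hk : k ≤ staircase n) {f : XRing n}
    (hf : f ∈ qIdeal n) : normalCoeff n k f = 0 :=
  nfCoeff_of_mem_ideal _ hk (by rwa [span_triGen])

theorem sub_normalForm_mem {n : ℕ} (f : XRing n) :
    f - ∑ k ∈ Finset.Iic (staircase n), normalCoeff n k f • monomial k (1 : QRing n) ∈ qIdeal n := by
  have h := sub_nf_mem_ideal (triGen_hasLead n) f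
  rw [span_triGen] at h
  exact h

theorem proj_spec {n : ℕ} (f : XRing n) : proj n f ∈ staircaseSpan n ∧ f - proj n f ∈ qIdeal n := by
  have h : ∃ r ∈ staircaseSpan n, f - r ∈ qIdeal n :=
    ⟨_, Submodule.sum_mem _ fun k hk => Submodule.smul_mem _ _
      (Submodule.subset_span ⟨k, Finset.mem_Iic.1 hk, rfl⟩), sub_normalForm_mem f⟩
  rw [proj, dif_pos h]
  exact h.choose_spec

theorem normalCoeff_of_mem_staircaseSpan {n : ℕ} {k : Fin n →₀ ℕ} {f : XRing n}
    (hf : f ∈ staircaseSpan n) : normalCoeff n k f = coeff k f := by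
  induction hf using Submodule.span_induction with
  | mem x hx =>
    obtain ⟨j, hj, rfl⟩ := hx
    rw [normalCoeff_monomial k hj, coeff_monomial]
  | zero => simp
  | add x y _ _ hx hy => rw [map_add, coeff_add, hx, hy]
  | smul a x _ hx => rw [map_smul, coeff_smul, hx]

theorem coeff_proj {n : ℕ} {k : Fin n →₀ ℕ} (hk : k ≤ staircase n) (f : XRing n) :
    coeff k (proj n f) = normalCoeff n k f := by
  have h := normalCoeff_of_mem hk (proj_spec f).2
  rw [map_sub, normalCoeff_of_mem_staircaseSpan (proj_spec f).1, sub_eq_zero] at h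
  exact h.symm

theorem triGenF_hasLead (n : ℕ) (i : Fin n) :
    HasLead (revDegLex n) (map (toField n) (triGen n i)) (Finsupp.single i (staircase n i + 1)) :=
  (triGen_hasLead n i).map (toField n)

/-- The coefficient of `x^k` in the normal form of a polynomial modulo `Ĩ_n`, over the field of
fractions of `ℚ[q][[t]]`. -/
def normalCoeffF (n : ℕ) (k : Fin n →₀ ℕ) : MvPolynomial (Fin n) (TField n) →ₗ[TField n] TField n :=
  nfCoeff (triGenF_hasLead n) k

theorem normalCoeffF_map {n : ℕ} (k : Fin n →₀ ℕ) (f : XRing n) :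
    normalCoeffF n k (map (toField n) f) = toField n (normalCoeff n k f) :=
  map_nfCoeff (triGen_hasLead n) (toField n) (triGenF_hasLead n) (fun _ => rfl) k f

theorem qIdealF_eq_map (n : ℕ) : qIdealF n = (qIdeal n).map (map (toField n)) := by
  rw [qIdealF, qIdeal, Ideal.map_span, ← Set.range_comp]
  rfl

theorem span_triGenF (n : ℕ) :
    Ideal.span (Set.range fun i => map (toField n) (triGen n i)) = qIdealF n := by
  rw [qIdealF_eq_map, ← span_triGen, Ideal.map_span, ← Set.range_comp]
  rfl

theorem normalCoeffF_of_mem {n : ℕ} {k : Fin n →₀ ℕ} (hk : k ≤ staircase n)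
    {f : MvPolynomial (Fin n) (TField n)} (hf : f ∈ qIdealF n) : normalCoeffF n k f = 0 :=
  nfCoeff_of_mem_ideal _ hk (by rwa [span_triGenF])

theorem sub_normalFormF_mem {n : ℕ} (f : MvPolynomial (Fin n) (TField n)) :
    f - ∑ k ∈ Finset.Iic (staircase n), normalCoeffF n k f • monomial k (1 : TField n)
      ∈ qIdealF n := by
  have h := sub_nf_mem_ideal (triGenF_hasLead n) f
  rw [span_triGenF] at h
  exact h

theorem mem_qIdealF_iff {n : ℕ} {f : MvPolynomial (Fin n) (TField n)} :
    f ∈ qIdealF n ↔ ∀ k ≤ staircase n, normalCoeffF n k f = 0 := by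
  refine ⟨fun h k hk => normalCoeffF_of_mem hk h, fun h => ?_⟩
  have h1 := sub_normalFormF_mem f
  rwa [Finset.sum_eq_zero (fun k hk => by rw [h k (Finset.mem_Iic.1 hk), zero_smul]), sub_zero]
    at h1

theorem det_map_of_det_eq {R S : Type*} [CommRing R] [CommRing S] (φ : R →+* S) {n : ℕ}
    {V : Matrix (Fin n) (Fin n) R} {c : R} (h : V.det = c) : (V.map φ).det = φ c := by
  rw [← h, RingHom.map_det]
  rfl

theorem exists_grothendieckResidue_eq (n : ℕ) : ∃ c : ℤ, c * c = 1 ∧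
    grothendieckResidue (eTildeF n) = (c : TField n) • normalCoeffF n (staircase n) := by
  obtain ⟨V, c, hc, hdet, hV⟩ := exists_triGen_transform n
  refine ⟨c, hc, ?_⟩
  have h1 : IsGrothendieckResidue (fun i => map (toField n) (triGen n i))
    (normalCoeffF n (staircase n)) := isGrothendieckResidue_nfCoeff (triGenF_hasLead n)
  refine (h1.transform (V.map (map (toField n))) (g := eTildeF n) (fun i => ?_)
    (span_triGenF n).symm (c : TField n) (c : TField n) ?_ ?_).eq
  · rw [eTildeF, hV, map_sum]
    refine Finset.sum_congr rfl fun j _ => ?_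
    rw [map_mul]
    rfl
  · rw [← Int.cast_mul, hc, Int.cast_one]
  · rw [det_map_of_det_eq (map (toField n)) hdet, map_C, map_intCast]

/-! ### The derivatives in `t` -/

theorem tDeriv_algebraMap {n : ℕ} (w : Equiv.Perm (Fin n)) (a : TRing n) :
    tDeriv w (algebraMap (TRing n) (TField n) a) =
      algebraMap (TRing n) (TField n) (MvPowerSeries.pderiv (QRing n) w a) := by
  have h := tDeriv_div w a 1 one_ne_zero
  simpa using h

theorem exists_eq_div {n : ℕ} (z : TField n) : ∃ a b : TRing n, b ≠ 0 ∧
    algebraMap (TRing n) (TField n) b ≠ 0 ∧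
    algebraMap (TRing n) (TField n) a / algebraMap (TRing n) (TField n) b = z := by
  obtain ⟨a, b, hb, h⟩ := IsFractionRing.div_surjective (A := TRing n) z
  have hb0 : b ≠ 0 := nonZeroDivisors.ne_zero hb
  exact ⟨a, b, hb0, fun h => hb0 (IsFractionRing.injective (TRing n) (TField n)
    (h.trans (map_zero _).symm)), h⟩

theorem tDeriv_add {n : ℕ} (w : Equiv.Perm (Fin n)) (y z : TField n) :
    tDeriv w (y + z) = tDeriv w y + tDeriv w z := by
  obtain ⟨a, b, hb, hb', rfl⟩ := exists_eq_div y
  obtain ⟨c, d, hd, hd', rfl⟩ := exists_eq_div z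
  rw [div_add_div _ _ hb' hd', ← map_mul, ← map_mul, ← map_mul, ← map_add,
    tDeriv_div w _ _ (mul_ne_zero hb hd), tDeriv_div w a b hb, tDeriv_div w c d hd]
  simp only [map_add, map_mul, Derivation.leibniz, smul_eq_mul]
  field_simp
  ring

theorem tDeriv_mul {n : ℕ} (w : Equiv.Perm (Fin n)) (y z : TField n) :
    tDeriv w (y * z) = y * tDeriv w z + tDeriv w y * z := by
  obtain ⟨a, b, hb, hb', rfl⟩ := exists_eq_div y
  obtain ⟨c, d, hd, hd', rfl⟩ := exists_eq_div z
  rw [div_mul_div_comm, ← map_mul, ← map_mul,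
    tDeriv_div w _ _ (mul_ne_zero hb hd), tDeriv_div w a b hb, tDeriv_div w c d hd]
  simp only [map_mul, map_add, Derivation.leibniz, smul_eq_mul]
  field_simp
  ring

/-- `tDeriv` as a homomorphism of additive groups. -/
def tDerivHom {n : ℕ} (w : Equiv.Perm (Fin n)) : TField n →+ TField n :=
  AddMonoidHom.mk' (tDeriv w) (tDeriv_add w)

theorem tDeriv_zero {n : ℕ} (w : Equiv.Perm (Fin n)) : tDeriv w (0 : TField n) = 0 :=
  map_zero (tDerivHom w)

theorem tDeriv_sum {n : ℕ} {ι : Type*} (w : Equiv.Perm (Fin n)) (s : Finset ι)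
    (f : ι → TField n) : tDeriv w (∑ i ∈ s, f i) = ∑ i ∈ s, tDeriv w (f i) :=
  map_sum (tDerivHom w) f s

theorem tDeriv_toField {n : ℕ} (w : Equiv.Perm (Fin n)) (c : QRing n) :
    tDeriv w (toField n c) = 0 := by
  rw [toField, RingHom.comp_apply, tDeriv_algebraMap, MvPowerSeries.pderiv_C, map_zero]

theorem tDeriv_mul_toField {n : ℕ} (w : Equiv.Perm (Fin n)) (z : TField n) (c : QRing n) :
    tDeriv w (z * toField n c) = tDeriv w z * toField n c := by
  rw [tDeriv_mul, tDeriv_toField, mul_zero, zero_add]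

theorem coeff_tDerivPoly {n : ℕ} (w : Equiv.Perm (Fin n)) (f : MvPolynomial (Fin n) (TField n))
    (k : Fin n →₀ ℕ) : coeff k (tDerivPoly w f) = tDeriv w (coeff k f) := by
  rw [tDerivPoly, coeff_sum]
  simp only [coeff_monomial, Finset.sum_ite_eq']
  split_ifs with h
  · rfl
  · rw [notMem_support_iff.1 h, tDeriv_zero]

theorem tDerivPoly_mul {n : ℕ} (w : Equiv.Perm (Fin n)) (f g : MvPolynomial (Fin n) (TField n)) :
    tDerivPoly w (f * g) = f * tDerivPoly w g + tDerivPoly w f * g := by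
  ext k
  rw [coeff_add, coeff_tDerivPoly, coeff_mul, coeff_mul, coeff_mul, tDeriv_sum,
    ← Finset.sum_add_distrib]
  refine Finset.sum_congr rfl fun x _ => ?_
  rw [tDeriv_mul, coeff_tDerivPoly, coeff_tDerivPoly]

/-- The normal forms of the monomials have coefficients in `ℚ[q]`, which `∂/∂t_w` kills. -/
theorem tDeriv_normalCoeffF {n : ℕ} (w : Equiv.Perm (Fin n)) (k : Fin n →₀ ℕ)
    (f : MvPolynomial (Fin n) (TField n)) :
    tDeriv w (normalCoeffF n k f) = normalCoeffF n k (tDerivPoly w f) := by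
  have hmon : ∀ (j : Fin n →₀ ℕ) (c : TField n), normalCoeffF n k (monomial j c) =
      c * toField n (normalCoeff n k (monomial j 1)) := by
    intro j c
    rw [← normalCoeffF_map, map_monomial, map_one, ← smul_eq_mul c, ← map_smul, smul_monomial,
      smul_eq_mul, mul_one]
  conv_lhs => rw [f.as_sum]
  rw [tDerivPoly, map_sum, map_sum, tDeriv_sum]
  refine Finset.sum_congr rfl fun j _ => ?_
  rw [hmon, hmon, tDeriv_mul_toField]

/-- The series in `t` whose coefficients are the coefficients of `x^J` in the normal forms of the
coefficients of `g exp (∑ t_w S̃_w)`. -/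
def kernelSeries {n : ℕ} (J : Fin n →₀ ℕ) (g : XRing n) : TRing n :=
  fun a => normalCoeff n J (g * MvPowerSeries.coeff a (expSeries n))

theorem coeff_kernelSeries {n : ℕ} (J : Fin n →₀ ℕ) (g : XRing n)
    (a : Equiv.Perm (Fin n) →₀ ℕ) : MvPowerSeries.coeff a (kernelSeries J g) =
      normalCoeff n J (g * MvPowerSeries.coeff a (expSeries n)) := rfl

/-- The exponential and its projection `K` agree modulo `Ĩ_n` in each coefficient in `t`, so either
may be used inside a normal form. -/
theorem kernelSeries_eq_sum {n : ℕ} {J : Fin n →₀ ℕ} (hJ : J ≤ staircase n) (g : XRing n) :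
    kernelSeries J g = ∑ I ∈ Finset.Iic (staircase n),
      MvPowerSeries.C (normalCoeff n J (g * monomial I (1 : QRing n))) * kernelCoeff n I := by
  ext1 a
  have h2 := normalCoeff_of_mem hJ (Ideal.mul_mem_left _ g
    (sub_normalForm_mem (MvPowerSeries.coeff a (expSeries n))))
  rw [mul_sub, map_sub, sub_eq_zero] at h2
  rw [coeff_kernelSeries, h2, Finset.mul_sum, map_sum, map_sum]
  refine Finset.sum_congr rfl fun I hI => ?_
  have hk : MvPowerSeries.coeff a (kernelCoeff n I) =
      normalCoeff n I (MvPowerSeries.coeff a (expSeries n)) := coeff_proj (Finset.mem_Iic.1 hI) _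
  rw [mul_smul_comm, map_smul, MvPowerSeries.coeff_C_mul, hk, smul_eq_mul, mul_comm]

theorem normalCoeffF_map_mul_kernel {n : ℕ} {J : Fin n →₀ ℕ} (hJ : J ≤ staircase n)
    (g : XRing n) : normalCoeffF n J (map (toField n) g * kernel n) =
      algebraMap (TRing n) (TField n) (kernelSeries J g) := by
  rw [kernelSeries_eq_sum hJ, kernel, Finset.mul_sum, map_sum, map_sum]
  refine Finset.sum_congr rfl fun I _ => ?_
  have hmon : ∀ c : TField n, map (toField n) g * monomial I c =
      c • map (toField n) (g * monomial I (1 : QRing n)) := by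
    intro c
    rw [map_mul, map_monomial, map_one (toField n), ← mul_smul_comm, smul_monomial, smul_eq_mul,
      mul_one]
  rw [hmon, map_smul, normalCoeffF_map, map_mul (algebraMap (TRing n) (TField n)), smul_eq_mul,
    mul_comm]
  rfl

theorem pderiv_kernelSeries {n : ℕ} (w : Equiv.Perm (Fin n)) (J : Fin n →₀ ℕ) (g : XRing n) :
    MvPowerSeries.pderiv (QRing n) w (kernelSeries J g) =
      kernelSeries J (g * quantumSchubert w) := by
  ext1 a
  rw [MvPowerSeries.coeff_pderiv, coeff_kernelSeries, coeff_kernelSeries, mul_assoc,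
    ← coeff_expSeries_add_single, ← mul_assoc, mul_comm _ ((a w : QRing n) + 1), ← smul_eq_mul,
    ← map_smul, smul_eq_C_mul, mul_comm (C _)]
  simp

/-- Both terms have the same normal form coefficients: `K` may be replaced by the exponential, and
differentiating that multiplies by `S̃_w`. -/
theorem tDerivPoly_kernel_sub_mem {n : ℕ} (w : Equiv.Perm (Fin n)) :
    tDerivPoly w (kernel n) - quantumSchubertF w * kernel n ∈ qIdealF n := by
  refine mem_qIdealF_iff.2 fun J hJ => ?_
  have h1 := normalCoeffF_map_mul_kernel hJ 1
  rw [map_one, one_mul] at h1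
  rw [map_sub, sub_eq_zero, ← tDeriv_normalCoeffF, h1, tDeriv_algebraMap, pderiv_kernelSeries,
    one_mul, quantumSchubertF, normalCoeffF_map_mul_kernel hJ]

/-! ### The pairing -/

theorem pairing_comm {n : ℕ} (f g : MvPolynomial (Fin n) (TField n)) :
    pairing f g = pairing g f := by
  rw [pairing, pairing, mul_comm f g]

/-- The pairing as a bilinear form. -/
def pairingForm (n : ℕ) : LinearMap.BilinForm (TField n) (MvPolynomial (Fin n) (TField n)) :=
  LinearMap.mk₂ (TField n) pairing
    (fun f g h => by simp only [pairing, add_mul, map_add])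
    (fun c f g => by simp only [pairing, smul_mul_assoc, map_smul])
    (fun f g h => by simp only [pairing, mul_add, add_mul, map_add])
    (fun c f g => by simp only [pairing, smul_mul_assoc, mul_smul_comm, map_smul])

theorem pairingForm_apply {n : ℕ} (f g : MvPolynomial (Fin n) (TField n)) :
    pairingForm n f g = pairing f g := rfl

theorem pairing_mul_left {n : ℕ} (s f g : MvPolynomial (Fin n) (TField n)) :
    pairing (s * f) g = pairing f (s * g) := by
  rw [pairing, pairing]
  congr 1
  ring

theorem grothendieckResidue_eTildeF_of_mem {n : ℕ} {f : MvPolynomial (Fin n) (TField n)}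
    (hf : f ∈ qIdealF n) : grothendieckResidue (eTildeF n) f = 0 := by
  obtain ⟨c, _, h⟩ := exists_grothendieckResidue_eq n
  rw [h, LinearMap.smul_apply, normalCoeffF_of_mem le_rfl hf, smul_zero]

theorem pairing_of_mem {n : ℕ} {f : MvPolynomial (Fin n) (TField n)} (hf : f ∈ qIdealF n)
    (g : MvPolynomial (Fin n) (TField n)) : pairing f g = 0 := by
  rw [pairing, mul_assoc]
  exact grothendieckResidue_eTildeF_of_mem (Ideal.mul_mem_right _ _ hf)

theorem tDeriv_grothendieckResidue {n : ℕ} (w : Equiv.Perm (Fin n))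
    (f : MvPolynomial (Fin n) (TField n)) :
    tDeriv w (grothendieckResidue (eTildeF n) f) =
      grothendieckResidue (eTildeF n) (tDerivPoly w f) := by
  obtain ⟨c, _, h⟩ := exists_grothendieckResidue_eq n
  have hc : (c : TField n) = toField n (c : QRing n) := (map_intCast _ c).symm
  rw [h, LinearMap.smul_apply, LinearMap.smul_apply, ← tDeriv_normalCoeffF, smul_eq_mul,
    smul_eq_mul, mul_comm, hc, tDeriv_mul_toField, mul_comm]

/-- The residue commutes with the derivation, so this is the Leibniz rule for `f g K`; the last term
comes from the kernel. -/
theorem tDeriv_pairing {n : ℕ} (w : Equiv.Perm (Fin n)) (f g : MvPolynomial (Fin n) (TField n)) :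
    tDeriv w (pairing f g) = pairing (tDerivPoly w f) g + pairing f (tDerivPoly w g) +
      pairing (quantumSchubertF w * f) g := by
  have h := grothendieckResidue_eTildeF_of_mem (Ideal.mul_mem_left _ (f * g)
    (tDerivPoly_kernel_sub_mem w))
  rw [mul_sub, map_sub, sub_eq_zero] at h
  rw [pairing, tDeriv_grothendieckResidue, tDerivPoly_mul, tDerivPoly_mul, map_add, h, add_mul,
    map_add, pairing, pairing, pairing,
    show f * g * (quantumSchubertF w * kernel n) = quantumSchubertF w * f * g * kernel n by ring]
  ring

/-! ### Determinants of inverse factorials -/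

/-- Inclusion–exclusion for the `b`-subsets of a `D`-set that avoid a fixed `a`-set; the proof is by
Pascal's rule. The sum may have any length beyond `a`, which the induction needs. -/
theorem choose_sub_eq_sum {a D : ℕ} (h : a ≤ D) (b : ℕ) {N : ℕ} (hN : a < N) :
    ((D - a).choose b : ℚ) = ∑ k ∈ Finset.range N,
      (-1) ^ k * (a.choose k : ℚ) * (if k ≤ b then ((D - k).choose (b - k) : ℚ) else 0) := by
  induction a generalizing D b N with
  | zero =>
    rw [Finset.sum_eq_single 0]
    · simp
    · intro k _ hk
      rw [Nat.choose_eq_zero_of_lt (by omega : 0 < k)]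
      simp
    · intro h
      exact absurd (Finset.mem_range.2 hN) h
  | succ a ih =>
    obtain ⟨N, rfl⟩ : ∃ M, N = M + 1 := ⟨N - 1, by omega⟩
    obtain ⟨E, rfl⟩ : ∃ E, D = E + 1 := ⟨D - 1, by omega⟩
    have h1 : ((E + 1 - a).choose b : ℚ) = _ := ih (D := E + 1) (by omega) b (N := N + 1) (by omega)
    rw [Finset.sum_range_succ'] at h1 ⊢
    have h3 : ∑ k ∈ Finset.range N, (-1 : ℚ) ^ (k + 1) * ((a + 1).choose (k + 1) : ℚ) *
        (if k + 1 ≤ b then ((E + 1 - (k + 1)).choose (b - (k + 1)) : ℚ) else 0) =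
        (∑ k ∈ Finset.range N, (-1 : ℚ) ^ (k + 1) * (a.choose (k + 1) : ℚ) *
        (if k + 1 ≤ b then ((E + 1 - (k + 1)).choose (b - (k + 1)) : ℚ) else 0)) -
        ∑ k ∈ Finset.range N, (-1 : ℚ) ^ k * (a.choose k : ℚ) *
        (if k + 1 ≤ b then ((E - k).choose (b - (k + 1)) : ℚ) else 0) := by
      rw [← Finset.sum_sub_distrib]
      refine Finset.sum_congr rfl fun k _ => ?_
      rw [Nat.choose_succ_succ, show E + 1 - (k + 1) = E - k by omega]
      push_cast
      ring
    rw [h3, show E + 1 - (a + 1) = E - a by omega]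
    have h4 : E + 1 - a = E - a + 1 := by omega
    rw [h4] at h1
    simp only [Nat.choose_zero_right] at h1 ⊢
    cases b with
    | zero => simp
    | succ b =>
      have h2 := ih (D := E) (by omega) b (N := N) (by omega)
      rw [Nat.choose_succ_succ] at h1
      simp only [Nat.add_sub_add_right, Nat.add_le_add_iff_right, Nat.zero_le, if_true, Nat.sub_zero,
        Nat.cast_one] at h1 h2 ⊢
      push_cast at h1
      linarith

/-- `1 / (D - a - b)!`, and zero if `a + b > D`. -/
def invFactorial (D a b : ℕ) : ℚ := if a + b ≤ D then ((D - (a + b)).factorial : ℚ)⁻¹ else 0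

theorem invFactorial_eq {D a b : ℕ} (ha : a ≤ D) : invFactorial D a b =
    ((D - a).factorial : ℚ)⁻¹ * ((D - a).choose b : ℚ) * (b.factorial : ℚ) := by
  rw [invFactorial]
  split_ifs with h
  · have h1 := Nat.choose_mul_factorial_mul_factorial (show b ≤ D - a by omega)
    rw [show D - (a + b) = D - a - b by omega, ← h1]
    have h2 : ((D - a).choose b : ℚ) ≠ 0 := by
      exact_mod_cast (Nat.choose_pos (show b ≤ D - a by omega)).ne'
    have h3 : (b.factorial : ℚ) ≠ 0 := by exact_mod_cast b.factorial_ne_zero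
    have h4 : ((D - a - b).factorial : ℚ) ≠ 0 := by exact_mod_cast (D - a - b).factorial_ne_zero
    push_cast
    field_simp
  · rw [Nat.choose_eq_zero_of_lt (by omega)]
    simp

/-- `1/(D - a - b)! = C(D - a, b) b!/(D - a)!`, and `choose_sub_eq_sum` writes `C(D - a, b)` as a
lower unitriangular matrix times a sign matrix times an upper unitriangular one. Taking products
over `i` keeps this shape, provided the intermediate exponents `K ≤ c u` stay in the index set,
which is `hdown`. -/
theorem det_invFactorial_ne_zero {ι : Type*} [Fintype ι] [DecidableEq ι] {n : ℕ}
    (δ : Fin n → ℕ) (c : ι → Fin n → ℕ) (hc : Function.Injective c) (hle : ∀ u, c u ≤ δ)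
    (hdown : ∀ u K, K ≤ c u → ∃ v, c v = K) :
    (Matrix.of fun u v => ∏ i, invFactorial (δ i) (c u i) (c v i)).det ≠ 0 := by
  let P : Matrix ι ι ℚ := Matrix.of fun u k => ∏ i, ((c u i).choose (c k i) : ℚ)
  let Q : Matrix ι ι ℚ := Matrix.of fun k v =>
    ∏ i, if c k i ≤ c v i then ((δ i - c k i).choose (c v i - c k i) : ℚ) else 0
  have hfac : (Matrix.of fun u v => ∏ i, invFactorial (δ i) (c u i) (c v i)) =
      Matrix.diagonal (fun u => ∏ i, ((δ i - c u i).factorial : ℚ)⁻¹) *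
        (P * Matrix.diagonal (fun k => ∏ i, (-1) ^ c k i) * Q) *
        Matrix.diagonal (fun v => ∏ i, ((c v i).factorial : ℚ)) := by
    ext u v
    rw [Matrix.mul_diagonal, Matrix.diagonal_mul, Matrix.of_apply]
    simp only [invFactorial_eq (hle u _), Finset.prod_mul_distrib]
    congr 2
    rw [Matrix.mul_apply]
    simp only [Matrix.mul_diagonal, P, Q, Matrix.of_apply, ← Finset.prod_mul_distrib]
    rw [Finset.prod_congr rfl fun i _ => choose_sub_eq_sum (hle u i) (c v i)
      (Nat.lt_succ_self (c u i)), Finset.prod_univ_sum]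
    symm
    have himg : ∀ K ∈ Fintype.piFinset fun i => Finset.range (c u i).succ,
        K ∈ Finset.univ.image c := by
      intro K hK
      obtain ⟨k, rfl⟩ := hdown u K fun i =>
        Nat.lt_succ_iff.1 (Finset.mem_range.1 (Fintype.mem_piFinset.1 hK i))
      exact Finset.mem_image_of_mem _ (Finset.mem_univ _)
    rw [Finset.sum_subset (fun K hK => himg K hK), Finset.sum_image fun x _ y _ h => hc h]
    · refine Finset.sum_congr rfl fun k _ => Finset.prod_congr rfl fun i _ => ?_
      ring
    · intro K _ hK
      obtain ⟨i, hi⟩ : ∃ i, c u i < K i := by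
        by_contra! h
        exact hK (Fintype.mem_piFinset.2 fun i => Finset.mem_range.2 (Nat.lt_succ_of_le (h i)))
      refine Finset.prod_eq_zero (Finset.mem_univ i) ?_
      rw [Nat.choose_eq_zero_of_lt hi]
      simp
  -- Any linear extension of the componentwise order makes both factors triangular.
  let _ : LinearOrder ι := LinearOrder.lift' (fun u => toLex (c u)) fun x y h => hc h
  have hlt : ∀ {u v : ι}, u < v → ∃ i, c u i < c v i := by
    intro u v h
    by_contra! h'
    have : toLex (c v) ≤ toLex (c u) := Pi.toLex_monotone h'
    exact absurd h (not_lt.2 this)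
  have hP : P.det = 1 := by
    rw [Matrix.det_of_isLowerTriangular]
    · simp [P]
    · intro u v h
      obtain ⟨i, hi⟩ := hlt h
      refine Finset.prod_eq_zero (Finset.mem_univ i) ?_
      rw [Nat.choose_eq_zero_of_lt (show c u i < c v i from hi), Nat.cast_zero]
  have hQ : Q.det = 1 := by
    rw [Matrix.det_of_isUpperTriangular]
    · simp [Q]
    · intro u v h
      obtain ⟨i, hi⟩ := hlt h
      exact Finset.prod_eq_zero (Finset.mem_univ i) (if_neg (not_le.2 hi))
  rw [hfac]
  simp only [Matrix.det_mul, hP, hQ, Matrix.det_diagonal, one_mul, mul_one]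
  refine mul_ne_zero (mul_ne_zero ?_ ?_) ?_ <;>
    refine Finset.prod_ne_zero_iff.2 fun u _ => Finset.prod_ne_zero_iff.2 fun i _ => ?_
  · exact inv_ne_zero (by exact_mod_cast Nat.factorial_ne_zero _)
  · exact pow_ne_zero _ (by norm_num)
  · exact_mod_cast Nat.factorial_ne_zero _

/-! ### Lowest terms of power series -/

section lowTerm
variable {σ A : Type*} [CommRing A] {n : ℕ}

/-- Among the exponents in `T`, graded by `ω`, the series `f` has no terms with `p + ω a ≺ d`, and
`c` as its coefficient where `p + ω a = d`; if this does not happen, then `c = 0`. -/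
structure LowTerm (m : MonomialOrder (Fin n)) (T : AddSubmonoid (σ →₀ ℕ))
    (ω : (σ →₀ ℕ) →+ (Fin n →₀ ℕ)) (f : MvPowerSeries σ A) (p d : Fin n →₀ ℕ) (c : A) : Prop where
  coeff_of_lt : ∀ a ∈ T, m.toSyn (p + ω a) < m.toSyn d → MvPowerSeries.coeff a f = 0
  coeff_of_eq : ∀ a ∈ T, p + ω a = d → MvPowerSeries.coeff a f = c
  eq_zero : (∀ a ∈ T, p + ω a ≠ d) → c = 0

variable {m : MonomialOrder (Fin n)} {T : AddSubmonoid (σ →₀ ℕ)} {ω : (σ →₀ ℕ) →+ (Fin n →₀ ℕ)}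
  {f g : MvPowerSeries σ A} {p p' d d' : Fin n →₀ ℕ} {c c' : A}

theorem LowTerm.zero : LowTerm m T ω (0 : MvPowerSeries σ A) p d 0 :=
  ⟨fun _ _ _ => by simp, fun _ _ _ => by simp, fun _ => rfl⟩

theorem LowTerm.add (hf : LowTerm m T ω f p d c) (hg : LowTerm m T ω g p d c') :
    LowTerm m T ω (f + g) p d (c + c') :=
  ⟨fun a ha h => by rw [map_add, hf.1 a ha h, hg.1 a ha h, add_zero],
    fun a ha h => by rw [map_add, hf.2 a ha h, hg.2 a ha h],
    fun h => by rw [hf.3 h, hg.3 h, add_zero]⟩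

theorem LowTerm.zsmul (hf : LowTerm m T ω f p d c) (z : ℤ) :
    LowTerm m T ω (z • f) p d (z • c) :=
  ⟨fun a ha h => by rw [map_zsmul, hf.1 a ha h, smul_zero],
    fun a ha h => by rw [map_zsmul, hf.2 a ha h],
    fun h => by rw [hf.3 h, smul_zero]⟩

theorem LowTerm.sum {ι : Type*} (s : Finset ι) {f : ι → MvPowerSeries σ A} {c : ι → A}
    (h : ∀ i ∈ s, LowTerm m T ω (f i) p d (c i)) :
    LowTerm m T ω (∑ i ∈ s, f i) p d (∑ i ∈ s, c i) := by
  classical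
  induction s using Finset.induction_on with
  | empty => exact LowTerm.zero
  | insert i s hi ih =>
    rw [Finset.sum_insert hi, Finset.sum_insert hi]
    exact (h i (Finset.mem_insert_self i s)).add
      (ih fun j hj => h j (Finset.mem_insert_of_mem hj))

variable (hT : ∀ a b, a + b ∈ T → a ∈ T) (hω : ∀ a ∈ T, ∀ b ∈ T, ω a = ω b → a = b)

-- In a product, the two lowest degrees can only be reached together, and by at most one pair of
-- exponents because `ω` is injective on `T`. If one factor does not reach its lowest degree, its
-- `c` is `0` by `eq_zero`, which is what makes the formula hold in all cases.
include hT hω in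
theorem LowTerm.mul (hf : LowTerm m T ω f p d c) (hg : LowTerm m T ω g p' d' c') :
    LowTerm m T ω (f * g) (p + p') (d + d') (c * c') := by
  classical
  have key : ∀ a b, a ∈ T → b ∈ T → m.toSyn (p + p' + ω (a + b)) ≤ m.toSyn (d + d') →
      MvPowerSeries.coeff a f * MvPowerSeries.coeff b g ≠ 0 → p + ω a = d ∧ p' + ω b = d' := by
    intro a b ha hb hle hne
    have h1 : m.toSyn d ≤ m.toSyn (p + ω a) := not_lt.1 fun h => hne (by rw [hf.1 a ha h, zero_mul])
    have h2 : m.toSyn d' ≤ m.toSyn (p' + ω b) :=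
      not_lt.1 fun h => hne (by rw [hg.1 b hb h, mul_zero])
    rw [map_add ω, add_add_add_comm, map_add m.toSyn, map_add m.toSyn d] at hle
    have h3 : m.toSyn (p + ω a) ≤ m.toSyn d :=
      le_of_add_le_add_right ((add_le_add_right h2 _).trans hle)
    have h4 : m.toSyn (p' + ω b) ≤ m.toSyn d' :=
      le_of_add_le_add_left ((add_le_add_left h1 _).trans hle)
    exact ⟨m.toSyn.injective (le_antisymm h3 h1), m.toSyn.injective (le_antisymm h4 h2)⟩
  have hT' : ∀ a b, a + b ∈ T → b ∈ T := fun a b h => hT b a (by rwa [add_comm])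
  refine ⟨fun a ha h => ?_, fun a ha h => ?_, fun h => ?_⟩
  · rw [MvPowerSeries.coeff_mul]
    refine Finset.sum_eq_zero fun x hx => ?_
    rw [Finset.HasAntidiagonal.mem_antidiagonal] at hx
    by_contra hne
    rw [← hx] at h ha
    obtain ⟨h1, h2⟩ := key x.1 x.2 (hT _ _ ha) (hT' _ _ ha) h.le hne
    rw [map_add ω, add_add_add_comm, h1, h2] at h
    exact h.false
  · rw [MvPowerSeries.coeff_mul]
    by_cases hex : (∃ b ∈ T, p + ω b = d) ∧ ∃ b ∈ T, p' + ω b = d'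
    · obtain ⟨⟨b, hb, hb'⟩, b', hb1, hb2⟩ := hex
      have hsum : b + b' = a := by
        refine hω _ (T.add_mem hb hb1) _ ha (add_left_cancel (a := p + p') ?_)
        rw [h, map_add, add_add_add_comm, hb', hb2]
      rw [Finset.sum_eq_single (b, b')]
      · rw [hf.2 b hb hb', hg.2 b' hb1 hb2]
      · rintro ⟨x, y⟩ hx hxb
        rw [Finset.HasAntidiagonal.mem_antidiagonal] at hx
        by_contra hne
        dsimp only at hx hne
        rw [← hx] at h ha
        obtain ⟨h1, h2⟩ := key x y (hT _ _ ha) (hT' _ _ ha) (by rw [h]) hne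
        refine hxb (Prod.ext ?_ ?_)
        · exact hω _ (hT _ _ ha) _ hb (add_left_cancel (h1.trans hb'.symm))
        · exact hω _ (hT' _ _ ha) _ hb1 (add_left_cancel (h2.trans hb2.symm))
      · intro hn
        exact absurd (Finset.HasAntidiagonal.mem_antidiagonal.2 hsum) hn
    · have hcc : c * c' = 0 := by
        rcases not_and_or.1 hex with h1 | h1 <;> push Not at h1
        · rw [hf.3 h1, zero_mul]
        · rw [hg.3 h1, mul_zero]
      rw [hcc]
      refine Finset.sum_eq_zero fun x hx => ?_
      rw [Finset.HasAntidiagonal.mem_antidiagonal] at hx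
      by_contra hne
      rw [← hx] at h ha
      obtain ⟨h1, h2⟩ := key x.1 x.2 (hT _ _ ha) (hT' _ _ ha) (by rw [h]) hne
      exact hex ⟨⟨_, hT _ _ ha, h1⟩, ⟨_, hT' _ _ ha, h2⟩⟩
  · by_cases h1 : ∀ a ∈ T, p + ω a ≠ d
    · rw [hf.3 h1, zero_mul]
    · push Not at h1
      obtain ⟨a, ha, h1⟩ := h1
      rw [hg.3 fun b hb hb' => h (a + b) (T.add_mem ha hb) (by
        rw [map_add, add_add_add_comm, h1, hb']), mul_zero]

include hω in
theorem LowTerm.one : LowTerm m T ω (1 : MvPowerSeries σ A) 0 0 1 := by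
  classical
  refine ⟨fun a _ h => ?_, fun a ha h => ?_, fun h => ?_⟩
  · rw [zero_add, map_zero] at h
    exact absurd h (not_lt.2 (m.zero_le _))
  · rw [zero_add, ← map_zero ω] at h
    rw [hω a ha 0 T.zero_mem h, MvPowerSeries.coeff_zero_one]
  · exact absurd (by simp) (h 0 T.zero_mem)

include hT hω in
theorem LowTerm.prod {ι : Type*} (s : Finset ι) {f : ι → MvPowerSeries σ A}
    {p d : ι → Fin n →₀ ℕ} {c : ι → A} (h : ∀ i ∈ s, LowTerm m T ω (f i) (p i) (d i) (c i)) :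
    LowTerm m T ω (∏ i ∈ s, f i) (∑ i ∈ s, p i) (∑ i ∈ s, d i) (∏ i ∈ s, c i) := by
  classical
  induction s using Finset.induction_on with
  | empty => exact LowTerm.one hω
  | insert i s hi ih =>
    rw [Finset.prod_insert hi, Finset.sum_insert hi, Finset.sum_insert hi, Finset.prod_insert hi]
    exact (h i (Finset.mem_insert_self i s)).mul hT hω
      (ih fun j hj => h j (Finset.mem_insert_of_mem hj))

-- The offset of an entry is a row part plus a column part, so all products in the expansion have
-- the same total offset and the same lowest degree.
include hT hω in
theorem LowTerm.det {ι : Type*} [Fintype ι] [DecidableEq ι] {H : Matrix ι ι (MvPowerSeries σ A)}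
    {r s : ι → Fin n →₀ ℕ} {d : Fin n →₀ ℕ} {c : Matrix ι ι A}
    (h : ∀ i j, LowTerm m T ω (H i j) (r i + s j) d (c i j)) :
    LowTerm m T ω H.det (∑ i, r i + ∑ i, s i) (∑ _i : ι, d) c.det := by
  rw [Matrix.det_apply, Matrix.det_apply]
  refine LowTerm.sum _ fun τ _ => LowTerm.zsmul ?_ _
  have h1 : ∑ i, r i + ∑ i, s i = ∑ i, (r (τ i) + s i) := by
    rw [Finset.sum_add_distrib, Equiv.sum_comp τ r]
  rw [h1]
  exact LowTerm.prod hT hω _ fun i _ => h (τ i) i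

theorem LowTerm.ne_zero (hf : LowTerm m T ω f p d c) (hc : c ≠ 0) : f ≠ 0 := by
  rintro rfl
  refine hc (hf.3 fun a ha h => hc ?_)
  rw [← hf.2 a ha h, map_zero]

end lowTerm

/-! ### The lowest terms of the Gram matrix -/

theorem HasLead.degree_eq {R : Type*} [CommRing R] [Nontrivial R] {n : ℕ}
    {m : MonomialOrder (Fin n)} {f : MvPolynomial (Fin n) R} {a : Fin n →₀ ℕ}
    (h : HasLead m f a) : m.degree f = a :=
  m.toSyn.injective (le_antisymm h.1 (m.le_degree (mem_support_iff.2 (by rw [h.2]; simp))))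

theorem sum_xVar_hasLead {n : ℕ} (i : Fin n) :
    HasLead (revDegLex n) (∑ j ∈ Finset.range (i + 1), xVar n j) (Finsupp.single i 1) := by
  have hX : ∀ {j : ℕ} (hj : j < n), xVar n j = monomial (Finsupp.single ⟨j, hj⟩ 1) (1 : QRing n) :=
    fun hj => by rw [xVar, dif_pos hj]; rfl
  rw [Finset.sum_range_succ, add_comm]
  refine HasLead.add_of_lt ?_ ?_
  · rw [hX i.2]
    exact HasLead.monomial _
  · refine (revDegLex n).degree_sum_le.trans_lt ?_
    refine (Finset.sup_lt_iff ?_).2 fun j hj => ?_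
    · refine bot_le.trans_lt ((revDegLex n).toSyn_strictMono (a := 0) ?_)
      exact pos_iff_ne_zero.2 (by simp)
    · have hji := Finset.mem_range.1 hj
      rw [hX (hji.trans i.2)]
      exact ((revDegLex n).degree_monomial_le _).trans_lt (revDegLex_single_lt hji)

section gram
variable {n : ℕ} (W : Fin n → Equiv.Perm (Fin n))

/-- The exponents of the monomials in the variables `t_w`, `w = W i`, `i + 1 < n`. -/
def supportedExponents : AddSubmonoid (Equiv.Perm (Fin n) →₀ ℕ) where
  carrier := {a | ∀ w, (∀ i : Fin n, (i : ℕ) + 1 < n → W i ≠ w) → a w = 0}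
  zero_mem' _ _ := rfl
  add_mem' ha hb w hw := by rw [Finsupp.add_apply, ha w hw, hb w hw]

/-- The exponents of the variables `t_w`, `w = W i`, `i + 1 < n`. -/
def pullbackExponent : (Equiv.Perm (Fin n) →₀ ℕ) →+ (Fin n →₀ ℕ) where
  toFun a := Finsupp.equivFunOnFinite.symm fun i => if (i : ℕ) + 1 < n then a (W i) else 0
  map_zero' := by ext i; simp
  map_add' a b := by
    ext i
    simp only [Finsupp.equivFunOnFinite_symm_apply_apply, Finsupp.add_apply]
    split_ifs <;> rfl

theorem pullbackExponent_apply (a : Equiv.Perm (Fin n) →₀ ℕ) (i : Fin n) :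
    pullbackExponent W a i = if (i : ℕ) + 1 < n then a (W i) else 0 := rfl

theorem pullbackExponent_injOn {a b : Equiv.Perm (Fin n) →₀ ℕ} (ha : a ∈ supportedExponents W)
    (hb : b ∈ supportedExponents W) (h : pullbackExponent W a = pullbackExponent W b) : a = b := by
  ext w
  by_cases hw : ∀ i : Fin n, (i : ℕ) + 1 < n → W i ≠ w
  · rw [ha w hw, hb w hw]
  · push Not at hw
    obtain ⟨i, hi, rfl⟩ := hw
    simpa [pullbackExponent_apply, hi] using DFunLike.congr_fun h i

variable {W} (hW : ∀ i j : Fin n, (i : ℕ) + 1 < n → (j : ℕ) + 1 < n → W i = W j → i = j)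
include hW

theorem prod_supportedExponents {M : Type*} [CommMonoid M] (G : Equiv.Perm (Fin n) → ℕ → M)
    (hG : ∀ w, G w 0 = 1) {a : Equiv.Perm (Fin n) →₀ ℕ} (ha : a ∈ supportedExponents W) :
    ∏ w, G w (a w) = ∏ i, G (W i) (pullbackExponent W a i) := by
  have h1 : ∏ i, G (W i) (pullbackExponent W a i) =
      ∏ i ∈ Finset.univ.filter fun i : Fin n => (i : ℕ) + 1 < n, G (W i) (a (W i)) := by
    rw [Finset.prod_filter]
    refine Finset.prod_congr rfl fun i _ => ?_
    rw [pullbackExponent_apply]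
    split_ifs
    · rfl
    · exact hG _
  rw [h1, ← Finset.prod_image (g := W) (f := fun w => G w (a w)) fun i hi j hj h =>
    hW i j (Finset.mem_filter.1 hi).2 (Finset.mem_filter.1 hj).2 h]
  symm
  refine Finset.prod_subset (Finset.subset_univ _) fun w _ hw => ?_
  rw [ha w fun i hi h => hw (Finset.mem_image.2 ⟨i, by simpa using hi, h⟩), hG]

theorem exists_pullbackExponent_eq (k : Fin n →₀ ℕ) (hk : k ≤ staircase n) :
    ∃ a ∈ supportedExponents W, pullbackExponent W a = k := by
  classical
  refine ⟨∑ i ∈ Finset.univ.filter (fun i : Fin n => (i : ℕ) + 1 < n),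
    Finsupp.single (W i) (k i), ?_, ?_⟩
  · refine (supportedExponents W).sum_mem fun i hi => ?_
    intro w hw
    exact Finsupp.single_eq_of_ne (hw i (Finset.mem_filter.1 hi).2).symm
  · ext i
    rw [pullbackExponent_apply]
    split_ifs with h
    · rw [Finsupp.coe_finsetSum, Finset.sum_apply, Finset.sum_eq_single i]
      · simp
      · intro j hj hji
        exact Finsupp.single_eq_of_ne fun h' => hji (hW _ _ (Finset.mem_filter.1 hj).2 h h'.symm)
      · intro hi
        exact absurd (by simpa using h) hi
    -- The last variable needs no `t_w`: its exponent in the staircase is `0`.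
    · have h1 : k i ≤ n - 1 - i := hk i
      omega

/-- The coefficient of `t^a` is `1/a!` times the `x^δ`-coordinate of a polynomial with leading
monomial `x^{p + ω a}`. It vanishes when this is below `x^δ`; when they are equal it is `1/a!` with
exponents `δ - p`. -/
theorem kernelSeries_lowTerm
    (hS : ∀ i : Fin n, (i : ℕ) + 1 < n →
      HasLead (revDegLex n) (quantumSchubert (W i)) (Finsupp.single i 1)) (p : Fin n →₀ ℕ) :
    LowTerm (revDegLex n) (supportedExponents W) (pullbackExponent W)
      (kernelSeries (staircase n) (monomial p (1 : QRing n))) p (staircase n)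
      (algebraMap ℚ (QRing n) (∏ i, invFactorial (staircase n i) (p i) 0)) := by
  have hlead : ∀ a ∈ supportedExponents W, HasLead (revDegLex n)
      (monomial p (1 : QRing n) * ∏ w, quantumSchubert w ^ a w) (p + pullbackExponent W a) := by
    intro a ha
    refine (HasLead.monomial p).mul ?_
    rw [prod_supportedExponents hW (fun w k => quantumSchubert w ^ k) (fun w => pow_zero _) ha]
    have h1 : pullbackExponent W a = ∑ i, pullbackExponent W a i • Finsupp.single i 1 := by
      conv_lhs => rw [← Finsupp.univ_sum_single (pullbackExponent W a)]
      simp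
    conv => arg 3; rw [h1]
    refine HasLead.prod _ fun i _ => ?_
    by_cases hi : (i : ℕ) + 1 < n
    · exact (hS i hi).pow _
    · rw [pullbackExponent_apply, if_neg hi, pow_zero, zero_smul]
      exact HasLead.one
  have hcoeff : ∀ a, MvPowerSeries.coeff a
      (kernelSeries (staircase n) (monomial p (1 : QRing n))) =
      algebraMap ℚ (QRing n) ((∏ w, (a w).factorial : ℕ) : ℚ)⁻¹ * normalCoeff n (staircase n)
        (monomial p (1 : QRing n) * ∏ w, quantumSchubert w ^ a w) := by
    intro a
    rw [coeff_kernelSeries, coeff_expSeries, mul_smul_comm,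
      ← algebraMap_smul (QRing n) (((∏ w, (a w).factorial : ℕ) : ℚ)⁻¹), map_smul, smul_eq_mul]
  refine ⟨fun a ha h => ?_, fun a ha h => ?_, fun h => ?_⟩
  · have h0 : normalCoeff n (staircase n)
        (monomial p (1 : QRing n) * ∏ w, quantumSchubert w ^ a w) = 0 :=
      nfCoeff_eq_zero_of_lt _ ((hlead a ha).1.trans_lt h)
    rw [hcoeff, h0, mul_zero]
  · have hl := hlead a ha
    rw [h] at hl
    have h1 : normalCoeff n (staircase n)
        (monomial p (1 : QRing n) * ∏ w, quantumSchubert w ^ a w) = 1 :=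
      (nfCoeff_of_degree_le _ hl.1).trans hl.2
    rw [hcoeff, h1, mul_one]
    congr 1
    rw [Nat.cast_prod, prod_supportedExponents hW (fun w k => (k.factorial : ℚ)) (by simp) ha,
      ← Finset.prod_inv_distrib]
    refine Finset.prod_congr rfl fun i _ => ?_
    have h2 : p i + pullbackExponent W a i = staircase n i := DFunLike.congr_fun h i
    rw [invFactorial, if_pos (by omega), show staircase n i - (p i + 0) = pullbackExponent W a i by
      omega]
  -- If no exponent reaches `δ`, then `p` exceeds `δ` somewhere, and there `invFactorial` has its
  -- default value `0`.
  · have hp : ¬ p ≤ staircase n := by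
      intro hp
      obtain ⟨a, ha, h1⟩ := exists_pullbackExponent_eq hW (staircase n - p) tsub_le_self
      exact h a ha (by rw [h1, add_tsub_cancel_of_le hp])
    obtain ⟨i, hi⟩ : ∃ i, staircase n i < p i := by
      by_contra! h'
      exact hp h'
    rw [Finset.prod_eq_zero (Finset.mem_univ i), map_zero]
    rw [invFactorial, if_neg (by omega)]

end gram

/-- The exponent `c(v)` as a finitely supported function. -/
def codeExponent {n : ℕ} (v : Equiv.Perm (Fin n)) : Fin n →₀ ℕ :=
  Finsupp.equivFunOnFinite.symm (code v)

theorem codeExponent_le {n : ℕ} (v : Equiv.Perm (Fin n)) : codeExponent v ≤ staircase n :=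
  fun i => code_le v i

theorem det_kernelSeries_ne_zero {n : ℕ} (v : Equiv.Perm (Fin n)) :
    (Matrix.of fun a b : {u : Equiv.Perm (Fin n) // toLex (code u) ≤ toLex (code v)} =>
      kernelSeries (staircase n) (monomial (codeExponent a.1 + codeExponent b.1)
        (1 : QRing n))).det ≠ 0 := by
  have hex : ∀ i : Fin n, ∃ w : Equiv.Perm (Fin n), (i : ℕ) + 1 < n →
      quantumSchubert w = ∑ j ∈ Finset.range (i + 1), xVar n j := by
    intro i
    by_cases hi : (i : ℕ) + 1 < n
    · obtain ⟨w, hw⟩ := exists_quantumSchubert_eq_sum (Nat.succ_pos (i : ℕ)) hi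
      exact ⟨w, fun _ => hw⟩
    · exact ⟨1, fun h => absurd h hi⟩
  choose W hW using hex
  have hS : ∀ i : Fin n, (i : ℕ) + 1 < n →
      HasLead (revDegLex n) (quantumSchubert (W i)) (Finsupp.single i 1) := fun i hi => by
    rw [hW i hi]
    exact sum_xVar_hasLead i
  have hinj : ∀ i j : Fin n, (i : ℕ) + 1 < n → (j : ℕ) + 1 < n → W i = W j → i = j := by
    intro i j hi hj h
    have h1 := (hS i hi).degree_eq
    rw [h, (hS j hj).degree_eq] at h1
    exact (Finsupp.single_left_injective one_ne_zero h1).symm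
  refine (LowTerm.det (m := revDegLex n) (T := supportedExponents W) (ω := pullbackExponent W)
    (r := fun a => codeExponent a.1) (s := fun a => codeExponent a.1) (d := staircase n)
    (fun a b h w hw => ?_) (fun a ha b hb h => pullbackExponent_injOn W ha hb h)
    (c := (algebraMap ℚ (QRing n)).mapMatrix (Matrix.of fun a b :
      {u : Equiv.Perm (Fin n) // toLex (code u) ≤ toLex (code v)} =>
        ∏ i, invFactorial (staircase n i) (code a.1 i) (code b.1 i)))
    fun a b => ?_).ne_zero ?_
  · have := h w hw
    rw [Finsupp.add_apply] at this
    omega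
  · exact kernelSeries_lowTerm hinj hS _
  · rw [← RingHom.map_det, map_ne_zero_iff _ (FaithfulSMul.algebraMap_injective ℚ (QRing n))]
    -- An initial segment of the lexicographic order is closed under componentwise decrease, as
    -- required.
    refine det_invFactorial_ne_zero _ (fun u : {u : Equiv.Perm (Fin n) //
      toLex (code u) ≤ toLex (code v)} => code u.1) (fun x y h => Subtype.ext (code_injective h))
      (fun u => code_le u.1) fun u K hK => ?_
    obtain ⟨w, rfl⟩ := exists_code_eq K fun i => (hK i).trans (code_le u.1 i)
    exact ⟨⟨w, (Pi.toLex_monotone hK).trans u.2⟩, rfl⟩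

/-! ### Gram-Schmidt orthogonalization -/

section gramSchmidt
variable {ι κ K V : Type*} [Fintype ι] [LinearOrder κ] [WellFoundedLT κ] [Field K]
    [AddCommGroup V] [Module K V] (key : ι → κ) (B : LinearMap.BilinForm K V) (b : ι → V)

local notation "gs" => formGramSchmidt key (fun x y => B x y) b

/-- Unitriangularity with respect to `key`. It needs no assumption on the form, since the divisions
are total. -/
theorem exists_formGramSchmidt_eq_sum [DecidableEq ι] (v : ι) : ∃ c : ι → K,
    gs v = ∑ u, c u • b u ∧ ∀ u, ¬ key u < key v → c u = if u = v then 1 else 0 := by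
  induction hk : key v using WellFoundedLT.induction generalizing v with
  | ind k ih =>
    subst hk
    choose c hc hc' using fun u : {u : ι // key u < key v} => ih _ u.2 u.1 rfl
    let a : {u : ι // key u < key v} → K := fun u => B (b v) (gs u) / B (gs u) (gs u)
    refine ⟨fun i => (if i = v then 1 else 0) - ∑ u, a u * c u i, ?_, fun i hi => ?_⟩
    · rw [formGramSchmidt]
      simp only [sub_smul, Finset.sum_sub_distrib, Finset.sum_smul, ite_smul, one_smul, zero_smul,
        Finset.sum_ite_eq', Finset.mem_univ, if_true]
      rw [Finset.sum_comm]
      congr 1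
      refine Finset.sum_congr rfl fun u _ => ?_
      conv_lhs => rw [hc u, Finset.smul_sum]
      refine Finset.sum_congr rfl fun i _ => ?_
      rw [mul_smul, ← hc u]
    · dsimp only
      rw [Finset.sum_eq_zero, sub_zero]
      intro u _
      rw [hc' u i fun h => hi (h.trans u.2), if_neg, mul_zero]
      rintro rfl
      exact hi u.2

theorem mem_span_formGramSchmidt (v : ι) : b v ∈ Submodule.span K (gs '' {u | key u ≤ key v}) := by
  have h : b v = gs v + ∑ u : {u : ι // key u < key v},
      (B (b v) (gs u) / B (gs u) (gs u)) • gs u := by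
    conv_rhs => arg 1; rw [formGramSchmidt]
    exact (sub_add_cancel _ _).symm
  rw [h]
  refine add_mem (Submodule.subset_span ⟨v, le_refl (key v), rfl⟩)
    (Submodule.sum_mem _ fun u _ => Submodule.smul_mem _ _ (Submodule.subset_span ?_))
  exact ⟨u.1, u.2.le, rfl⟩

variable (hkey : Function.Injective key) (hB : ∀ x y, B x y = B y x)
  (hdet : ∀ v, ∀ [DecidableEq ι], (Matrix.of fun x y : {u : ι // key u ≤ key v} =>
    B (b x.1) (b y.1)).det ≠ 0)
include hkey hB hdet

/-- Orthogonality to the earlier vectors uses only that their norms are nonzero. If the norm of the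
vector at `v` vanished too, that vector would be orthogonal to all `b u` with `key u ≤ key v`. Its
coefficients, with a `1` at `v`, would then be a nontrivial relation among the rows of a Gram matrix
with nonzero determinant. -/
theorem formGramSchmidt_spec (v : ι) : B (gs v) (gs v) ≠ 0 ∧
    ∀ u, key u < key v → B (gs v) (gs u) = 0 := by
  classical
  induction hk : key v using WellFoundedLT.induction generalizing v with
  | ind k ih =>
    subst hk
    have horth : ∀ u, key u < key v → B (gs v) (gs u) = 0 := by
      intro u hu
      have hne := (ih _ hu u rfl).1
      rw [formGramSchmidt, map_sub, LinearMap.sub_apply, map_sum, LinearMap.sum_apply,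
        Finset.sum_eq_single ⟨u, hu⟩]
      · rw [map_smul, LinearMap.smul_apply, smul_eq_mul, div_mul_cancel₀ _ hne, sub_self]
      · intro x _ hx
        have h0 : B (gs x) (gs u) = 0 := by
          rcases lt_trichotomy (key x.1) (key u) with h | h | h
          · rw [hB]
            exact (ih _ hu u rfl).2 _ h
          · exact absurd (Subtype.ext (hkey h)) hx
          · exact (ih _ x.2 x.1 rfl).2 _ h
        rw [map_smul, LinearMap.smul_apply, h0, smul_zero]
      · intro h
        exact absurd (Finset.mem_univ _) h
    refine ⟨fun h0 => ?_, horth⟩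
    have hall : ∀ u, key u ≤ key v → B (gs v) (b u) = 0 := by
      intro u hu
      have hle : Submodule.span K (gs '' {x | key x ≤ key u}) ≤ LinearMap.ker (B (gs v)) := by
        rw [Submodule.span_le]
        rintro _ ⟨x, hx, rfl⟩
        rw [SetLike.mem_coe, LinearMap.mem_ker]
        rcases (le_trans hx hu : key x ≤ key v).lt_or_eq with h | h
        · exact horth x h
        · rw [hkey h, h0]
      exact hle (mem_span_formGramSchmidt key B b u)
    obtain ⟨c, hc, hc'⟩ := exists_formGramSchmidt_eq_sum key B b v
    refine hdet v (Matrix.exists_vecMul_eq_zero_iff.1 ⟨fun x => c x.1, fun h => ?_, ?_⟩)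
    · have := congrFun h ⟨v, le_rfl⟩
      dsimp only at this
      rw [hc' v (lt_irrefl _), if_pos rfl] at this
      exact one_ne_zero this
    · ext y
      rw [Pi.zero_apply, ← hall y.1 y.2, hc, map_sum, LinearMap.sum_apply, Matrix.vecMul,
        dotProduct]
      simp only [map_smul, LinearMap.smul_apply, smul_eq_mul, Matrix.of_apply]
      rw [← Finset.sum_subtype (Finset.univ.filter fun u => key u ≤ key v) (by simp)
        (fun u => c u * B (b u) (b y.1))]
      refine Finset.sum_subset (Finset.filter_subset _ _) fun x _ hx => ?_
      have hx' : ¬ key x ≤ key v := fun h => hx (by simpa using h)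
      rw [hc' x fun h => hx' h.le, if_neg, zero_mul]
      rintro rfl
      exact hx' le_rfl

theorem formGramSchmidt_orthogonal {u v : ι} (h : u ≠ v) : B (gs u) (gs v) = 0 := by
  rcases lt_or_gt_of_ne (fun h' => h (hkey h') : key u ≠ key v) with h' | h'
  · rw [hB]
    exact (formGramSchmidt_spec key B b hkey hB hdet v).2 u h'
  · exact (formGramSchmidt_spec key B b hkey hB hdet u).2 v h'

end gramSchmidt

/-! ### The main theorem -/

theorem pairing_monomial {n : ℕ} : ∃ c : TField n, c ≠ 0 ∧ ∀ p q : Fin n →₀ ℕ,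
    pairing (monomial p (1 : TField n)) (monomial q 1) = c *
      algebraMap (TRing n) (TField n) (kernelSeries (staircase n) (monomial (p + q) 1)) := by
  obtain ⟨c, hc, h⟩ := exists_grothendieckResidue_eq n
  refine ⟨c, fun h0 => ?_, fun p q => ?_⟩
  · have := congrArg (Int.cast (R := TField n)) hc
    rw [Int.cast_mul, h0, mul_zero, Int.cast_one] at this
    exact zero_ne_one this
  · rw [pairing, h, LinearMap.smul_apply, smul_eq_mul, monomial_mul, mul_one,
      ← normalCoeffF_map_mul_kernel le_rfl, map_monomial, map_one (toField n)]

theorem det_pairing_ne_zero {n : ℕ} (v : Equiv.Perm (Fin n)) [DecidableEq (Equiv.Perm (Fin n))] :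
    (Matrix.of fun a b : {u : Equiv.Perm (Fin n) // toLex (code u) ≤ toLex (code v)} =>
      pairingForm n (monomial (codeExponent a.1) 1) (monomial (codeExponent b.1) 1)).det ≠ 0 := by
  obtain ⟨c, hc, h⟩ := pairing_monomial (n := n)
  have h1 : (Matrix.of fun a b : {u : Equiv.Perm (Fin n) // toLex (code u) ≤ toLex (code v)} =>
      pairingForm n (monomial (codeExponent a.1) 1) (monomial (codeExponent b.1) 1)) =
      c • (algebraMap (TRing n) (TField n)).mapMatrix (Matrix.of fun a b :
        {u : Equiv.Perm (Fin n) // toLex (code u) ≤ toLex (code v)} =>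
          kernelSeries (staircase n) (monomial (codeExponent a.1 + codeExponent b.1)
            (1 : QRing n))) := by
    ext a b
    exact h _ _
  rw [h1, Matrix.det_smul, ← RingHom.map_det]
  refine mul_ne_zero (pow_ne_zero _ hc) fun h0 => ?_
  have h2 := det_kernelSeries_ne_zero v
  refine h2 ?_
  rw [← map_zero (algebraMap (TRing n) (TField n))] at h0
  convert IsFractionRing.injective (TRing n) (TField n) h0

theorem Xt_eq {n : ℕ} (v : Equiv.Perm (Fin n)) :
    Xt v = formGramSchmidt (fun v : Equiv.Perm (Fin n) => toLex (code v))
      (fun x y => pairingForm n x y) (fun v => monomial (codeExponent v) 1) v := rfl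

theorem normF_ne_zero {n : ℕ} (v : Equiv.Perm (Fin n)) : normF v ≠ 0 := by
  rw [normF, Xt_eq, ← pairingForm_apply]
  exact (formGramSchmidt_spec (fun v : Equiv.Perm (Fin n) => toLex (code v)) (pairingForm n)
    (fun v => monomial (codeExponent v) 1) (fun _ _ h => code_injective (toLex.injective h))
    pairing_comm (fun v _ => det_pairing_ne_zero v) v).1

theorem pairing_Xt_of_ne {n : ℕ} {u v : Equiv.Perm (Fin n)} (h : u ≠ v) :
    pairing (Xt u) (Xt v) = 0 := by
  rw [Xt_eq, Xt_eq, ← pairingForm_apply]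
  exact formGramSchmidt_orthogonal (fun v : Equiv.Perm (Fin n) => toLex (code v)) (pairingForm n)
    (fun v => monomial (codeExponent v) 1) (fun _ _ h => code_injective (toLex.injective h))
    pairing_comm (fun v _ => det_pairing_ne_zero v) h

theorem pairing_sum_Xt {n : ℕ} (c : Equiv.Perm (Fin n) → TField n) (v : Equiv.Perm (Fin n)) :
    pairing (∑ u, c u • Xt u) (Xt v) = c v * normF v := by
  rw [← pairingForm_apply, map_sum, LinearMap.sum_apply, Finset.sum_eq_single v]
  · rw [map_smul]
    rfl
  · intro u _ h
    rw [map_smul, LinearMap.smul_apply, pairingForm_apply, pairing_Xt_of_ne h, smul_zero]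
  · intro h
    exact absurd (Finset.mem_univ v) h

/-- The exponents `≤ δ_n` are exactly the codes, and each monomial `x^{c(v)}` lies in the span of
the Gram–Schmidt vectors. -/
theorem exists_sum_Xt_eq {n : ℕ} (f : MvPolynomial (Fin n) (TField n))
    (hf : ∀ k, coeff k f ≠ 0 → k ≤ staircase n) :
    ∃ c : Equiv.Perm (Fin n) → TField n, f = ∑ u, c u • Xt u := by
  suffices h : f ∈ Submodule.span (TField n) (Set.range (Xt (n := n))) by
    obtain ⟨c, hc⟩ := (Submodule.mem_span_range_iff_exists_fun _).1 h
    exact ⟨c, hc.symm⟩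
  rw [f.as_sum]
  refine Submodule.sum_mem _ fun k hk => ?_
  obtain ⟨v, hv⟩ := exists_code_eq (k : Fin n → ℕ) (hf k (mem_support_iff.1 hk))
  have hkv : k = codeExponent v := by
    ext i
    exact congrFun hv.symm i
  rw [← mul_one (coeff k f), ← smul_eq_mul, ← smul_monomial, hkv]
  refine Submodule.smul_mem _ _ ?_
  exact Submodule.span_mono (Set.image_subset_range _ _)
    (mem_span_formGramSchmidt (fun v : Equiv.Perm (Fin n) => toLex (code v)) (pairingForm n)
      (fun v => monomial (codeExponent v) 1) v)

/-- Needed for `M_w`, which is defined by an equality of polynomials: the derivative of `X_v^t` must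
stay in the span of the `x^I`, `I ⊆ δ_n`. -/
theorem coeff_Xt_ne_zero {n : ℕ} {v : Equiv.Perm (Fin n)} {k : Fin n →₀ ℕ}
    (h : coeff k (Xt v) ≠ 0) : k ≤ staircase n := by
  obtain ⟨c, hc, -⟩ := exists_formGramSchmidt_eq_sum
    (fun v : Equiv.Perm (Fin n) => toLex (code v)) (pairingForm n)
      (fun v => monomial (codeExponent v) 1) v
  rw [Xt_eq, hc, coeff_sum] at h
  obtain ⟨u, _, hu⟩ := Finset.exists_ne_zero_of_sum_ne_zero h
  rw [coeff_smul, coeff_monomial] at hu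
  split_ifs at hu with h1
  · rw [← h1]
    exact codeExponent_le u
  · simp at hu

theorem exists_isMulMatrix {n : ℕ} (w : Equiv.Perm (Fin n)) : ∃ L, IsMulMatrix w L := by
  have h : ∀ f : MvPolynomial (Fin n) (TField n), ∃ c : Equiv.Perm (Fin n) → TField n,
      f - ∑ u, c u • Xt u ∈ qIdealF n := by
    intro f
    obtain ⟨c, hc⟩ := exists_sum_Xt_eq
      (∑ k ∈ Finset.Iic (staircase n), normalCoeffF n k f • monomial k (1 : TField n)) (by
        intro j hj
        rw [coeff_sum] at hj
        obtain ⟨k, hk, hkj⟩ := Finset.exists_ne_zero_of_sum_ne_zero hj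
        rw [coeff_smul, coeff_monomial] at hkj
        split_ifs at hkj with h1
        · rw [← h1]
          exact Finset.mem_Iic.1 hk
        · simp at hkj)
    exact ⟨c, hc ▸ sub_normalFormF_mem f⟩
  choose L hL using fun v => h (quantumSchubertF w * Xt v)
  exact ⟨Matrix.of L, fun v => Ideal.Quotient.eq.2 (hL v)⟩

theorem IsMulMatrix.mul_normF {n : ℕ} {w : Equiv.Perm (Fin n)}
    {L : Matrix (Equiv.Perm (Fin n)) (Equiv.Perm (Fin n)) (TField n)} (h : IsMulMatrix w L)
    (v u : Equiv.Perm (Fin n)) :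
    L v u * normF u = pairing (quantumSchubertF w * Xt v) (Xt u) := by
  have h1 := pairing_of_mem (Ideal.Quotient.eq.1 (h v)) (Xt u)
  rw [← pairingForm_apply, map_sub, LinearMap.sub_apply, sub_eq_zero] at h1
  rw [← pairing_sum_Xt]
  exact h1.symm

theorem exists_isDerivMatrix {n : ℕ} (w : Equiv.Perm (Fin n)) : ∃ M, IsDerivMatrix w M := by
  choose M hM using fun v : Equiv.Perm (Fin n) => exists_sum_Xt_eq (tDerivPoly w (Xt v))
    fun k hk => coeff_Xt_ne_zero (v := v) fun h0 => hk (by rw [coeff_tDerivPoly, h0, tDeriv_zero])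
  exact ⟨Matrix.of M, hM⟩

theorem IsDerivMatrix.mul_normF {n : ℕ} {w : Equiv.Perm (Fin n)}
    {M : Matrix (Equiv.Perm (Fin n)) (Equiv.Perm (Fin n)) (TField n)} (h : IsDerivMatrix w M)
    (v u : Equiv.Perm (Fin n)) : M v u * normF u = pairing (tDerivPoly w (Xt v)) (Xt u) := by
  rw [h v, pairing_sum_Xt]

end FlagLax

end

theorem lemmal2p12 (n : ℕ) :
    (∀ v : Equiv.Perm (Fin n), FlagLax.normF v ≠ 0) ∧
    (∀ u v : Equiv.Perm (Fin n), u ≠ v → FlagLax.pairing (FlagLax.Xt u) (FlagLax.Xt v) = 0) ∧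
    ∀ w : Equiv.Perm (Fin n),
      (∃! L, FlagLax.IsMulMatrix w L) ∧
      (∃! M, FlagLax.IsDerivMatrix w M) ∧
      ∀ L M : Matrix (Equiv.Perm (Fin n)) (Equiv.Perm (Fin n)) (FlagLax.TField n),
        FlagLax.IsMulMatrix w L → FlagLax.IsDerivMatrix w M →
          (L * FlagLax.diagF n).IsSymm ∧
          FlagLax.IsSymmetrizable L ∧
          M * FlagLax.diagF n + (M * FlagLax.diagF n).transpose + L * FlagLax.diagF n
            = (FlagLax.diagF n).map (FlagLax.tDeriv w) := by
  refine ⟨FlagLax.normF_ne_zero, fun u v => FlagLax.pairing_Xt_of_ne, fun w => ⟨?_, ?_, ?_⟩⟩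
  · obtain ⟨L, hL⟩ := FlagLax.exists_isMulMatrix w
    refine ⟨L, hL, fun L' hL' => ?_⟩
    ext v u
    exact mul_right_cancel₀ (FlagLax.normF_ne_zero u) ((hL'.mul_normF v u).trans
      (hL.mul_normF v u).symm)
  · obtain ⟨M, hM⟩ := FlagLax.exists_isDerivMatrix w
    refine ⟨M, hM, fun M' hM' => ?_⟩
    ext v u
    exact mul_right_cancel₀ (FlagLax.normF_ne_zero u) ((hM'.mul_normF v u).trans
      (hM.mul_normF v u).symm)
  · intro L M hL hM
    have hsymm : (L * FlagLax.diagF n).IsSymm := by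
      ext v u
      rw [Matrix.transpose_apply, FlagLax.diagF, Matrix.mul_diagonal, Matrix.mul_diagonal,
        hL.mul_normF, hL.mul_normF, FlagLax.pairing_mul_left, FlagLax.pairing_comm]
    refine ⟨hsymm, ⟨FlagLax.normF, FlagLax.normF_ne_zero, hsymm⟩, ?_⟩
    ext u v
    rw [Matrix.add_apply, Matrix.add_apply, Matrix.transpose_apply, Matrix.map_apply,
      FlagLax.diagF, Matrix.mul_diagonal, Matrix.mul_diagonal, Matrix.mul_diagonal, hM.mul_normF,
      hM.mul_normF, hL.mul_normF, FlagLax.pairing_comm (FlagLax.tDerivPoly w (FlagLax.Xt v)),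
      ← FlagLax.tDeriv_pairing]
    -- The left side has become `∂⟨X_u, X_v⟩`, which is `∂F_u` on the diagonal and `∂0` off it.
    by_cases h : u = v
    · subst h
      rw [Matrix.diagonal_apply_eq]
      rfl
    · rw [Matrix.diagonal_apply_ne _ h, FlagLax.pairing_Xt_of_ne h]
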